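/- **Theorem (local well-posedness).** Consider, for real-valued $u=u(x,t)$ and a constant $\mu>0$, the Kuramoto–Sivashinsky initial value problem $$u_t-\partial_x^2u-\mu(1-\partial_x^2)^{-1/2}u-\tfrac12(\partial_xu)^2=0,\quad x\in\mathbb R,\ t\ge 0,\qquad u(x,0)=\phi(x).\tag{1}$$ Let $\hat f(\xi)=\int_{\mathbb R}e^{-i\xi x}f(x)\,dx$ and $\|f\|_{H^s}=\|(1+\xi^2)^{s/2}\hat f\|_{L^2_\xi}$, let $H^s=H^s(\mathbb R)$ be the space of real-valued functions with finite norm, and put $H^\infty=\bigcap_r H^r$ with the topology of all the norms $\|\cdot\|_{H^r}$. Let $\Phi(\xi)=-\xi^2+\mu(1+\xi^2)^{-1/2}$ and let $E_\mu(t)$ be given by $(E_\mu(t)\psi)^\wedge(\xi)=e^{t\Phi(\xi)}\hat\psi(\xi)$. For $s>1/2$ and $T>0$ let $\mathcal X_T^s$ be the space of all $u\in C([0,T];H^s)$ with $$\|u\|_{\mathcal X_T^s}=\sup_{t\in[0,T]}\Big(\|u(t)\|_{H^s}+t^{\frac{(1-s)_+}{2}}\|\partial_xu(t)\|_{L^2}\Big)<\infty,\qquad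 (1-s)_+=\max(1-s,0),$$ where, for $s<1$, the second term is read as $0$ at $t=0$. A *solution* of (1) in $\mathcal X_T^s$ is a $u\in\mathcal X_T^s$ with $$u(t)=E_\mu(t)\phi+\tfrac12\int_0^tE_\mu(t-\tau)(\partial_xu)^2(\tau)\,d\tau,\qquad t\in[0,T].\tag{2}$$ Let $\mu>0$ and $s>1/2$. Then $\mathcal X_T^s\hookrightarrow C([0,T];H^s)$ continuously, with $\sup_{[0,T]}\|u(t)\|_{H^s}\le\|u\|_{\mathcal X_T^s}$, and there is a function $r\mapsto T(r)\in(0,1]$ on $[0,\infty)$, depending only on $\mu$ and $s$, such that for every $r\ge0$ there are $\rho>r$ and a map $S:\{\phi\in H^s:\|\phi\|_{H^s}<\rho\}\to\mathcal X_T^s$, $T=T(r)$, with the following properties. (So for every $\phi\in H^s$ they hold with $T=T(\|\phi\|_{H^s})$ on a neighbourhood of $\phi$.) 1. For every $\phi\in H^s$ with $\|\phi\|_{H^s}<\rho$, $u=S(\phi)$ is a solution of (1) in $\mathcal X_T^s$. It also satisfies the differential equation for $0<t\le T$: all terms are in $L^2(\mathbb R)$, and $u_t$ is the derivative of $u:[0,T]\to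 L^2(\mathbb R)$ (one-sided at $T$). 2. $S(\phi)$ is the only solution in $\mathcal X_T^s$, both of (2) and of (1) in the sense of item 1 with $u(0)=\phi$. 3. The data-to-solution map $S$ is smooth ($C^\infty$ in the Fréchet sense) from $\{\|\phi\|_{H^s}<\rho\}\subset H^s$ to $\mathcal X_T^s$, hence to $C([0,T];H^s)$. 4. $S(\phi)\in C((0,T];H^\infty(\mathbb R))$. 5. If $s'>s$ and moreover $\phi\in H^{s'}$, then $S(\phi)$ belongs to $\mathcal X_T^{s'}\subset C([0,T];H^{s'})$, with the same $T=T(r)$, and is a solution of (1) there. -/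

import Mathlib

open MeasureTheory Set Filter Topology
open scoped ENNReal FourierTransform SchwartzMap LineDeriv ContDiff

noncomputable section

namespace KS

/-! ### Spaces of finite extended norm -/

/-- An extended norm on a real vector space: a norm that may take the value `∞`. -/
structure ExtNorm (V : Type) [AddCommGroup V] [Module ℝ V] where
  toFun : V → ℝ≥0∞
  eq_zero : ∀ x, toFun x = 0 → x = 0
  zero : toFun 0 = 0
  add_le : ∀ x y, toFun (x + y) ≤ toFun x + toFun y
  smul_le : ∀ (c : ℝ) x, toFun (c • x) ≤ ‖c‖ₑ * toFun x

namespace ExtNorm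

variable {V : Type} [AddCommGroup V] [Module ℝ V]

/-- The subspace on which an extended norm is finite. -/
def finite (N : ExtNorm V) : Submodule ℝ V where
  carrier := {x | N.toFun x < ⊤}
  add_mem' {x y} hx hy := (N.add_le x y).trans_lt (ENNReal.add_lt_top.2 ⟨hx, hy⟩)
  zero_mem' := by simp [N.zero]
  smul_mem' c x hx := (N.smul_le c x).trans_lt (ENNReal.mul_lt_top (by simp) hx)

/-- The normed space `{x ∈ V : N x < ∞}` with the norm `N`. -/
def Space (N : ExtNorm V) : Type := N.finite

instance (N : ExtNorm V) : AddCommGroup N.Space := inferInstanceAs (AddCommGroup N.finite)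
instance (N : ExtNorm V) : Module ℝ N.Space := inferInstanceAs (Module ℝ N.finite)

/-- The inclusion of `{x ∈ V : N x < ⊤}` in `V`. -/
def incl (N : ExtNorm V) : N.Space →ₗ[ℝ] V := N.finite.subtype

instance (N : ExtNorm V) : Norm N.Space := ⟨fun x => (N.toFun (N.incl x)).toReal⟩

theorem norm_def (N : ExtNorm V) (x : N.Space) : ‖x‖ = (N.toFun (N.incl x)).toReal := rfl

theorem incl_lt_top (N : ExtNorm V) (x : N.Space) : N.toFun (N.incl x) < ⊤ := x.2

theorem smul_eq (N : ExtNorm V) (c : ℝ) (x : V) : N.toFun (c • x) = ‖c‖ₑ * N.toFun x := by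
  refine le_antisymm (N.smul_le c x) ?_
  by_cases hc : c = 0
  · simp [hc]
  · have h := N.smul_le c⁻¹ (c • x)
    rw [smul_smul, inv_mul_cancel₀ hc, one_smul] at h
    calc ‖c‖ₑ * N.toFun x ≤ ‖c‖ₑ * (‖c⁻¹‖ₑ * N.toFun (c • x)) := by gcongr
      _ = ‖c * c⁻¹‖ₑ * N.toFun (c • x) := by rw [enorm_mul, mul_assoc]
      _ = N.toFun (c • x) := by rw [mul_inv_cancel₀ hc]; simp

theorem core (N : ExtNorm V) : NormedSpace.Core ℝ N.Space where
  norm_nonneg x := ENNReal.toReal_nonneg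
  norm_smul c x := by
    rw [norm_def, norm_def, map_smul, smul_eq, ENNReal.toReal_mul]; simp
  norm_triangle x y := by
    rw [norm_def, norm_def, norm_def, map_add,
      ← ENNReal.toReal_add (N.incl_lt_top x).ne (N.incl_lt_top y).ne]
    exact ENNReal.toReal_mono
      (ENNReal.add_lt_top.2 ⟨N.incl_lt_top x, N.incl_lt_top y⟩).ne (N.add_le _ _)
  norm_eq_zero_iff x := by
    rw [norm_def]
    constructor
    · intro h
      rcases (ENNReal.toReal_eq_zero_iff _).1 h with h | h
      · exact Subtype.ext (N.eq_zero _ h)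
      · exact absurd h (N.incl_lt_top x).ne
    · rintro rfl
      simp [N.zero]

instance (N : ExtNorm V) : NormedAddCommGroup N.Space := NormedAddCommGroup.ofCore N.core
instance (N : ExtNorm V) : NormedSpace ℝ N.Space := NormedSpace.ofCore N.core

end ExtNorm

/-! ### The Fourier transform and Sobolev spaces -/

/-- `L²(ℝ)`, real-valued. -/
abbrev L2 : Type := Lp ℝ 2 (volume : Measure ℝ)

/-- The inclusion of the real-valued `L²` functions in the complex-valued ones. -/
def toC : L2 →L[ℝ] Lp ℂ 2 (volume : Measure ℝ) := Complex.ofRealCLM.compLpL 2 volume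

/-- The Fourier transform `f̂(ξ) = ∫ e^{-iξx} f(x) dx` of `f ∈ L²(ℝ)`. Mathlib's transform `𝓕`
has the kernel `e^{-2πixη}`, so that `f̂(ξ) = (𝓕 f)(ξ / 2π)`. -/
def hat (f : L2) (ξ : ℝ) : ℂ := (𝓕 (toC f) : Lp ℂ 2 (volume : Measure ℝ)) (ξ / (2 * Real.pi))

/-- The Fourier transform `∫ e^{-iξx} f(x) dx` of an integrable real function. -/
def hatL1 (f : ℝ → ℝ) (ξ : ℝ) : ℂ := ∫ x : ℝ, Complex.exp (-Complex.I * ξ * x) * (f x : ℂ)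

theorem hat_qmp : Measure.QuasiMeasurePreserving (fun ξ : ℝ => ξ / (2 * Real.pi)) := by
  refine ⟨by fun_prop, ?_⟩
  have h : (2 * Real.pi)⁻¹ ≠ 0 := by positivity
  simp only [div_eq_mul_inv]
  rw [Real.map_volume_mul_right h]
  exact Measure.smul_absolutelyContinuous

theorem hat_aestronglyMeasurable (f : L2) : AEStronglyMeasurable (hat f) volume :=
  (Lp.aestronglyMeasurable (𝓕 (toC f) : Lp ℂ 2 (volume : Measure ℝ))).comp_quasiMeasurePreserving
    hat_qmp

theorem hat_add (f g : L2) : hat (f + g) =ᵐ[volume] hat f + hat g := by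
  have h := hat_qmp.ae_eq_comp (Lp.coeFn_add (𝓕 (toC f)) (𝓕 (toC g)))
  have e : 𝓕 (toC (f + g)) = 𝓕 (toC f) + 𝓕 (toC g) := by
    rw [map_add, FourierTransform.fourier_add]
  filter_upwards [h] with ξ hξ
  simp only [hat, e, Pi.add_apply]
  exact hξ

theorem toC_smul (c : ℝ) (f : L2) : toC (c • f) = (c : ℂ) • toC f := by
  rw [map_smul]; rfl

theorem hat_smul (c : ℝ) (f : L2) : hat (c • f) =ᵐ[volume] c • hat f := by
  have h := hat_qmp.ae_eq_comp (Lp.coeFn_smul (c : ℂ) (𝓕 (toC f)))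
  have e : 𝓕 (toC (c • f)) = (c : ℂ) • 𝓕 (toC f) := by
    rw [toC_smul, FourierTransform.fourier_smul]
  filter_upwards [h] with ξ hξ
  simp only [hat, e, Pi.smul_apply]
  exact hξ

theorem toC_injective : Function.Injective toC := by
  intro f g h
  apply Lp.ext
  have hf := Complex.ofRealCLM.coeFn_compLp f
  have hg := Complex.ofRealCLM.coeFn_compLp g
  have h' : Complex.ofRealCLM.compLp f = Complex.ofRealCLM.compLp g := h
  rw [h'] at hf
  filter_upwards [hf, hg] with x h1 h2
  have := h1.symm.trans h2
  simpa using this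

theorem eq_zero_of_hat (f : L2) (h : hat f =ᵐ[volume] 0) : f = 0 := by
  have q : Measure.QuasiMeasurePreserving (fun ξ : ℝ => ξ * (2 * Real.pi)) := by
    refine ⟨by fun_prop, ?_⟩
    have h : (2 * Real.pi) ≠ 0 := by positivity
    rw [Real.map_volume_mul_right h]
    exact Measure.smul_absolutelyContinuous
  have h2 := q.ae_eq_comp h
  have h3 : 𝓕 (toC f) = 0 := by
    rw [Lp.eq_zero_iff_ae_eq_zero]
    filter_upwards [h2] with ξ hξ
    have hp : (2 * Real.pi) ≠ 0 := by positivity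
    simpa [hat, Function.comp, mul_div_assoc, div_self hp] using hξ
  have h4 : toC f = 0 := by
    rw [← norm_eq_zero, ← Lp.norm_fourier_eq, h3, norm_zero]
  exact toC_injective (h4.trans (map_zero toC).symm)

/-- The extended norm `‖f‖_{H^s} = ‖⟨ξ⟩^s f̂‖_{L²_ξ}`, `⟨ξ⟩ = (1 + ξ²)^{1/2}`. -/
def sobNorm (s : ℝ) : ExtNorm L2 where
  toFun f := eLpNorm (fun ξ : ℝ => (1 + ξ ^ 2) ^ (s / 2) • hat f ξ) 2 volume
  eq_zero f hf := by
    apply eq_zero_of_hat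
    have hm : AEStronglyMeasurable (fun ξ : ℝ => (1 + ξ ^ 2) ^ (s / 2) • hat f ξ) volume :=
      (by fun_prop : Measurable fun ξ : ℝ => (1 + ξ ^ 2) ^ (s / 2)).aestronglyMeasurable.smul
        (hat_aestronglyMeasurable f)
    rw [eLpNorm_eq_zero_iff hm (by norm_num)] at hf
    filter_upwards [hf] with ξ hξ
    have : (0 : ℝ) < (1 + ξ ^ 2) ^ (s / 2) := by positivity
    simpa [this.ne'] using hξ
  zero := by
    have h : hat 0 =ᵐ[volume] 0 := by simpa using hat_smul 0 0
    rw [eLpNorm_congr_ae (g := 0), eLpNorm_zero]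
    filter_upwards [h] with ξ hξ
    simp [hξ]
  add_le f g := by
    have hm (f : L2) : AEStronglyMeasurable (fun ξ : ℝ => (1 + ξ ^ 2) ^ (s / 2) • hat f ξ) volume :=
      (by fun_prop : Measurable fun ξ : ℝ => (1 + ξ ^ 2) ^ (s / 2)).aestronglyMeasurable.smul
        (hat_aestronglyMeasurable f)
    refine le_of_eq_of_le (eLpNorm_congr_ae ?_) (eLpNorm_add_le (hm f) (hm g) (by norm_num))
    filter_upwards [hat_add f g] with ξ hξ
    simp [hξ]
  smul_le c f := by
    refine le_of_eq (Eq.trans (eLpNorm_congr_ae ?_) (eLpNorm_const_smul c _ _ _))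
    filter_upwards [hat_smul c f] with ξ hξ
    simp only [hξ, Pi.smul_apply]
    rw [smul_comm]

/-- The space `H^s(ℝ)` of real-valued functions, for `s ≥ 0`, with the norm `‖⟨ξ⟩^s f̂‖_{L²}`. -/
abbrev Sob (s : ℝ) : Type := (sobNorm s).Space

/-- The element of `L²(ℝ)` underlying an element of `H^s(ℝ)`. -/
abbrev Sob.toL2 {s : ℝ} (f : Sob s) : L2 := (sobNorm s).incl f

/-- `g ∈ L²` is the derivative of `f ∈ L²` in the sense of (tempered) distributions. -/
def HasWeakDeriv (f g : L2) : Prop :=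
  ∂_{(1 : ℝ)} (Lp.toTemperedDistributionCLM ℂ volume 2 (toC f) : 𝓢'(ℝ, ℂ)) =
    Lp.toTemperedDistributionCLM ℂ volume 2 (toC g)

theorem HasWeakDeriv.add {f g f' g' : L2} (hf : HasWeakDeriv f f') (hg : HasWeakDeriv g g') :
    HasWeakDeriv (f + g) (f' + g') := by
  unfold HasWeakDeriv at *
  rw [map_add, map_add, map_add, map_add, LineDeriv.lineDerivOp_add, hf, hg]

theorem HasWeakDeriv.smul {f f' : L2} (c : ℝ) (hf : HasWeakDeriv f f') :
    HasWeakDeriv (c • f) (c • f') := by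
  unfold HasWeakDeriv at *
  rw [toC_smul, toC_smul, map_smul, map_smul, LineDeriv.lineDerivOp_smul, hf]

/-- `‖∂ₓf‖_{L²}`, which is `∞` when the distribution `∂ₓf` is not in `L²`. -/
def dxNorm (f : L2) : ℝ≥0∞ := ⨅ (g : L2) (_ : HasWeakDeriv f g), ‖g‖ₑ

theorem dxNorm_add (f g : L2) : dxNorm (f + g) ≤ dxNorm f + dxNorm g := by
  simp only [dxNorm, ENNReal.iInf_add, ENNReal.add_iInf]
  simp only [le_iInf_iff]
  intro g' hg f' hf
  exact iInf₂_le_of_le (f' + g') (hf.add hg) (enorm_add_le _ _)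

theorem dxNorm_zero : dxNorm 0 = 0 := by
  refine le_antisymm ?_ zero_le
  have h : HasWeakDeriv 0 0 := by
    unfold HasWeakDeriv
    rw [map_zero, map_zero]
    exact map_zero (LineDeriv.lineDerivOpCLM ℂ 𝓢'(ℝ, ℂ) (1 : ℝ))
  exact (iInf₂_le (0 : L2) h).trans (by simp)

theorem dxNorm_smul (c : ℝ) (f : L2) : dxNorm (c • f) ≤ ‖c‖ₑ * dxNorm f := by
  by_cases hc : c = 0
  · simp [hc, dxNorm_zero]
  · have h0 : ‖c‖ₑ ≠ 0 := by simpa using hc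
    have ht : ‖c‖ₑ ≠ ⊤ := by simp
    simp only [dxNorm, ENNReal.mul_iInf_of_ne h0 ht]
    refine le_iInf fun f' => le_iInf fun hf => ?_
    exact (iInf₂_le (c • f') (hf.smul c)).trans (by rw [enorm_smul])

/-! ### The time-weighted space -/

/-- The exponent `(1 - s)₊ / 2` of the time weight; there is no weight for `s ≥ 1`. -/
def weightExp (s : ℝ) : ℝ := max ((1 - s) / 2) 0

/-- The extended norm `sup_{t ∈ [0,T]} (‖u(t)‖_{H^s} + t^{(1-s)₊/2} ‖∂ₓu(t)‖_{L²})` on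
`C([0,T]; H^s)`. -/
def xNorm (s T : ℝ) : ExtNorm C(Icc (0 : ℝ) T, Sob s) where
  toFun u := ⨆ t : Icc (0 : ℝ) T,
    (‖u t‖ₑ + ENNReal.ofReal ((t : ℝ) ^ weightExp s) * dxNorm (u t).toL2)
  eq_zero u hu := by
    ext t
    have h := (ENNReal.iSup_eq_zero.1 hu t)
    rw [add_eq_zero] at h
    simpa using h.1
  zero := by simp [dxNorm_zero]
  add_le u v := by
    refine iSup_le fun t => ?_
    refine le_trans ?_ (add_le_add (le_iSup _ t) (le_iSup _ t))
    have h := dxNorm_add (u t).toL2 (v t).toL2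
    have h' := enorm_add_le (u t) (v t)
    simp only [ContinuousMap.add_apply, Sob.toL2, map_add] at *
    calc _ ≤ (‖u t‖ₑ + ‖v t‖ₑ) + ENNReal.ofReal ((t : ℝ) ^ weightExp s) *
          (dxNorm ((sobNorm s).incl (u t)) + dxNorm ((sobNorm s).incl (v t))) := by gcongr
      _ = _ := by ring
  smul_le c u := by
    refine iSup_le fun t => ?_
    refine le_trans ?_ (mul_le_mul_right (le_iSup _ t) _)
    have h := dxNorm_smul c (u t).toL2
    simp only [ContinuousMap.smul_apply, Sob.toL2, map_smul, enorm_smul] at *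
    calc _ ≤ ‖c‖ₑ * ‖u t‖ₑ + ENNReal.ofReal ((t : ℝ) ^ weightExp s) *
          (‖c‖ₑ * dxNorm ((sobNorm s).incl (u t))) := by gcongr
      _ = _ := by ring

/-- The space `X_T^s` of all `u ∈ C([0,T]; H^s(ℝ))` with
`sup_{t ∈ [0,T]} (‖u(t)‖_{H^s} + t^{(1-s)₊/2} ‖∂ₓu(t)‖_{L²}) < ∞`. -/
abbrev XSpace (s T : ℝ) : Type := (xNorm s T).Space

/-- The element of `C([0,T]; H^s)` underlying an element of `X_T^s`. -/
abbrev XSpace.toCont {s T : ℝ} (u : XSpace s T) : C(Icc (0 : ℝ) T, Sob s) := (xNorm s T).incl u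

/-- The function `t ↦ u(t) ∈ L²(ℝ)`, extended by zero outside `[0,T]`. -/
def XSpace.traj {s T : ℝ} (u : XSpace s T) (t : ℝ) : L2 :=
  open Classical in if h : t ∈ Icc (0 : ℝ) T then (u.toCont ⟨t, h⟩).toL2 else 0

/-! ### The Kuramoto-Sivashinsky equation -/

/-- The symbol `Φ(ξ) = -ξ² + μ (1 + ξ²)^{-1/2}` of the linear part `∂ₓ² + μ (1 - ∂ₓ²)^{-1/2}`. -/
def symb (μ ξ : ℝ) : ℝ := -ξ ^ 2 + μ / (1 + ξ ^ 2) ^ (1 / 2 : ℝ)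

/-- `u` solves the initial value problem on `[0,T]` in Duhamel form,
`u(t) = E_μ(t) φ + ½ ∫₀ᵗ E_μ(t - τ) (∂ₓu)²(τ) dτ`, where `(E_μ(t) ψ)^ = e^{tΦ} ψ̂`. The equation
is written for the Fourier transforms; `v` is `∂ₓu`. -/
def IsSolution (μ T : ℝ) (φ : L2) (u : ℝ → L2) : Prop :=
  ∃ v : ℝ → L2, (∀ t ∈ Ioc 0 T, HasWeakDeriv (u t) (v t)) ∧
    ∀ t ∈ Icc 0 T, ∀ᵐ ξ : ℝ,
      IntervalIntegrable
        (fun τ => Real.exp ((t - τ) * symb μ ξ) • hatL1 (fun x => (v τ x) ^ 2) ξ) volume 0 t ∧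
      hat (u t) ξ = Real.exp (t * symb μ ξ) • hat φ ξ +
        (1 / 2 : ℝ) • ∫ τ in (0)..t,
          Real.exp ((t - τ) * symb μ ξ) • hatL1 (fun x => (v τ x) ^ 2) ξ

/-- `u_t = ∂ₓ²u + μ (1 - ∂ₓ²)^{-1/2} u + ½ (∂ₓu)²` for `0 < t ≤ T`, with all the terms in `L²(ℝ)` and
`u_t` the derivative (one-sided at `T`) of `u : [0,T] → L²(ℝ)`. -/
def SolvesPDE (μ T : ℝ) (u : ℝ → L2) : Prop :=
  ∀ t ∈ Ioc 0 T, ∃ ut ux uxx z : L2,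
    HasDerivWithinAt u ut (Icc 0 T) t ∧
    HasWeakDeriv (u t) ux ∧ HasWeakDeriv ux uxx ∧
    (∀ᵐ ξ : ℝ, hat z ξ = (1 + ξ ^ 2) ^ (-1 / 2 : ℝ) • hat (u t) ξ) ∧
    ∀ᵐ x : ℝ, ut x = uxx x + μ * z x + 1 / 2 * (ux x) ^ 2

/-- `u ∈ C((0,T]; H^∞(ℝ))`: `u` is continuous from `(0,T]` to `H^r(ℝ)` for every `r`. -/
def ContinuousInHInfty (T : ℝ) (u : ℝ → L2) : Prop :=
  ∀ r : ℝ, (∀ t ∈ Ioc 0 T, (sobNorm r).toFun (u t) < ⊤) ∧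
    ∀ t₀ ∈ Ioc 0 T, Tendsto (fun t => (sobNorm r).toFun (u t - u t₀)) (𝓝[Ioc 0 T] t₀) (𝓝 0)

end KS

end

/-!
The whole argument takes place on the Fourier side, with the bounds for the propagator and for the
source pointwise in the frequency.

*Linear bounds.* `e^{tΦ} ≤ e^{1+μ} e^{-t⟨ξ⟩²}` for `0 ≤ t ≤ 1`, so that a factor `⟨ξ⟩^{-2θ}` is
gained at the price of the integrable singularity `(t-τ)^{-θ}`, for every `θ < 1` (`norm_duh_le`).

*The quadratic term.* For `v, w ∈ H^m`, `m ≥ 0`, the transform of the product `vw` is bounded by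
`C ⟨ξ⟩^{-m} ‖v‖_{H^m} ‖w‖_{H^m}`, by the Cauchy-Schwarz inequality for a convolution
(`prodHat_weighted_le`). For `u, w ∈ X_T^s` the transform of `∂ₓu ∂ₓw` is therefore bounded by
`C τ^{-(1-s)₊} ⟨ξ⟩^{-(s-1)₊} ‖u‖ ‖w‖` (`isSource_src`). The Duhamel integral of such a source belongs
to `X_T^{s'}` whenever `s' < s + 1/2 - (1-s)₊`, with a positive power of `T` in the bound
(`exists_linear_solution`); `s > 1/2` is what allows `s' ≥ s` here.

*Existence and smoothness.* With `s' = s` the Duhamel formula is an equation `u = Lφ + B(u,u)` in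
the Banach space `X_T^s`, where `L` is linear and bounded and `B` is bilinear with a bound
`O(T^γ)`. For small `T` it has a fixed point in a ball, by contraction, and the inverse function
theorem for `u ↦ u - B(u,u)` shows that the fixed point depends smoothly on `φ` (`exists_flow`).

*Uniqueness.* In the exponentially weighted norm `sup_t e^{-λt} t^{(1-s)₊/2} ‖∂ₓu(t)‖_{L²}` the map
is a contraction for large `λ`, for solutions of any size and on all of `[0,T]`
(`isSolution_unique`).

*Smoothing.* Restarting the formula at a positive time shows that a bound in `H^r` on `[ε,T]` gives
one in `H^{r+1/4}` on `[2ε,T]`, together with a square-integrable envelope for the transforms; hence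
`u ∈ C((0,T]; H^∞)` by dominated convergence (`continuousInHInfty`).

*The differential equation.* For `t > 0` the transform given by the Duhamel formula is differentiable
in `t` at each frequency, with the derivative dominated in `L²` (`solvesPDE`). Conversely, if `u`
satisfies the differential equation, then the derivative of `τ ↦ e^{(t-τ)Φ} û(τ)`, tested against
the indicator function of a compact set of frequencies, is the source term alone, and integrating
over `(0,t)` gives the Duhamel formula (`isSolution_of_solvesPDE`).

*Persistence.* The source of a solution in `X_T^σ` produces a solution in `X_T^{σ'}` with
`σ' = σ + δ`, for a `δ > 0` that serves for all `σ ≥ s`, and the solution is the same function, being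
determined by its source. Finitely many such steps lead from `s` to `s'` with the same `T`
(`exists_persistent`).
-/

namespace KS

/-! ### The Fourier transform on `L²` -/

/-- Complex-valued `L²(ℝ)`. -/
abbrev L2C : Type := Lp ℂ 2 (volume : Measure ℝ)

/-- The defining identity of the Fourier transform on `L²`: it is transposed onto test functions. -/
theorem integral_mul_fourier (F : L2C) (ψ : 𝓢(ℝ, ℂ)) :
    ∫ x, (𝓕 ψ) x * F x = ∫ x, ψ x * (𝓕 F : L2C) x := by
  have h := Lp.fourier_toTemperedDistribution_eq F
  have h2 := congrArg (fun D : 𝓢'(ℝ, ℂ) => D ψ) h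
  simpa [TemperedDistribution.fourier_apply, Lp.toTemperedDistribution_apply] using h2

theorem L2C.locallyIntegrable (F : L2C) : LocallyIntegrable F :=
  (Lp.memLp F).locallyIntegrable (by norm_num)

/-- A locally integrable function that satisfies the transposition identity is the Fourier
transform. -/
theorem fourier_ae_eq (F : L2C) (G : ℝ → ℂ) (hG : LocallyIntegrable G)
    (h : ∀ ψ : 𝓢(ℝ, ℂ), HasCompactSupport ψ → ∫ x, (𝓕 ψ) x * F x = ∫ x, ψ x * G x) :
    (𝓕 F : L2C) =ᵐ[volume] G := by
  refine ae_eq_of_integral_contDiff_smul_eq (L2C.locallyIntegrable _) hG fun g hg hgc => ?_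
  have hc : HasCompactSupport (fun x => (g x : ℂ)) :=
    hgc.comp_left (g := fun y : ℝ => (y : ℂ)) (by simp)
  have hd : ContDiff ℝ ∞ (fun x => (g x : ℂ)) := Complex.ofRealCLM.contDiff.comp hg
  have h1 := h (hc.toSchwartzMap hd) hc
  rw [integral_mul_fourier] at h1
  simpa using h1

/-- Complex conjugation on `L²` becomes `G ↦ conj G(-·)` under the Fourier transform. -/
theorem fourier_conj (F F' : L2C) (h : F' =ᵐ[volume] fun x => (starRingEnd ℂ) (F x)) :
    (𝓕 F' : L2C) =ᵐ[volume] fun η => (starRingEnd ℂ) ((𝓕 F : L2C) (-η)) := by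
  have hm : MemLp (fun η => (starRingEnd ℂ) ((𝓕 F : L2C) (-η))) 2 := by
    have := ((Lp.memLp (𝓕 F : L2C)).comp_measurePreserving (Measure.measurePreserving_neg volume)).star
    exact this
  refine fourier_ae_eq F' _ (hm.locallyIntegrable (by norm_num)) fun ψ _ => ?_
  let ψ' : 𝓢(ℝ, ℂ) := SchwartzMap.postcompCLM (𝕜 := ℝ) (Complex.conjCLE : ℂ →L[ℝ] ℂ)
    (SchwartzMap.compCLMOfContinuousLinearEquiv ℝ (ContinuousLinearEquiv.neg ℝ) ψ)
  have e1 : ∀ x, ψ' x = (starRingEnd ℂ) (ψ (-x)) := fun x => rfl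
  have e2 : ∀ x, (𝓕 ψ' ) x = (starRingEnd ℂ) ((𝓕 ψ) x) := by
    intro x
    rw [SchwartzMap.fourier_coe, SchwartzMap.fourier_coe, Real.fourier_eq', Real.fourier_eq',
      ← integral_conj, ← integral_neg_eq_self]
    refine integral_congr_ae (ae_of_all _ fun v => ?_)
    simp [e1, ← Complex.exp_conj, Complex.conj_ofNat]
  have h1 := congrArg (starRingEnd ℂ) (integral_mul_fourier F ψ')
  rw [← integral_conj, ← integral_conj] at h1
  calc ∫ x, (𝓕 ψ) x * F' x = ∫ x, (starRingEnd ℂ) ((𝓕 ψ') x * F x) := by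
        refine integral_congr_ae ?_
        filter_upwards [h] with x hx
        simp [hx, e2]
    _ = ∫ x, (starRingEnd ℂ) (ψ' x * (𝓕 F : L2C) x) := h1
    _ = _ := by
        rw [← integral_neg_eq_self]
        refine integral_congr_ae (ae_of_all _ fun v => ?_)
        simp [e1]

/-- Modulation becomes translation under the Fourier transform. -/
theorem fourier_modulation (a : ℝ) (F F' : L2C)
    (h : F' =ᵐ[volume] fun x => Complex.exp (2 * Real.pi * a * x * Complex.I) * F x) :
    (𝓕 F' : L2C) =ᵐ[volume] fun η => (𝓕 F : L2C) (η - a) := by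
  have hm : MemLp (fun η => (𝓕 F : L2C) (η - a)) 2 :=
    (Lp.memLp (𝓕 F : L2C)).comp_measurePreserving (measurePreserving_sub_right volume a)
  refine fourier_ae_eq F' _ (hm.locallyIntegrable (by norm_num)) fun ψ _ => ?_
  let ψ' : 𝓢(ℝ, ℂ) := SchwartzMap.compSubConstCLM ℂ (-a) ψ
  have e1 : ∀ x, ψ' x = ψ (x + a) := fun x => by
    simp only [ψ', SchwartzMap.compSubConstCLM_apply, sub_neg_eq_add]
  have e2 : ∀ x : ℝ, (𝓕 ψ') x = Complex.exp (2 * Real.pi * a * x * Complex.I) * (𝓕 ψ) x := by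
    intro x
    rw [SchwartzMap.fourier_coe, SchwartzMap.fourier_coe, Real.fourier_eq', Real.fourier_eq',
      ← integral_const_mul, ← integral_sub_right_eq_self _ a]
    refine integral_congr_ae (ae_of_all _ fun v => ?_)
    simp only [e1, smul_eq_mul, sub_add_cancel, ← mul_assoc, ← Complex.exp_add]
    congr 2
    simp only [RCLike.inner_apply, conj_trivial]
    push_cast
    ring
  calc ∫ x, (𝓕 ψ) x * F' x = ∫ x, (𝓕 ψ') x * F x := by
        refine integral_congr_ae ?_
        filter_upwards [h] with x hx
        rw [hx, e2]; ring
    _ = ∫ x, ψ' x * (𝓕 F : L2C) x := integral_mul_fourier F ψ'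
    _ = _ := by
        rw [← integral_sub_right_eq_self _ a]
        refine integral_congr_ae (ae_of_all _ fun v => ?_)
        simp [e1]

theorem two_pi_pos : 0 < 2 * Real.pi := by positivity

theorem quasiMeasurePreserving_mul {c : ℝ} (hc : c ≠ 0) :
    Measure.QuasiMeasurePreserving (fun ξ : ℝ => ξ * c) := by
  refine ⟨by fun_prop, ?_⟩
  rw [Real.map_volume_mul_right hc]
  exact Measure.smul_absolutelyContinuous

theorem hat_two_pi (f : L2) (η : ℝ) : hat f (η * (2 * Real.pi)) = (𝓕 (toC f) : L2C) η := by
  rw [hat, mul_div_cancel_right₀ _ two_pi_pos.ne']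

/-- Scaling by a nonzero factor multiplies the `L²` norm on the line. -/
theorem eLpNorm_comp_mul {c : ℝ} (hc : 0 < c) {E : Type*} [NormedAddCommGroup E] (g : ℝ → E)
    (hg : AEStronglyMeasurable g) :
    eLpNorm (fun ξ => g (ξ * c)) 2 volume = ENNReal.ofReal (√c⁻¹) * eLpNorm g 2 volume := by
  have h1 : eLpNorm (fun ξ => g (ξ * c)) 2 volume
      = eLpNorm g 2 (Measure.map (fun ξ : ℝ => ξ * c) volume) := by
    rw [eLpNorm_map_measure _ (by fun_prop)]
    · rfl
    · rw [Real.map_volume_mul_right hc.ne']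
      exact hg.smul_measure _
  rw [h1, Real.map_volume_mul_right hc.ne', eLpNorm_smul_measure_of_ne_top (by norm_num),
    abs_of_pos (inv_pos.2 hc), smul_eq_mul, Real.sqrt_eq_rpow, ENNReal.ofReal_rpow_of_nonneg]
  · norm_num
  · positivity
  · norm_num

theorem eLpNorm_toC (f : L2) : eLpNorm (toC f) 2 volume = ‖f‖ₑ := by
  rw [Lp.enorm_def]
  refine eLpNorm_congr_norm_ae ?_
  filter_upwards [Complex.ofRealCLM.coeFn_compLp f] with x hx
  have : (toC f) x = Complex.ofRealCLM (f x) := hx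
  rw [this]; simp

theorem toC_coe (f : L2) : toC f =ᵐ[volume] fun x => (f x : ℂ) :=
  Complex.ofRealCLM.coeFn_compLp f

theorem eLpNorm_fourier (F : L2C) : eLpNorm (𝓕 F : L2C) 2 volume = eLpNorm F 2 volume := by
  have := Lp.norm_fourier_eq F
  rw [← Lp.enorm_def, ← Lp.enorm_def, ← ofReal_norm, ← ofReal_norm, this]

/-- Plancherel: `‖f̂‖ = √(2π) ‖f‖`. -/
theorem eLpNorm_hat (f : L2) :
    eLpNorm (hat f) 2 volume = ENNReal.ofReal (√(2 * Real.pi)) * ‖f‖ₑ := by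
  have h := eLpNorm_comp_mul (inv_pos.2 two_pi_pos) (𝓕 (toC f) : L2C) (Lp.aestronglyMeasurable _)
  rw [inv_inv, eLpNorm_fourier, eLpNorm_toC] at h
  rw [← h]
  rfl

theorem memLp_hat (f : L2) : MemLp (hat f) 2 := by
  refine ⟨hat_aestronglyMeasurable f, ?_⟩
  rw [eLpNorm_hat]
  exact ENNReal.mul_lt_top ENNReal.ofReal_lt_top (by simp)

theorem hat_zero : hat 0 =ᵐ[volume] 0 := by simpa using hat_smul 0 0

theorem hat_neg (f : L2) : hat (-f) =ᵐ[volume] -hat f := by simpa using hat_smul (-1) f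

theorem hat_sub (f g : L2) : hat (f - g) =ᵐ[volume] hat f - hat g := by
  rw [sub_eq_add_neg]
  filter_upwards [hat_add f (-g), hat_neg g] with ξ h1 h2
  rw [h1, Pi.add_apply, h2]; simp [sub_eq_add_neg]

theorem hat_injective {f g : L2} (h : hat f =ᵐ[volume] hat g) : f = g := by
  rw [← sub_eq_zero]
  refine eq_zero_of_hat _ ?_
  filter_upwards [hat_sub f g, h] with ξ h1 h2
  simp [h1, h2]

/-- The symmetry `G(-ξ) = conj G(ξ)` for almost every `ξ`, which characterizes the transforms of
real-valued functions. -/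
def Hermitian (G : ℝ → ℂ) : Prop := ∀ᵐ ξ : ℝ, G (-ξ) = (starRingEnd ℂ) (G ξ)

theorem hermitian_hat (f : L2) : Hermitian (hat f) := by
  have h := fourier_conj (toC f) (toC f) (by
    filter_upwards [toC_coe f] with x hx
    rw [hx]; simp)
  have h2 := hat_qmp.ae h
  filter_upwards [h2] with ξ hξ
  rw [hat, hat, hξ, neg_div]
  simp

/-- Every hermitian square-integrable function is the Fourier transform of a real function. -/
theorem exists_hat_eq {G : ℝ → ℂ} (hG : MemLp G 2) (hh : Hermitian G) :
    ∃ f : L2, hat f =ᵐ[volume] G := by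
  have hq := quasiMeasurePreserving_mul two_pi_pos.ne'
  have hm : MemLp (fun η => G (η * (2 * Real.pi))) 2 := by
    refine ⟨hG.1.comp_quasiMeasurePreserving hq, ?_⟩
    rw [eLpNorm_comp_mul two_pi_pos _ hG.1]
    exact ENNReal.mul_lt_top ENNReal.ofReal_lt_top hG.2
  let G' : L2C := hm.toLp _
  let F : L2C := 𝓕⁻ G'
  have hF : 𝓕 F = G' := FourierTransform.fourier_fourierInv_eq G'
  have hG' : G' =ᵐ[volume] fun η => G (η * (2 * Real.pi)) := hm.coeFn_toLp
  let F' : L2C := (Lp.memLp F).star.toLp _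
  have hF' : F' =ᵐ[volume] fun x => (starRingEnd ℂ) (F x) := (Lp.memLp F).star.coeFn_toLp
  have h1 := fourier_conj F F' hF'
  have hG'n := (Measure.measurePreserving_neg (volume : Measure ℝ)).quasiMeasurePreserving.ae hG'
  have h2 : 𝓕 F' = G' := by
    apply Lp.ext
    filter_upwards [h1, hG', hG'n, hq.ae hh] with η e1 e2 e3 e4
    rw [e1, hF, e2, e3]
    simp only [neg_mul]
    rw [e4]; simp
  have h3 : F' = F := by
    rw [← FourierTransform.fourierInv_fourier_eq (F := L2C) F', h2]
  have h4 : ∀ᵐ x : ℝ, ((F x).re : ℂ) = F x := by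
    filter_upwards [hF'] with x hx
    rw [h3] at hx
    exact Complex.conj_eq_iff_re.1 hx.symm
  let f : L2 := Complex.reCLM.compLp F
  have hf : toC f = F := by
    apply Lp.ext
    filter_upwards [toC_coe f, Complex.reCLM.coeFn_compLp F, h4] with x e1 e2 e3
    rw [e1, e2]
    exact e3
  refine ⟨f, ?_⟩
  filter_upwards [hat_qmp.ae hG'] with ξ hξ
  rw [hat, hf, hF, hξ, div_mul_cancel₀ _ two_pi_pos.ne']

/-! ### Weak derivatives on the Fourier side -/

theorem integral_lineDeriv_fourier (f : L2C) (χ : 𝓢(ℝ, ℂ)) :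
    ∫ x, (-∂_{(1 : ℝ)} (𝓕 χ)) x * f x
      = ∫ η, χ η * (2 * Real.pi * Complex.I * η * (𝓕 f : L2C) η) := by
  have h1 : -∂_{(1 : ℝ)} (𝓕 χ) =
      𝓕 ((2 * Real.pi * Complex.I) • SchwartzMap.smulLeftCLM ℂ (fun x : ℝ => inner ℝ x 1) χ) := by
    rw [SchwartzMap.lineDerivOp_fourier_eq, neg_smul, FourierTransform.fourier_neg, neg_neg]
  rw [h1, integral_mul_fourier]
  refine integral_congr_ae (ae_of_all _ fun η => ?_)
  have h2 : (SchwartzMap.smulLeftCLM ℂ (fun x : ℝ => inner ℝ x 1) χ) η = (inner ℝ η 1 : ℝ) • χ η :=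
    SchwartzMap.smulLeftCLM_apply_apply (by fun_prop) χ η
  simp only [smul_apply, h2]
  simp
  ring

theorem hasWeakDeriv_iff_integral (f g : L2) :
    HasWeakDeriv f g ↔ ∀ ψ : 𝓢(ℝ, ℂ), ∫ x, (-∂_{(1 : ℝ)} ψ) x * toC f x = ∫ x, ψ x * toC g x := by
  have key : ∀ ψ : 𝓢(ℝ, ℂ),
      (∂_{(1 : ℝ)} (Lp.toTemperedDistributionCLM ℂ volume 2 (toC f) : 𝓢'(ℝ, ℂ))) ψ
        = ∫ x, (-∂_{(1 : ℝ)} ψ) x * toC f x := by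
    intro ψ
    rw [TemperedDistribution.lineDerivOp_apply_apply, Lp.toTemperedDistributionCLM_apply,
      Lp.toTemperedDistribution_apply]
    rfl
  have key2 : ∀ ψ : 𝓢(ℝ, ℂ), (Lp.toTemperedDistributionCLM ℂ volume 2 (toC g) : 𝓢'(ℝ, ℂ)) ψ
        = ∫ x, ψ x * toC g x := by
    intro ψ
    rw [Lp.toTemperedDistributionCLM_apply, Lp.toTemperedDistribution_apply]
    rfl
  unfold HasWeakDeriv
  constructor
  · intro h ψ
    rw [← key, h, key2]
  · intro h
    ext ψ
    rw [key, h, key2]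

/-- The weak derivative is the multiplication by `iξ` on the Fourier side. -/
theorem hasWeakDeriv_iff (f g : L2) :
    HasWeakDeriv f g ↔ hat g =ᵐ[volume] fun ξ => Complex.I * ξ * hat f ξ := by
  have hq := quasiMeasurePreserving_mul two_pi_pos.ne'
  have e : hat g =ᵐ[volume] (fun ξ => Complex.I * ξ * hat f ξ) ↔
      (𝓕 (toC g) : L2C) =ᵐ[volume] fun η => 2 * Real.pi * Complex.I * η * (𝓕 (toC f) : L2C) η := by
    constructor
    · intro h
      filter_upwards [hq.ae h] with η hη
      rw [hat_two_pi, hat_two_pi] at hη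
      rw [hη]; push_cast; ring
    · intro h
      filter_upwards [hat_qmp.ae h] with ξ hξ
      rw [hat, hξ, hat]
      have : (Real.pi : ℂ) ≠ 0 := by exact_mod_cast Real.pi_ne_zero
      push_cast
      field_simp
  rw [e, hasWeakDeriv_iff_integral]
  constructor
  · intro h
    refine fourier_ae_eq _ _ ?_ fun ψ _ => ?_
    · have := (L2C.locallyIntegrable (𝓕 (toC f)))
      have hc : Continuous fun η : ℝ => (2 * Real.pi * Complex.I * η : ℂ) := by fun_prop
      have h3 := (this.locallyIntegrableOn univ).continuousOn_mul hc.continuousOn isOpen_univ.isLocallyClosed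
      exact locallyIntegrableOn_univ.1 h3
    · rw [← h, integral_lineDeriv_fourier]
  · intro h ψ
    have hψ : ψ = 𝓕 (𝓕⁻ ψ) := (FourierTransform.fourier_fourierInv_eq ψ).symm
    rw [hψ, integral_lineDeriv_fourier, integral_mul_fourier]
    refine integral_congr_ae ?_
    filter_upwards [h] with η hη
    rw [hη]

/-! ### Weighted norms on the Fourier side -/

/-- The weighted norm `‖w f̂‖_{L²}`. -/
noncomputable def wN (w : ℝ → ℝ) (f : L2) : ℝ≥0∞ := eLpNorm (fun ξ => w ξ • hat f ξ) 2 volume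

theorem sobNorm_eq (s : ℝ) (f : L2) :
    (sobNorm s).toFun f = wN (fun ξ => (1 + ξ ^ 2) ^ (s / 2)) f := rfl

theorem aestronglyMeasurable_smul_hat {w : ℝ → ℝ} (hw : Measurable w) (f : L2) :
    AEStronglyMeasurable (fun ξ => w ξ • hat f ξ) volume :=
  hw.aestronglyMeasurable.smul (hat_aestronglyMeasurable f)

theorem HasWeakDeriv.wN_eq {f g : L2} (h : HasWeakDeriv f g) (w : ℝ → ℝ) :
    wN w g = wN (fun ξ => w ξ * ξ) f := by
  refine eLpNorm_congr_norm_ae ?_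
  filter_upwards [(hasWeakDeriv_iff f g).1 h] with ξ hξ
  rw [hξ]
  simp [mul_assoc]

theorem wN_one (f : L2) : wN (fun _ => 1) f = ENNReal.ofReal (√(2 * Real.pi)) * ‖f‖ₑ := by
  rw [← eLpNorm_hat]; simp [wN]

theorem HasWeakDeriv.unique {f g g' : L2} (h : HasWeakDeriv f g) (h' : HasWeakDeriv f g') :
    g = g' := by
  rw [hasWeakDeriv_iff] at h h'
  exact hat_injective (h.trans h'.symm)

theorem exists_hasWeakDeriv {f : L2} (h : wN (fun ξ => ξ) f < ⊤) : ∃ g, HasWeakDeriv f g := by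
  have hm : MemLp (fun ξ : ℝ => Complex.I * ξ * hat f ξ) 2 := by
    refine ⟨(by fun_prop : Measurable fun ξ : ℝ => Complex.I * (ξ : ℂ)).aestronglyMeasurable.mul
      (hat_aestronglyMeasurable f), ?_⟩
    refine lt_of_eq_of_lt (eLpNorm_congr_norm_ae (ae_of_all _ fun ξ => ?_)) h
    simp
  obtain ⟨g, hg⟩ := exists_hat_eq hm (by
    filter_upwards [hermitian_hat f] with ξ hξ
    rw [hξ]; simp)
  exact ⟨g, (hasWeakDeriv_iff f g).2 hg⟩

open Classical in
/-- The weak derivative of `f`, or `0` if it is not in `L²`. -/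
noncomputable def dx (f : L2) : L2 := if h : ∃ g, HasWeakDeriv f g then h.choose else 0

theorem HasWeakDeriv.dx_eq {f g : L2} (h : HasWeakDeriv f g) : dx f = g := by
  have h' : ∃ g, HasWeakDeriv f g := ⟨g, h⟩
  rw [dx, dif_pos h']
  exact h'.choose_spec.unique h

theorem hasWeakDeriv_dx {f : L2} (h : wN (fun ξ => ξ) f < ⊤) : HasWeakDeriv f (dx f) := by
  obtain ⟨g, hg⟩ := exists_hasWeakDeriv h
  rwa [hg.dx_eq]

theorem HasWeakDeriv.enorm_eq {f g : L2} (h : HasWeakDeriv f g) :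
    ENNReal.ofReal (√(2 * Real.pi)) * ‖g‖ₑ = wN (fun ξ => ξ) f := by
  rw [← wN_one, h.wN_eq]; simp

theorem sqrt_two_pi_ne : ENNReal.ofReal (√(2 * Real.pi)) ≠ 0 := by
  rw [ENNReal.ofReal_ne_zero_iff]; positivity

theorem dxNorm_eq (f : L2) : ENNReal.ofReal (√(2 * Real.pi)) * dxNorm f = wN (fun ξ => ξ) f := by
  by_cases h : ∃ g, HasWeakDeriv f g
  · obtain ⟨g, hg⟩ := h
    have : dxNorm f = ‖g‖ₑ := by
      refine le_antisymm (iInf₂_le g hg) (le_iInf₂ fun g' hg' => ?_)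
      rw [hg.unique hg']
    rw [this, hg.enorm_eq]
  · have h1 : dxNorm f = ⊤ := by
      simp only [dxNorm, iInf_eq_top]
      intro g hg
      exact (h ⟨g, hg⟩).elim
    have h2 : ¬ wN (fun ξ => ξ) f < ⊤ := fun h' => h (exists_hasWeakDeriv h')
    rw [h1, ENNReal.mul_top sqrt_two_pi_ne]
    exact (not_lt_top_iff.1 h2).symm

theorem dxNorm_lt_top_iff (f : L2) : dxNorm f < ⊤ ↔ wN (fun ξ => ξ) f < ⊤ := by
  rw [← dxNorm_eq]
  constructor
  · exact fun h => ENNReal.mul_lt_top ENNReal.ofReal_lt_top h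
  · intro h
    exact ENNReal.lt_top_of_mul_ne_top_right h.ne sqrt_two_pi_ne

theorem wN_mono {w w' : ℝ → ℝ} (h : ∀ ξ, |w ξ| ≤ |w' ξ|) (f : L2) : wN w f ≤ wN w' f := by
  refine eLpNorm_mono fun ξ => ?_
  rw [norm_smul, norm_smul]
  exact mul_le_mul_of_nonneg_right (h ξ) (norm_nonneg _)

theorem wN_const_mul (c : ℝ) (w : ℝ → ℝ) (f : L2) :
    wN (fun ξ => c * w ξ) f = ‖c‖ₑ * wN w f := by
  rw [wN, wN, ← eLpNorm_const_smul]
  refine eLpNorm_congr_ae (ae_of_all _ fun ξ => ?_)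
  simp [mul_assoc]

theorem sobNorm_mono {r s : ℝ} (h : r ≤ s) (f : L2) : (sobNorm r).toFun f ≤ (sobNorm s).toFun f := by
  refine wN_mono (fun ξ => ?_) f
  rw [abs_of_nonneg (by positivity), abs_of_nonneg (by positivity)]
  exact Real.rpow_le_rpow_of_exponent_le (by nlinarith [sq_nonneg ξ]) (by linarith)

theorem abs_le_japanese (ξ : ℝ) : |ξ| ≤ (1 + ξ ^ 2) ^ (1 / 2 : ℝ) := by
  rw [← Real.sqrt_eq_rpow, ← Real.sqrt_sq_eq_abs]
  exact Real.sqrt_le_sqrt (by linarith)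

theorem wN_id_le_sobNorm {s : ℝ} (hs : 1 ≤ s) (f : L2) : wN (fun ξ => ξ) f ≤ (sobNorm s).toFun f := by
  refine le_trans (wN_mono (fun ξ => ?_) f) (sobNorm_mono hs f)
  exact (abs_le_japanese ξ).trans (le_abs_self _)

theorem sqrt_two_pi_le : (1 : ℝ≥0∞) ≤ ENNReal.ofReal (√(2 * Real.pi)) := by
  rw [ENNReal.one_le_ofReal, Real.one_le_sqrt]
  linarith [Real.pi_gt_three]

theorem enorm_le_sobNorm {s : ℝ} (hs : 0 ≤ s) (f : L2) : ‖f‖ₑ ≤ (sobNorm s).toFun f := by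
  refine le_trans ?_ (sobNorm_mono hs f)
  have : (sobNorm 0).toFun f = wN (fun _ => 1) f := by rw [sobNorm_eq]; simp
  rw [this, wN_one]
  exact le_mul_of_one_le_left (by simp) sqrt_two_pi_le

/-! ### Integrable functions and products -/

theorem hatL1_eq (p : ℝ → ℝ) (ξ : ℝ) : hatL1 p ξ = 𝓕 (fun x => (p x : ℂ)) (ξ / (2 * Real.pi)) := by
  rw [hatL1, Real.fourier_eq']
  refine integral_congr_ae (ae_of_all _ fun x => ?_)
  simp only [smul_eq_mul, RCLike.inner_apply, conj_trivial]
  congr 2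
  have : (Real.pi : ℂ) ≠ 0 := by exact_mod_cast Real.pi_ne_zero
  push_cast
  field_simp

theorem continuous_fourier_of_integrable {p : ℝ → ℂ} (hp : Integrable p) : Continuous (𝓕 p) :=
  VectorFourier.fourierIntegral_continuous Real.continuous_fourierChar continuous_inner hp

theorem continuous_hatL1 {p : ℝ → ℝ} (hp : Integrable p) : Continuous (hatL1 p) := by
  have : hatL1 p = fun ξ => 𝓕 (fun x => (p x : ℂ)) (ξ / (2 * Real.pi)) := funext (hatL1_eq p)
  rw [this]
  exact (continuous_fourier_of_integrable hp.ofReal).comp (by fun_prop)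

theorem integral_fourier_mul_of_integrable {p : ℝ → ℂ} (hp : Integrable p) (ψ : 𝓢(ℝ, ℂ)) :
    ∫ x, (𝓕 ψ) x * p x = ∫ x, ψ x * 𝓕 p x := by
  have h := VectorFourier.integral_fourierIntegral_smul_eq_flip (μ := volume) (ν := volume)
    (L := innerₗ ℝ) (e := Real.fourierChar) Real.continuous_fourierChar continuous_inner
    (ψ.integrable (μ := volume)) hp
  rw [flip_innerₗ] at h
  rw [SchwartzMap.fourier_coe]
  exact h

/-- The two notions of Fourier transform determine the same function: an integrable function has
the same transform as an `L²` function if and only if the two agree. -/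
theorem hatL1_ae_eq_hat_iff {p : ℝ → ℝ} (hp : Integrable p) (q : L2) :
    hatL1 p =ᵐ[volume] hat q ↔ p =ᵐ[volume] q := by
  have hq := quasiMeasurePreserving_mul two_pi_pos.ne'
  constructor
  · intro h
    have h1 : (𝓕 (toC q) : L2C) =ᵐ[volume] 𝓕 (fun x => (p x : ℂ)) := by
      filter_upwards [hq.ae h] with η hη
      rw [hat_two_pi, hatL1_eq, mul_div_cancel_right₀ _ two_pi_pos.ne'] at hη
      exact hη.symm
    have h2 : ∀ᵐ x : ℝ, (p x : ℂ) = toC q x := by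
      refine ae_eq_of_integral_contDiff_smul_eq hp.ofReal.locallyIntegrable
        (L2C.locallyIntegrable _) fun g hg hgc => ?_
      have hc : HasCompactSupport (fun x => (g x : ℂ)) :=
        hgc.comp_left (g := fun y : ℝ => (y : ℂ)) (by simp)
      have hd : ContDiff ℝ ∞ (fun x => (g x : ℂ)) := Complex.ofRealCLM.contDiff.comp hg
      let ψ := hc.toSchwartzMap hd
      have hψ : ψ = 𝓕 (𝓕⁻ ψ) := (FourierTransform.fourier_fourierInv_eq ψ).symm
      have e1 := integral_fourier_mul_of_integrable hp.ofReal (𝓕⁻ ψ)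
      have e2 := integral_mul_fourier (toC q) (𝓕⁻ ψ)
      rw [← hψ] at e1 e2
      have e3 : ∫ x, ψ x * (p x : ℂ) = ∫ x, ψ x * toC q x := by
        refine e1.trans (Eq.trans ?_ e2.symm)
        refine integral_congr_ae ?_
        filter_upwards [h1] with x hx
        rw [hx]
        rfl
      simpa [ψ] using e3
    filter_upwards [h2, toC_coe q] with x h3 h4
    rw [h4] at h3
    exact_mod_cast h3
  · intro h
    have h1 : (𝓕 (toC q) : L2C) =ᵐ[volume] 𝓕 (fun x => (p x : ℂ)) := by
      refine fourier_ae_eq _ _ (continuous_fourier_of_integrable hp.ofReal).locallyIntegrable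
        fun ψ _ => ?_
      refine Eq.trans (integral_congr_ae ?_) (integral_fourier_mul_of_integrable hp.ofReal ψ)
      filter_upwards [h, toC_coe q] with x h3 h4
      rw [h4, h3]
      rfl
    filter_upwards [hat_qmp.ae h1] with ξ hξ
    rw [hatL1_eq, hat, hξ]

/-- The Fourier transform of the product of two `L²` functions. -/
noncomputable def prodHat (v w : L2) (ξ : ℝ) : ℂ := hatL1 (fun x => v x * w x) ξ

theorem integrable_mul (v w : L2) : Integrable (fun x => v x * w x) :=
  (Lp.memLp v).integrable_mul (Lp.memLp w)

theorem continuous_prodHat_right (v w : L2) : Continuous (prodHat v w) :=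
  continuous_hatL1 (integrable_mul v w)

theorem prodHat_neg (v w : L2) (ξ : ℝ) : prodHat v w (-ξ) = (starRingEnd ℂ) (prodHat v w ξ) := by
  rw [prodHat, prodHat, hatL1, hatL1, ← integral_conj]
  refine integral_congr_ae (ae_of_all _ fun x => ?_)
  simp [← Complex.exp_conj]

theorem norm_prodHat_le (v w : L2) (ξ : ℝ) : ‖prodHat v w ξ‖ ≤ ‖v‖ * ‖w‖ := by
  have h1 : ‖prodHat v w ξ‖ₑ ≤ ‖v‖ₑ * ‖w‖ₑ := by
    calc ‖prodHat v w ξ‖ₑ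
        ≤ ∫⁻ x : ℝ, ‖Complex.exp (-Complex.I * ξ * x) * ((v x * w x : ℝ) : ℂ)‖ₑ :=
          enorm_integral_le_lintegral_enorm _
      _ = eLpNorm (fun x => v x * w x) 1 volume := by
          rw [eLpNorm_one_eq_lintegral_enorm]
          refine lintegral_congr fun x => ?_
          rw [enorm_mul]
          have e1 : ‖Complex.exp (-Complex.I * ξ * x)‖ₑ = 1 := by
            rw [← ofReal_norm, Complex.norm_exp]
            simp
          have e2 : ‖((v x * w x : ℝ) : ℂ)‖ₑ = ‖v x * w x‖ₑ := by
            rw [← ofReal_norm, ← ofReal_norm, Complex.norm_real]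
          rw [e1, e2, one_mul]
      _ ≤ eLpNorm v 2 volume * eLpNorm w 2 volume := by
          have := eLpNorm_smul_le_mul_eLpNorm (p := 2) (q := 2) (r := 1) (μ := volume)
            (Lp.aestronglyMeasurable w) (Lp.aestronglyMeasurable v)
          exact this
      _ = ‖v‖ₑ * ‖w‖ₑ := by rw [Lp.enorm_def, Lp.enorm_def]
  rw [← ofReal_norm, ← ofReal_norm, ← ofReal_norm, ← ENNReal.ofReal_mul (norm_nonneg _)] at h1
  exact (ENNReal.ofReal_le_ofReal_iff (by positivity)).1 h1

theorem hatL1_congr {p q : ℝ → ℝ} (h : p =ᵐ[volume] q) (ξ : ℝ) : hatL1 p ξ = hatL1 q ξ := by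
  refine integral_congr_ae ?_
  filter_upwards [h] with x hx
  rw [hx]

theorem hatL1_add {p q : ℝ → ℝ} (hp : Integrable p) (hq : Integrable q) (ξ : ℝ) :
    hatL1 (fun x => p x + q x) ξ = hatL1 p ξ + hatL1 q ξ := by
  have hi : ∀ {p : ℝ → ℝ}, Integrable p →
      Integrable fun x : ℝ => Complex.exp (-Complex.I * ξ * x) * (p x : ℂ) := fun {p} hp => by
    refine hp.ofReal.bdd_mul (c := 1) (by fun_prop) (ae_of_all _ fun x => ?_)
    rw [Complex.norm_exp]; simp
  rw [hatL1, hatL1, hatL1, ← integral_add (hi hp) (hi hq)]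
  refine integral_congr_ae (ae_of_all _ fun x => ?_)
  push_cast; ring

theorem hatL1_smul (c : ℝ) (p : ℝ → ℝ) (ξ : ℝ) :
    hatL1 (fun x => c * p x) ξ = c * hatL1 p ξ := by
  rw [hatL1, hatL1, ← integral_const_mul]
  refine integral_congr_ae (ae_of_all _ fun x => ?_)
  push_cast; ring

theorem prodHat_comm (v w : L2) (ξ : ℝ) : prodHat v w ξ = prodHat w v ξ := by
  simp only [prodHat, mul_comm]

theorem prodHat_add_left (v v' w : L2) (ξ : ℝ) :
    prodHat (v + v') w ξ = prodHat v w ξ + prodHat v' w ξ := by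
  rw [prodHat, prodHat, prodHat, ← hatL1_add (integrable_mul v w) (integrable_mul v' w)]
  refine hatL1_congr ?_ ξ
  filter_upwards [Lp.coeFn_add v v'] with x hx
  rw [hx, Pi.add_apply, add_mul]

theorem prodHat_smul_left (c : ℝ) (v w : L2) (ξ : ℝ) :
    prodHat (c • v) w ξ = c * prodHat v w ξ := by
  rw [prodHat, prodHat, ← hatL1_smul]
  refine hatL1_congr ?_ ξ
  filter_upwards [Lp.coeFn_smul c v] with x hx
  rw [hx, Pi.smul_apply, smul_eq_mul, mul_assoc]

theorem prodHat_sub_left (v v' w : L2) (ξ : ℝ) :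
    prodHat (v - v') w ξ = prodHat v w ξ - prodHat v' w ξ := by
  rw [sub_eq_add_neg, ← neg_one_smul ℝ v', prodHat_add_left, prodHat_smul_left]
  push_cast; ring

theorem continuous_prodHat : Continuous fun p : L2 × L2 × ℝ => prodHat p.1 p.2.1 p.2.2 := by
  rw [continuous_iff_continuousAt]
  rintro ⟨v, w, ξ⟩
  rw [ContinuousAt, tendsto_iff_norm_sub_tendsto_zero]
  refine squeeze_zero (g := fun p : L2 × L2 × ℝ => ‖p.1 - v‖ * ‖p.2.1‖ + ‖v‖ * ‖p.2.1 - w‖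
    + ‖prodHat v w p.2.2 - prodHat v w ξ‖) (fun _ => norm_nonneg _) (fun p => ?_) ?_
  · have e : prodHat p.1 p.2.1 p.2.2 - prodHat v w ξ = prodHat (p.1 - v) p.2.1 p.2.2
        + prodHat (p.2.1 - w) v p.2.2 + (prodHat v w p.2.2 - prodHat v w ξ) := by
      rw [prodHat_sub_left, prodHat_sub_left, prodHat_comm p.2.1 v, prodHat_comm w v]; ring
    rw [e]
    refine (norm_add₃_le).trans ?_
    gcongr
    · exact norm_prodHat_le _ _ _
    · rw [mul_comm]; exact norm_prodHat_le _ _ _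
  · have hc := (continuous_prodHat_right v w)
    have : Continuous fun p : L2 × L2 × ℝ => ‖p.1 - v‖ * ‖p.2.1‖ + ‖v‖ * ‖p.2.1 - w‖
        + ‖prodHat v w p.2.2 - prodHat v w ξ‖ := by fun_prop
    have h := this.tendsto (v, w, ξ)
    simpa using h

theorem peetre (ξ ζ : ℝ) : 1 + ξ ^ 2 ≤ 2 * ((1 + (ζ - ξ) ^ 2) * (1 + ζ ^ 2)) := by
  nlinarith [sq_nonneg (ζ * (ζ - ξ)), sq_nonneg (ζ + (ζ - ξ))]

theorem rpow_peetre {m : ℝ} (hm : 0 ≤ m) (ξ ζ : ℝ) : (1 + ξ ^ 2) ^ (m / 2) ≤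
    2 ^ (m / 2) * ((1 + (ζ - ξ) ^ 2) ^ (m / 2) * (1 + ζ ^ 2) ^ (m / 2)) := by
  rw [← Real.mul_rpow (by positivity) (by positivity),
    ← Real.mul_rpow (by positivity) (by positivity)]
  exact Real.rpow_le_rpow (by positivity) (peetre ξ ζ) (by positivity)

/-- The transform of a product is a convolution, since the Fourier transform is unitary and turns
modulation into translation. -/
theorem enorm_prodHat_le_lintegral (v w : L2) (a : ℝ) :
    ‖prodHat v w (a * (2 * Real.pi))‖ₑ ≤
      ∫⁻ η, ‖hat v ((η - a) * (2 * Real.pi))‖ₑ * ‖hat w (η * (2 * Real.pi))‖ₑ := by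
  have hV : MemLp (fun x : ℝ => Complex.exp (2 * Real.pi * a * x * Complex.I) * toC v x) 2 := by
    refine (Lp.memLp (toC v)).of_le ?_ (ae_of_all _ fun x => ?_)
    · exact (by fun_prop : Continuous fun x : ℝ =>
        Complex.exp (2 * Real.pi * a * x * Complex.I)).aestronglyMeasurable.mul
        (Lp.aestronglyMeasurable _)
    · rw [norm_mul, Complex.norm_exp]; simp
  have hV' := hV.coeFn_toLp
  generalize hV.toLp _ = V at hV'
  have e1 : prodHat v w (a * (2 * Real.pi)) = inner ℂ V (toC w) := by
    rw [L2.inner_def, prodHat, hatL1]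
    refine integral_congr_ae ?_
    filter_upwards [hV', toC_coe v, toC_coe w] with x h1 h2 h3
    rw [h1, h2, h3]
    simp only [RCLike.inner_apply, map_mul, ← Complex.exp_conj, Complex.conj_ofReal,
      Complex.conj_I, Complex.conj_ofNat]
    push_cast
    have : 2 * (Real.pi : ℂ) * a * x * -Complex.I = -Complex.I * (a * (2 * Real.pi)) * x := by
      ring
    rw [this]; ring
  rw [e1, ← Lp.inner_fourier_eq, L2.inner_def]
  refine (enorm_integral_le_lintegral_enorm _).trans (le_of_eq (lintegral_congr_ae ?_))
  filter_upwards [fourier_modulation a (toC v) V hV'] with η hη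
  rw [hη, hat_two_pi, hat_two_pi, RCLike.inner_apply, enorm_mul, RCLike.enorm_conj, mul_comm]

theorem eLpNorm_scaled_le {m : ℝ} (f : L2) :
    eLpNorm (fun η : ℝ => ((1 + (η * (2 * Real.pi)) ^ 2) ^ (m / 2) : ℝ) •
      hat f (η * (2 * Real.pi))) 2 volume ≤ (sobNorm m).toFun f := by
  have := eLpNorm_comp_mul two_pi_pos (fun ξ : ℝ => (1 + ξ ^ 2) ^ (m / 2) • hat f ξ)
    (aestronglyMeasurable_smul_hat (by fun_prop) f)
  refine this.trans_le ?_
  refine mul_le_of_le_one_left (by simp) ?_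
  rw [ENNReal.ofReal_le_one, Real.sqrt_le_one]
  exact inv_le_one_of_one_le₀ (by linarith [Real.pi_gt_three])

/-- The product estimate `⟨ξ⟩^m |(vw)^(ξ)| ≤ C ‖v‖_{H^m} ‖w‖_{H^m}`, pointwise in the frequency:
the Cauchy-Schwarz inequality for the convolution of the two transforms. -/
theorem prodHat_weighted_le {m : ℝ} (hm : 0 ≤ m) (v w : L2) (ξ : ℝ) :
    ENNReal.ofReal ((1 + ξ ^ 2) ^ (m / 2)) * ‖prodHat v w ξ‖ₑ ≤
      ENNReal.ofReal (2 ^ (m / 2)) * ((sobNorm m).toFun v * (sobNorm m).toFun w) := by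
  obtain ⟨a, rfl⟩ : ∃ a, ξ = a * (2 * Real.pi) :=
    ⟨ξ / (2 * Real.pi), (div_mul_cancel₀ _ two_pi_pos.ne').symm⟩
  have hgm : ∀ f, AEStronglyMeasurable (fun η : ℝ => ((1 + (η * (2 * Real.pi)) ^ 2) ^ (m / 2) : ℝ) •
      hat f (η * (2 * Real.pi))) volume := fun f =>
    (aestronglyMeasurable_smul_hat (w := fun ξ => (1 + ξ ^ 2) ^ (m / 2)) (by fun_prop)
      f).comp_quasiMeasurePreserving (quasiMeasurePreserving_mul two_pi_pos.ne')
  have hv := eLpNorm_scaled_le (m := m) v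
  have hw := eLpNorm_scaled_le (m := m) w
  have hvm := hgm v
  have hwm := hgm w
  have hpt : ∀ η : ℝ, ENNReal.ofReal ((1 + (a * (2 * Real.pi)) ^ 2) ^ (m / 2)) *
      (‖hat v ((η - a) * (2 * Real.pi))‖ₑ * ‖hat w (η * (2 * Real.pi))‖ₑ) ≤
      ENNReal.ofReal (2 ^ (m / 2)) *
      ‖((((1 + ((η - a) * (2 * Real.pi)) ^ 2) ^ (m / 2) : ℝ) • hat v ((η - a) * (2 * Real.pi))) •
        (((1 + (η * (2 * Real.pi)) ^ 2) ^ (m / 2) : ℝ) • hat w (η * (2 * Real.pi))) : ℂ)‖ₑ := by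
    intro η
    have hp := rpow_peetre hm (a * (2 * Real.pi)) (η * (2 * Real.pi))
    rw [← sub_mul] at hp
    rw [smul_eq_mul, enorm_mul, enorm_smul, enorm_smul, Real.enorm_of_nonneg (by positivity),
      Real.enorm_of_nonneg (by positivity)]
    calc _ ≤ ENNReal.ofReal (2 ^ (m / 2) * ((1 + ((η - a) * (2 * Real.pi)) ^ 2) ^ (m / 2) *
          (1 + (η * (2 * Real.pi)) ^ 2) ^ (m / 2))) *
          (‖hat v ((η - a) * (2 * Real.pi))‖ₑ * ‖hat w (η * (2 * Real.pi))‖ₑ) := by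
          gcongr
      _ = _ := by
          rw [ENNReal.ofReal_mul (by positivity), ENNReal.ofReal_mul (by positivity)]
          ring
  have htr := eLpNorm_comp_measurePreserving (p := 2) hvm (measurePreserving_sub_right volume a)
  have htm := hvm.comp_measurePreserving (measurePreserving_sub_right volume a)
  refine (mul_le_mul_right (enorm_prodHat_le_lintegral v w a) _).trans ?_
  rw [← lintegral_const_mul' _ _ ENNReal.ofReal_ne_top]
  refine (lintegral_mono hpt).trans ?_
  rw [lintegral_const_mul' _ _ ENNReal.ofReal_ne_top]
  gcongr
  refine le_trans ?_ (mul_le_mul' (htr.trans_le hv) hw)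
  have h := eLpNorm_smul_le_mul_eLpNorm (p := 2) (q := 2) (r := 1) hwm htm
  rw [eLpNorm_one_eq_lintegral_enorm] at h
  exact h

/-! ### The heat kernel bounds and the Duhamel integral -/

theorem one_le_jap (ξ : ℝ) : (1 : ℝ) ≤ 1 + ξ ^ 2 := by nlinarith [sq_nonneg ξ]

theorem jap_pos (ξ : ℝ) : (0 : ℝ) < 1 + ξ ^ 2 := by positivity

theorem symb_le {μ : ℝ} (hμ : 0 < μ) (ξ : ℝ) : symb μ ξ ≤ (1 + μ) - (1 + ξ ^ 2) := by
  have h : μ / (1 + ξ ^ 2) ^ (1 / 2 : ℝ) ≤ μ :=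
    div_le_self hμ.le (Real.one_le_rpow (one_le_jap ξ) (by norm_num))
  rw [symb]; linarith

theorem continuous_symb (μ : ℝ) : Continuous (symb μ) := by
  unfold symb
  refine Continuous.add (by fun_prop) (continuous_const.div ?_ fun ξ => by positivity)
  exact Continuous.rpow_const (by fun_prop) fun ξ => Or.inl (by positivity)

theorem symb_neg (μ ξ : ℝ) : symb μ (-ξ) = symb μ ξ := by simp [symb]

theorem exp_symb_le {μ : ℝ} (hμ : 0 < μ) {t : ℝ} (h0 : 0 ≤ t) (h1 : t ≤ 1) (ξ : ℝ) :
    Real.exp (t * symb μ ξ) ≤ Real.exp (1 + μ) * Real.exp (-(t * (1 + ξ ^ 2))) := by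
  rw [← Real.exp_add, Real.exp_le_exp]
  nlinarith [symb_le hμ ξ, mul_le_mul_of_nonneg_left (symb_le hμ ξ) h0]

theorem exp_symb_le_const {μ : ℝ} (hμ : 0 < μ) {t : ℝ} (h0 : 0 ≤ t) (h1 : t ≤ 1) (ξ : ℝ) :
    Real.exp (t * symb μ ξ) ≤ Real.exp (1 + μ) := by
  refine (exp_symb_le hμ h0 h1 ξ).trans (mul_le_of_le_one_right (by positivity) ?_)
  rw [Real.exp_le_one_iff]
  have := mul_nonneg h0 (jap_pos ξ).le
  linarith

theorem exp_neg_le_rpow {θ y : ℝ} (h0 : 0 ≤ θ) (h1 : θ ≤ 1) (hy : 0 < y) :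
    Real.exp (-y) ≤ y ^ (-θ) := by
  rw [Real.exp_neg, Real.rpow_neg hy.le]
  refine inv_anti₀ (by positivity) ?_
  rcases le_total y 1 with h | h
  · exact (Real.rpow_le_one hy.le h h0).trans (Real.one_le_exp hy.le)
  · calc y ^ θ ≤ y ^ (1 : ℝ) := Real.rpow_le_rpow_of_exponent_le h h1
      _ = y := Real.rpow_one y
      _ ≤ Real.exp y := by linarith [Real.add_one_le_exp y]

theorem exp_neg_le_rpow' {θ y : ℝ} (h0 : 0 < θ) (hy : 0 < y) :
    Real.exp (-y) ≤ θ ^ θ * y ^ (-θ) := by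
  have h1 := exp_neg_le_rpow zero_le_one le_rfl (div_pos hy h0)
  have h2 := Real.rpow_le_rpow (Real.exp_pos _).le h1 h0.le
  rw [← Real.exp_mul, ← Real.rpow_mul (div_pos hy h0).le] at h2
  have e1 : -(y / θ) * θ = -y := by field_simp
  have e2 : (y / θ) ^ (-1 * θ) = θ ^ θ * y ^ (-θ) := by
    rw [Real.div_rpow hy.le h0.le, neg_one_mul, Real.rpow_neg h0.le, div_inv_eq_mul, mul_comm]
  rwa [e1, e2] at h2

/-- The beta integral `∫₀¹ (1 - x)^{-θ} x^{-b} dx`. -/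
noncomputable def betaC (θ b : ℝ) : ℝ := ∫ x in (0 : ℝ)..1, (1 - x) ^ (-θ) * x ^ (-b)

theorem intervalIntegrable_beta_one {θ b : ℝ} (hθ : θ < 1) (hb : b < 1) :
    IntervalIntegrable (fun x : ℝ => (1 - x) ^ (-θ) * x ^ (-b)) volume 0 1 := by
  have h := (Complex.betaIntegral_convergent (u := ((1 - b : ℝ) : ℂ)) (v := ((1 - θ : ℝ) : ℂ))
    (by simpa using hb) (by simpa using hθ)).norm
  refine h.congr_uIoo ?_
  intro x hx
  rw [uIoo_of_le zero_le_one] at hx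
  have e1 : (1 - (x : ℂ)) = ((1 - x : ℝ) : ℂ) := by push_cast; ring
  simp only [norm_mul]
  rw [e1, Complex.norm_cpow_eq_rpow_re_of_pos hx.1,
    Complex.norm_cpow_eq_rpow_re_of_pos (sub_pos.2 hx.2), mul_comm]
  congr 2 <;> simp

theorem betaC_nonneg (θ b : ℝ) : 0 ≤ betaC θ b := by
  refine intervalIntegral.integral_nonneg zero_le_one fun x hx => ?_
  exact mul_nonneg (Real.rpow_nonneg (by linarith [hx.2]) _) (Real.rpow_nonneg hx.1 _)

theorem beta_scale {θ b t : ℝ} (ht : 0 < t) {x : ℝ} (hx : x ∈ Icc (0 : ℝ) t) :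
    (t - x) ^ (-θ) * x ^ (-b) =
      t ^ (-θ - b) * ((1 - t⁻¹ * x) ^ (-θ) * (t⁻¹ * x) ^ (-b)) := by
  have e : 1 - t⁻¹ * x = t⁻¹ * (t - x) := by field_simp
  rw [e, Real.mul_rpow (by positivity) (by linarith [hx.2]), Real.mul_rpow (by positivity) hx.1,
    Real.inv_rpow ht.le, Real.inv_rpow ht.le, sub_eq_add_neg (-θ), Real.rpow_add ht]
  have h1 : t ^ (-θ) ≠ 0 := (Real.rpow_pos_of_pos ht _).ne'
  have h2 : t ^ (-b) ≠ 0 := (Real.rpow_pos_of_pos ht _).ne'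
  field_simp

theorem intervalIntegrable_beta {θ b : ℝ} (hθ : θ < 1) (hb : b < 1) {t : ℝ} (ht : 0 < t) :
    IntervalIntegrable (fun x : ℝ => (t - x) ^ (-θ) * x ^ (-b)) volume 0 t := by
  have h := ((intervalIntegrable_beta_one hθ hb).comp_mul_left (c := t⁻¹)).const_mul (t ^ (-θ - b))
  rw [zero_div, one_div, inv_inv] at h
  refine h.congr_uIoo ?_
  intro x hx
  rw [uIoo_of_le ht.le] at hx
  exact (beta_scale ht ⟨hx.1.le, hx.2.le⟩).symm

theorem integral_beta {θ b : ℝ} {t : ℝ} (ht : 0 < t) :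
    ∫ x in (0 : ℝ)..t, (t - x) ^ (-θ) * x ^ (-b) = t ^ (1 - θ - b) * betaC θ b := by
  have h : ∫ x in (0 : ℝ)..t, (t - x) ^ (-θ) * x ^ (-b) = ∫ x in (0 : ℝ)..t,
      t ^ (-θ - b) * ((1 - t⁻¹ * x) ^ (-θ) * (t⁻¹ * x) ^ (-b)) := by
    refine intervalIntegral.integral_congr fun x hx => ?_
    rw [uIcc_of_le ht.le] at hx
    exact beta_scale ht hx
  rw [h, intervalIntegral.integral_const_mul,
    intervalIntegral.integral_comp_mul_left (fun y => (1 - y) ^ (-θ) * y ^ (-b))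
      (inv_ne_zero ht.ne'), mul_zero, inv_mul_cancel₀ ht.ne', inv_inv, smul_eq_mul, ← mul_assoc,
    betaC]
  congr 1
  rw [show 1 - θ - b = (-θ - b) + 1 by ring, Real.rpow_add ht, Real.rpow_one]

/-- The Duhamel integral `½ ∫₀ᵗ e^{(t-τ)Φ(ξ)} h(τ,ξ) dτ`. -/
noncomputable def duh (μ : ℝ) (h : ℝ → ℝ → ℂ) (t ξ : ℝ) : ℂ :=
  (1 / 2 : ℝ) • ∫ τ in (0 : ℝ)..t, Real.exp ((t - τ) * symb μ ξ) • h τ ξ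

theorem duh_zero (μ : ℝ) (h : ℝ → ℝ → ℂ) (ξ : ℝ) : duh μ h 0 ξ = 0 := by simp [duh]

/-- The smoothing bound for the Duhamel integral of a source that is singular at `τ = 0` and may
grow like `e^{λτ}`; the decay `(1 + ξ² + λ)^{-θ}` is gained at the price of the power `t^{-θ}`. -/
theorem norm_duh_le {μ : ℝ} (hμ : 0 < μ) {θ b : ℝ} (hθ0 : 0 ≤ θ) (hθ : θ < 1) (hb : b < 1)
    {h : ℝ → ℝ → ℂ} {t ξ K lam : ℝ} (ht0 : 0 < t) (ht1 : t ≤ 1) (hlam : 0 ≤ lam)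
    (hK : ∀ τ ∈ Ioo 0 t, ‖h τ ξ‖ ≤ K * (Real.exp (lam * τ) * τ ^ (-b))) :
    ‖duh μ h t ξ‖ ≤ Real.exp (1 + μ) * betaC θ b * K * Real.exp (lam * t) * t ^ (1 - θ - b) *
      (1 + ξ ^ 2 + lam) ^ (-θ) := by
  set J := 1 + ξ ^ 2 + lam with hJ
  have hJ0 : 0 < J := by have := jap_pos ξ; linarith
  set C := Real.exp (1 + μ) * K * Real.exp (lam * t) * J ^ (-θ) with hC
  have hbd : ∀ τ ∈ Ioo 0 t, ‖Real.exp ((t - τ) * symb μ ξ) • h τ ξ‖ ≤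
      C * ((t - τ) ^ (-θ) * τ ^ (-b)) := by
    intro τ hτ
    have hs : 0 < t - τ := sub_pos.2 hτ.2
    have hτb : 0 < τ ^ (-b) := Real.rpow_pos_of_pos hτ.1 _
    have hK0 : 0 ≤ K := by
      have := (norm_nonneg _).trans (hK τ hτ)
      exact nonneg_of_mul_nonneg_left this (by positivity)
    have e1 := exp_symb_le hμ hs.le (by linarith [hτ.1]) ξ
    have e2 : Real.exp (-((t - τ) * J)) ≤ (t - τ) ^ (-θ) * J ^ (-θ) := by
      rw [← Real.mul_rpow hs.le hJ0.le]
      exact exp_neg_le_rpow hθ0 hθ.le (mul_pos hs hJ0)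
    have e3 : Real.exp (-((t - τ) * (1 + ξ ^ 2))) * Real.exp (lam * τ) =
        Real.exp (lam * t) * Real.exp (-((t - τ) * J)) := by
      rw [← Real.exp_add, ← Real.exp_add, hJ]; ring_nf
    rw [norm_smul, Real.norm_of_nonneg (by positivity)]
    calc _ ≤ (Real.exp (1 + μ) * Real.exp (-((t - τ) * (1 + ξ ^ 2)))) *
          (K * (Real.exp (lam * τ) * τ ^ (-b))) :=
          mul_le_mul e1 (hK τ hτ) (norm_nonneg _) (by positivity)
      _ = Real.exp (1 + μ) * K * τ ^ (-b) *
          (Real.exp (-((t - τ) * (1 + ξ ^ 2))) * Real.exp (lam * τ)) := by ring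
      _ = Real.exp (1 + μ) * K * τ ^ (-b) *
          (Real.exp (lam * t) * Real.exp (-((t - τ) * J))) := by rw [e3]
      _ ≤ Real.exp (1 + μ) * K * τ ^ (-b) *
          (Real.exp (lam * t) * ((t - τ) ^ (-θ) * J ^ (-θ))) := by gcongr
      _ = _ := by rw [hC]; ring
  have hint : ‖∫ τ in (0 : ℝ)..t, Real.exp ((t - τ) * symb μ ξ) • h τ ξ‖ ≤
      ∫ τ in (0 : ℝ)..t, C * ((t - τ) ^ (-θ) * τ ^ (-b)) := by
    refine intervalIntegral.norm_integral_le_of_norm_le ht0.le ?_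
      ((intervalIntegrable_beta hθ hb ht0).const_mul C)
    filter_upwards [compl_mem_ae_iff.2 (measure_singleton t)] with τ hne hτ
    exact hbd τ ⟨hτ.1, lt_of_le_of_ne hτ.2 hne⟩
  rw [intervalIntegral.integral_const_mul, integral_beta ht0] at hint
  rw [duh, norm_smul]
  have hn : ‖(1 / 2 : ℝ)‖ ≤ 1 := by norm_num
  calc _ ≤ 1 * (C * (t ^ (1 - θ - b) * betaC θ b)) :=
        mul_le_mul hn hint (norm_nonneg _) zero_le_one
    _ = _ := by rw [hC]; ring

/-! ### Sources -/

/-- A source on `(0,T]`: a jointly measurable hermitian function with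
`|h(τ,ξ)| ≤ K τ^{-b} ⟨ξ⟩^{-m}`. -/
structure IsSource (T K b m : ℝ) (h : ℝ → ℝ → ℂ) : Prop where
  meas : StronglyMeasurable (Function.uncurry h)
  herm : ∀ τ ξ, h τ (-ξ) = (starRingEnd ℂ) (h τ ξ)
  bound : ∀ τ ∈ Ioc 0 T, ∀ ξ, ‖h τ ξ‖ ≤ K * τ ^ (-b) * (1 + ξ ^ 2) ^ (-(m / 2))

theorem IsSource.meas_left {T K b m : ℝ} {h : ℝ → ℝ → ℂ} (hh : IsSource T K b m h) (ξ : ℝ) :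
    StronglyMeasurable fun τ => h τ ξ :=
  hh.meas.comp_measurable (measurable_id.prodMk measurable_const)

theorem IsSource.intervalIntegrable {T K b m : ℝ} {h : ℝ → ℝ → ℂ} (hh : IsSource T K b m h)
    (hb : b < 1) {t : ℝ} (ht : t ∈ Icc 0 T) (ξ : ℝ) {g : ℝ → ℝ} (hg : Continuous g) :
    IntervalIntegrable (fun τ => g τ • h τ ξ) volume 0 t := by
  have h1 : IntervalIntegrable (fun τ => h τ ξ) volume 0 t := by
    have h0 : IntervalIntegrable
        (fun τ : ℝ => K * τ ^ (-b) * (1 + ξ ^ 2) ^ (-(m / 2))) volume 0 t :=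
      ((intervalIntegral.intervalIntegrable_rpow' (by linarith)).const_mul K).mul_const _
    refine h0.mono_fun (hh.meas_left ξ).aestronglyMeasurable ?_
    rw [uIoc_of_le ht.1]
    filter_upwards [ae_restrict_mem measurableSet_Ioc] with τ hτ
    refine (hh.bound τ ⟨hτ.1, hτ.2.trans ht.2⟩ ξ).trans (le_abs_self _)
  exact h1.continuousOn_smul hg.continuousOn

theorem IsSource.exp_intervalIntegrable {T K b m : ℝ} {h : ℝ → ℝ → ℂ} (hh : IsSource T K b m h)
    (hb : b < 1) {t : ℝ} (ht : t ∈ Icc 0 T) (μ t' ξ : ℝ) :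
    IntervalIntegrable (fun τ => Real.exp ((t' - τ) * symb μ ξ) • h τ ξ) volume 0 t :=
  hh.intervalIntegrable hb ht ξ (g := fun τ => Real.exp ((t' - τ) * symb μ ξ)) (by fun_prop)

theorem duh_eq (μ : ℝ) (h : ℝ → ℝ → ℂ) (t ξ : ℝ) : duh μ h t ξ =
    (1 / 2 : ℝ) • Real.exp (t * symb μ ξ) •
      ∫ τ in (0 : ℝ)..t, Real.exp (-τ * symb μ ξ) • h τ ξ := by
  rw [duh]
  congr 1
  rw [← intervalIntegral.integral_smul (Real.exp (t * symb μ ξ))]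
  refine intervalIntegral.integral_congr fun τ _ => ?_
  simp only [smul_smul, ← Real.exp_add]
  congr 2; ring

theorem IsSource.continuousOn_duh {T K b m : ℝ} {h : ℝ → ℝ → ℂ} (hh : IsSource T K b m h)
    (hb : b < 1) (hT : 0 ≤ T) (μ ξ : ℝ) : ContinuousOn (fun t => duh μ h t ξ) (Icc 0 T) := by
  simp only [duh_eq]
  have h1 : IntervalIntegrable (fun τ => Real.exp (-τ * symb μ ξ) • h τ ξ) volume 0 T :=
    hh.intervalIntegrable hb ⟨hT, le_rfl⟩ ξ (g := fun τ => Real.exp (-τ * symb μ ξ)) (by fun_prop)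
  have h2 := intervalIntegral.continuousOn_primitive_interval (a := 0) (b := T) (f := fun τ =>
    Real.exp (-τ * symb μ ξ) • h τ ξ) (μ := volume) (by
      rw [uIcc_of_le hT, integrableOn_Icc_iff_integrableOn_Ioc]
      exact (intervalIntegrable_iff_integrableOn_Ioc_of_le hT).1 h1)
  rw [uIcc_of_le hT] at h2
  exact ((by fun_prop : Continuous fun t : ℝ => Real.exp (t * symb μ ξ)).continuousOn.smul
    h2).const_smul (1 / 2 : ℝ)

theorem IsSource.stronglyMeasurable_duh {T K b m : ℝ} {h : ℝ → ℝ → ℂ} (hh : IsSource T K b m h)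
    (μ t : ℝ) : StronglyMeasurable (duh μ h t) := by
  have hc : StronglyMeasurable fun p : ℝ × ℝ =>
      Real.exp ((t - p.2) * symb μ p.1) • h p.2 p.1 := by
    have := continuous_symb μ
    have h1 : StronglyMeasurable fun p : ℝ × ℝ => Real.exp ((t - p.2) * symb μ p.1) :=
      (by fun_prop : Continuous fun p : ℝ × ℝ =>
        Real.exp ((t - p.2) * symb μ p.1)).stronglyMeasurable
    exact h1.smul (hh.meas.comp_measurable measurable_swap)
  exact (hc.integral_prod_right.sub hc.integral_prod_right).const_smul (1 / 2 : ℝ)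

theorem IsSource.duh_neg {T K b m : ℝ} {h : ℝ → ℝ → ℂ} (hh : IsSource T K b m h)
    (μ t ξ : ℝ) : duh μ h t (-ξ) = (starRingEnd ℂ) (duh μ h t ξ) := by
  unfold duh
  simp only [intervalIntegral, Complex.real_smul, map_mul, map_sub, ← integral_conj,
    Complex.conj_ofReal, hh.herm, symb_neg]

/-! ### Square-integrable frequency envelopes -/

/-- The `L²` norm of `⟨ξ⟩^{-2r}`. -/
noncomputable def japN (r : ℝ) : ℝ≥0∞ := eLpNorm (fun ξ : ℝ => (1 + ξ ^ 2) ^ (-r)) 2 volume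

theorem memLp_jap {r : ℝ} (hr : 1 / 4 < r) : MemLp (fun ξ : ℝ => (1 + ξ ^ 2) ^ (-r)) 2 := by
  have hm : Measurable fun ξ : ℝ => (1 + ξ ^ 2) ^ (-r) := by fun_prop
  rw [memLp_two_iff_integrable_sq hm.aestronglyMeasurable]
  have h := integrable_rpow_neg_one_add_norm_sq (E := ℝ) (μ := volume) (r := 4 * r)
    (by simp; linarith)
  refine h.congr (ae_of_all _ fun ξ => ?_)
  simp only [Real.norm_eq_abs, sq_abs]
  rw [← Real.rpow_mul_natCast (by positivity)]
  congr 1; push_cast; ring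

theorem japN_lt_top {r : ℝ} (hr : 1 / 4 < r) : japN r < ⊤ := (memLp_jap hr).2

theorem eLpNorm_weight_le {w : ℝ → ℝ} {F : ℝ → ℂ} {K p q : ℝ}
    (hw : ∀ ξ, |w ξ| ≤ (1 + ξ ^ 2) ^ q) (hF : ∀ ξ, ‖F ξ‖ ≤ K * (1 + ξ ^ 2) ^ (-p)) :
    eLpNorm (fun ξ => w ξ • F ξ) 2 volume ≤ ENNReal.ofReal K * japN (p - q) := by
  by_cases hK : K < 0
  · have h1 := (norm_nonneg _).trans (hF 0)
    simp at h1
    linarith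
  · rw [← Real.enorm_of_nonneg (not_lt.1 hK), japN, ← eLpNorm_const_smul]
    refine eLpNorm_mono fun ξ => ?_
    have e : (1 + ξ ^ 2) ^ (-(p - q)) = (1 + ξ ^ 2) ^ q * (1 + ξ ^ 2) ^ (-p) := by
      rw [← Real.rpow_add (jap_pos ξ)]; congr 1; ring
    have hK := not_lt.1 hK
    have e2 : ‖(K • fun ξ : ℝ => (1 + ξ ^ 2) ^ (-(p - q))) ξ‖ =
        (1 + ξ ^ 2) ^ q * (K * (1 + ξ ^ 2) ^ (-p)) := by
      rw [Pi.smul_apply, e, smul_eq_mul, Real.norm_of_nonneg (by positivity)]; ring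
    rw [norm_smul, Real.norm_eq_abs, e2]
    exact mul_le_mul (hw ξ) (hF ξ) (norm_nonneg _) (by positivity)

/-- The exponent of the time singularity of the quadratic source in `X_T^s`. -/
noncomputable def sing (s : ℝ) : ℝ := max (1 - s) 0

/-- The exponent of the frequency decay of the quadratic source in `X_T^s`. -/
noncomputable def dec (s : ℝ) : ℝ := max (s - 1) 0

theorem dec_sub_sing (s : ℝ) : dec s - sing s = s - 1 := by
  unfold dec sing
  rcases le_total s 1 with h | h
  · rw [max_eq_right (by linarith), max_eq_left (by linarith)]; ring
  · rw [max_eq_left (by linarith), max_eq_right (by linarith)]; ring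

theorem sing_nonneg (s : ℝ) : 0 ≤ sing s := le_max_right _ _
theorem dec_nonneg (s : ℝ) : 0 ≤ dec s := le_max_right _ _

theorem sing_lt {s : ℝ} (hs : 1 / 2 < s) : sing s < 1 / 2 := max_lt (by linarith) (by norm_num)

theorem two_mul_weightExp (s : ℝ) : 2 * weightExp s = sing s := by
  unfold weightExp sing
  rw [mul_max_of_nonneg _ _ (by norm_num)]; ring_nf

theorem weightExp_nonneg (s : ℝ) : 0 ≤ weightExp s := le_max_right _ _

theorem le_weightExp (s : ℝ) : (1 - s) / 2 ≤ weightExp s := le_max_left _ _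

/-- The Duhamel integral of a source of the kind that arises in `X_T^s` gains up to
`1/2 - (1-s)₊` derivatives, with a positive power of `T`. -/
theorem exists_duh_bound {μ : ℝ} (hμ : 0 < μ) {s s' : ℝ} (hs : 1 / 2 < s)
    (hs' : s' < s + 1 / 2 - sing s) :
    ∃ γ p p' C : ℝ, 0 < γ ∧ s' / 2 + 1 / 4 < p ∧ 3 / 4 < p' ∧ 0 ≤ C ∧
      ∀ T ∈ Ioc (0 : ℝ) 1, ∀ (K : ℝ) (h : ℝ → ℝ → ℂ), 0 ≤ K → IsSource T K (sing s) (dec s) h →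
        ∀ t ∈ Icc 0 T, ∀ ξ : ℝ,
          ‖duh μ h t ξ‖ ≤ C * K * T ^ γ * (1 + ξ ^ 2) ^ (-p) ∧
          t ^ weightExp s' * ‖duh μ h t ξ‖ ≤ C * K * T ^ γ * (1 + ξ ^ 2) ^ (-p') := by
  set b := sing s with hb
  set m := dec s with hm
  have hmb : m - b = s - 1 := dec_sub_sing s
  have hb0 : 0 ≤ b := sing_nonneg s
  have hm0 : 0 ≤ m := dec_nonneg s
  have hb1 : b < 1 / 2 := sing_lt hs
  have ha := le_weightExp s'
  have ha0 := weightExp_nonneg s'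
  set a' := weightExp s'
  obtain ⟨θ, hθ1, hθ2⟩ := exists_between (show max 0 ((s' - m) / 2 + 1 / 4) < 1 - b from
    max_lt (by linarith) (by linarith))
  obtain ⟨θ', hθ'1, hθ'2⟩ := exists_between (show max 0 (3 / 4 - m / 2) < min 1 (a' + 1 - b) from
    max_lt (lt_min (by norm_num) (by linarith)) (lt_min (by linarith) (by linarith)))
  rw [max_lt_iff] at hθ1 hθ'1
  rw [lt_min_iff] at hθ'2
  refine ⟨min (1 - θ - b) (a' + 1 - θ' - b), θ + m / 2, θ' + m / 2,
    Real.exp (1 + μ) * (betaC θ b + betaC θ' b), lt_min (by linarith) (by linarith), by linarith,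
    by linarith, by have := betaC_nonneg θ b; have := betaC_nonneg θ' b; positivity, ?_⟩
  intro T hT K h hK hh t ht ξ
  have hγ0 : 0 < min (1 - θ - b) (a' + 1 - θ' - b) := lt_min (by linarith) (by linarith)
  set γ := min (1 - θ - b) (a' + 1 - θ' - b) with hγ
  have hB1 := betaC_nonneg θ b
  have hB2 := betaC_nonneg θ' b
  have hTγ : 0 < T ^ γ := Real.rpow_pos_of_pos hT.1 γ
  have hJ := jap_pos ξ
  rcases ht.1.eq_or_lt with h0 | h0
  · rw [← h0, duh_zero, norm_zero, mul_zero]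
    exact ⟨by positivity, by positivity⟩
  · have hpow : ∀ α, γ ≤ α → t ^ α ≤ T ^ γ := fun α hα =>
      (Real.rpow_le_rpow h0.le ht.2 (hγ0.le.trans hα)).trans
        (Real.rpow_le_rpow_of_exponent_ge hT.1 hT.2 hα)
    have hsrc : ∀ τ ∈ Ioo 0 t, ‖h τ ξ‖ ≤
        (K * (1 + ξ ^ 2) ^ (-(m / 2))) * (Real.exp (0 * τ) * τ ^ (-b)) := by
      intro τ hτ
      refine (hh.bound τ ⟨hτ.1, hτ.2.le.trans ht.2⟩ ξ).trans (le_of_eq ?_)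
      rw [zero_mul, Real.exp_zero]; ring
    have key : ∀ ϑ, 0 ≤ ϑ → ϑ < 1 → ‖duh μ h t ξ‖ ≤ Real.exp (1 + μ) * betaC ϑ b * K *
        t ^ (1 - ϑ - b) * (1 + ξ ^ 2) ^ (-(ϑ + m / 2)) := by
      intro ϑ h1 h2
      refine (norm_duh_le hμ h1 h2 (by linarith) h0 (ht.2.trans hT.2) le_rfl hsrc).trans
        (le_of_eq ?_)
      rw [neg_add, Real.rpow_add hJ, zero_mul, Real.exp_zero, add_zero]; ring
    constructor
    · refine (key θ hθ1.1.le (by linarith)).trans ?_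
      have := hpow (1 - θ - b) (min_le_left _ _)
      calc _ ≤ Real.exp (1 + μ) * (betaC θ b + betaC θ' b) * K *
            T ^ γ * (1 + ξ ^ 2) ^ (-(θ + m / 2)) := by
            gcongr; linarith
        _ = _ := by ring
    · have h2 := hpow (a' + 1 - θ' - b) (min_le_right _ _)
      have e : t ^ (a' + 1 - θ' - b) = t ^ a' * t ^ (1 - θ' - b) := by
        rw [← Real.rpow_add h0]; congr 1; ring
      rw [e] at h2
      calc _ ≤ t ^ a' * (Real.exp (1 + μ) * betaC θ' b * K *
            t ^ (1 - θ' - b) * (1 + ξ ^ 2) ^ (-(θ' + m / 2))) := by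
            gcongr; exact key θ' hθ'1.1.le hθ'2.1
        _ = Real.exp (1 + μ) * betaC θ' b * K * (t ^ a' * t ^ (1 - θ' - b)) *
            (1 + ξ ^ 2) ^ (-(θ' + m / 2)) := by ring
        _ ≤ Real.exp (1 + μ) * (betaC θ b + betaC θ' b) * K * T ^ γ *
            (1 + ξ ^ 2) ^ (-(θ' + m / 2)) := by
            gcongr; linarith
        _ = _ := by ring

/-! ### Completeness of the function spaces -/

theorem ExtNorm.enorm_eq {V : Type} [AddCommGroup V] [Module ℝ V] (N : ExtNorm V) (x : N.Space) :
    ‖x‖ₑ = N.toFun (N.incl x) := by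
  rw [← ofReal_norm, ExtNorm.norm_def, ENNReal.ofReal_toReal (N.incl_lt_top x).ne]

theorem ExtNorm.incl_injective {V : Type} [AddCommGroup V] [Module ℝ V] (N : ExtNorm V) :
    Function.Injective N.incl := Subtype.val_injective

theorem ExtNorm.exists_incl {V : Type} [AddCommGroup V] [Module ℝ V] (N : ExtNorm V) {x : V}
    (hx : N.toFun x < ⊤) : ∃ y : N.Space, N.incl y = x := ⟨⟨x, hx⟩, rfl⟩

/-- A lower semicontinuous extended norm that dominates a complete norm is complete on the space
where it is finite. -/
theorem ExtNorm.completeSpace {V : Type} [NormedAddCommGroup V] [NormedSpace ℝ V] [CompleteSpace V]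
    (N : ExtNorm V) (hle : ∀ x, ‖x‖ₑ ≤ N.toFun x) (hN : LowerSemicontinuous N.toFun) :
    CompleteSpace N.Space := by
  refine Metric.complete_of_cauchySeq_tendsto fun u hu => ?_
  have hlip : ∀ x y : N.Space, dist (N.incl x) (N.incl y) ≤ dist x y := by
    intro x y
    rw [dist_eq_norm, dist_eq_norm, ← map_sub, norm_def, ← toReal_enorm]
    exact ENNReal.toReal_mono (N.incl_lt_top _).ne (hle _)
  have hc : CauchySeq fun n => N.incl (u n) := by
    rw [Metric.cauchySeq_iff] at hu ⊢
    intro ε hε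
    obtain ⟨n, hn⟩ := hu ε hε
    exact ⟨n, fun m hm k hk => (hlip _ _).trans_lt (hn m hm k hk)⟩
  obtain ⟨x, hx⟩ := cauchySeq_tendsto_of_complete hc
  have key : ∀ ε > 0, ∃ n, ∀ m ≥ n, N.toFun (N.incl (u m) - x) ≤ ENNReal.ofReal ε := by
    intro ε hε
    obtain ⟨n, hn⟩ := Metric.cauchySeq_iff.1 hu ε hε
    refine ⟨n, fun m hm => ?_⟩
    have hcl := lowerSemicontinuous_iff_isClosed_preimage.1 hN (ENNReal.ofReal ε)
    have ht : Tendsto (fun k => N.incl (u m) - N.incl (u k)) atTop (𝓝 (N.incl (u m) - x)) :=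
      tendsto_const_nhds.sub hx
    refine hcl.mem_of_tendsto ht ?_
    filter_upwards [eventually_ge_atTop n] with k hk
    have h := hn m hm k hk
    rw [dist_eq_norm] at h
    change N.toFun _ ≤ _
    rw [← map_sub, ← N.enorm_eq, ← ofReal_norm]
    exact ENNReal.ofReal_le_ofReal h.le
  have hfin : N.toFun x < ⊤ := by
    obtain ⟨n, hn⟩ := key 1 one_pos
    have h1 : N.incl (u n) - x ∈ N.finite := lt_of_le_of_lt (hn n le_rfl) ENNReal.ofReal_lt_top
    have h2 := N.finite.sub_mem (u n).2 h1
    have h3 : (u n).1 - (N.incl (u n) - x) = x := sub_sub_cancel _ _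
    rw [h3] at h2
    exact h2
  obtain ⟨y, rfl⟩ := N.exists_incl hfin
  refine ⟨y, Metric.tendsto_atTop'.2 fun ε hε => ?_⟩
  obtain ⟨n, hn⟩ := key (ε / 2) (by positivity)
  refine ⟨n, fun m hm => ?_⟩
  have h := hn m hm.le
  rw [← map_sub, ← N.enorm_eq, ← ofReal_norm] at h
  rw [dist_eq_norm]
  exact ((ENNReal.ofReal_le_ofReal_iff (by positivity)).1 h).trans_lt (by linarith)

/-- The weighted norms are lower semicontinuous on `L²`, by Fatou's lemma. -/
theorem lowerSemicontinuous_wN {w : ℝ → ℝ} (hw : Measurable w) : LowerSemicontinuous (wN w) := by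
  rw [lowerSemicontinuous_iff_isClosed_preimage]
  intro C
  refine IsSeqClosed.isClosed fun f g hf hfg => ?_
  have h1 : Tendsto (fun n => eLpNorm (hat (f n) - hat g) 2 volume) atTop (𝓝 0) := by
    have h2 : ∀ n, eLpNorm (hat (f n) - hat g) 2 volume =
        ENNReal.ofReal (√(2 * Real.pi)) * ‖f n - g‖ₑ := fun n => by
      rw [← eLpNorm_hat]; exact eLpNorm_congr_ae (hat_sub _ _).symm
    simp only [h2]
    have h3 : Tendsto (fun n => ‖f n - g‖ₑ) atTop (𝓝 0) := by
      have := (hfg.sub_const g).enorm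
      simpa using this
    have h4 := ENNReal.Tendsto.const_mul h3
      (Or.inr (ENNReal.ofReal_ne_top (r := √(2 * Real.pi))))
    rwa [mul_zero] at h4
  have h2 := tendstoInMeasure_of_tendsto_eLpNorm (by norm_num)
    (fun n => hat_aestronglyMeasurable (f n)) (hat_aestronglyMeasurable g) h1
  obtain ⟨ns, _, hns⟩ := h2.exists_seq_tendsto_ae
  refine Lp.eLpNorm_le_of_ae_tendsto (u := atTop) (f := fun n ξ => w ξ • hat (f (ns n)) ξ)
    (Eventually.of_forall fun n => hf (ns n)) (fun n => aestronglyMeasurable_smul_hat hw _) ?_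
  filter_upwards [hns] with ξ hξ
  exact hξ.const_smul _

theorem dxNorm_eq_const_mul (f : L2) :
    dxNorm f = (ENNReal.ofReal (√(2 * Real.pi)))⁻¹ * wN (fun ξ => ξ) f := by
  rw [← dxNorm_eq, ← mul_assoc, ENNReal.inv_mul_cancel sqrt_two_pi_ne ENNReal.ofReal_ne_top, one_mul]

theorem lowerSemicontinuous_const_mul {X : Type*} [TopologicalSpace X] {f : X → ℝ≥0∞}
    (hf : LowerSemicontinuous f) {c : ℝ≥0∞} (hc : c ≠ ⊤) :
    LowerSemicontinuous fun x => c * f x :=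
  (ENNReal.continuous_const_mul hc).comp_lowerSemicontinuous hf fun _ _ h => by
    change c * _ ≤ c * _; gcongr

theorem lowerSemicontinuous_dxNorm : LowerSemicontinuous dxNorm := by
  have h : dxNorm = fun f => (ENNReal.ofReal (√(2 * Real.pi)))⁻¹ * wN (fun ξ => ξ) f :=
    funext dxNorm_eq_const_mul
  rw [h]
  exact lowerSemicontinuous_const_mul (lowerSemicontinuous_wN measurable_id)
    (ENNReal.inv_ne_top.2 sqrt_two_pi_ne)

theorem completeSpace_sob {s : ℝ} (hs : 0 ≤ s) : CompleteSpace (Sob s) :=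
  (sobNorm s).completeSpace (enorm_le_sobNorm hs) (lowerSemicontinuous_wN (by fun_prop))

theorem norm_toL2_le {s : ℝ} (hs : 0 ≤ s) (f : Sob s) : ‖f.toL2‖ ≤ ‖f‖ := by
  rw [ExtNorm.norm_def, ← toReal_enorm]
  exact ENNReal.toReal_mono ((sobNorm s).incl_lt_top _).ne (enorm_le_sobNorm hs _)

theorem continuous_toL2 {s : ℝ} (hs : 0 ≤ s) : Continuous (Sob.toL2 : Sob s → L2) :=
  AddMonoidHomClass.continuous_of_bound (sobNorm s).incl 1 fun f => by
    rw [one_mul]; exact norm_toL2_le hs f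

theorem enorm_le_xNorm {s T : ℝ} (u : C(Icc (0 : ℝ) T, Sob s)) : ‖u‖ₑ ≤ (xNorm s T).toFun u := by
  by_cases h : (xNorm s T).toFun u = ⊤
  · rw [h]; exact le_top
  · rw [← ofReal_norm, ← ENNReal.ofReal_toReal h]
    refine ENNReal.ofReal_le_ofReal ((ContinuousMap.norm_le _ ENNReal.toReal_nonneg).2 fun t => ?_)
    rw [← toReal_enorm]
    refine ENNReal.toReal_mono h ?_
    exact le_self_add.trans (le_iSup (fun t : Icc (0 : ℝ) T =>
      (‖u t‖ₑ + ENNReal.ofReal ((t : ℝ) ^ weightExp s) * dxNorm (u t).toL2)) t)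

theorem norm_toCont_le {s T : ℝ} (u : XSpace s T) : ‖u.toCont‖ ≤ ‖u‖ := by
  rw [ExtNorm.norm_def, ← toReal_enorm]
  exact ENNReal.toReal_mono ((xNorm s T).incl_lt_top _).ne (enorm_le_xNorm _)

theorem completeSpace_xSpace {s : ℝ} (hs : 0 ≤ s) (T : ℝ) : CompleteSpace (XSpace s T) := by
  have := completeSpace_sob hs
  refine (xNorm s T).completeSpace enorm_le_xNorm ?_
  refine lowerSemicontinuous_iSup fun t => LowerSemicontinuous.add ?_ ?_
  · exact ((ContinuousEvalConst.continuous_eval_const t).enorm).lowerSemicontinuous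
  · exact lowerSemicontinuous_const_mul (LowerSemicontinuous.comp lowerSemicontinuous_dxNorm
      ((continuous_toL2 hs).comp (ContinuousEvalConst.continuous_eval_const t)))
      ENNReal.ofReal_ne_top

/-! ### Trajectories -/

theorem XSpace.traj_of_mem {s T : ℝ} (u : XSpace s T) {t : ℝ} (ht : t ∈ Icc 0 T) :
    u.traj t = (u.toCont ⟨t, ht⟩).toL2 := dif_pos ht

theorem XSpace.traj_of_notMem {s T : ℝ} (u : XSpace s T) {t : ℝ} (ht : t ∉ Icc 0 T) :
    u.traj t = 0 := dif_neg ht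

theorem XSpace.ext_traj {s T : ℝ} {u w : XSpace s T} (h : ∀ t ∈ Icc 0 T, u.traj t = w.traj t) :
    u = w := by
  refine (xNorm s T).incl_injective (ContinuousMap.ext fun t => ?_)
  have := h t t.2
  rw [u.traj_of_mem t.2, w.traj_of_mem t.2] at this
  exact (sobNorm s).incl_injective this

theorem XSpace.ext_hat {s T : ℝ} {u w : XSpace s T}
    (h : ∀ t ∈ Icc 0 T, hat (u.traj t) =ᵐ[volume] hat (w.traj t)) : u = w :=
  XSpace.ext_traj fun t ht => hat_injective (h t ht)

theorem XSpace.traj_add {s T : ℝ} (u w : XSpace s T) (t : ℝ) :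
    (u + w).traj t = u.traj t + w.traj t := by
  by_cases ht : t ∈ Icc 0 T
  · rw [traj_of_mem _ ht, traj_of_mem _ ht, traj_of_mem _ ht, XSpace.toCont, map_add,
      ContinuousMap.add_apply, Sob.toL2, map_add]
  · rw [traj_of_notMem _ ht, traj_of_notMem _ ht, traj_of_notMem _ ht, add_zero]

theorem XSpace.traj_smul {s T : ℝ} (c : ℝ) (u : XSpace s T) (t : ℝ) :
    (c • u).traj t = c • u.traj t := by
  by_cases ht : t ∈ Icc 0 T
  · rw [traj_of_mem _ ht, traj_of_mem _ ht, XSpace.toCont, map_smul,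
      ContinuousMap.smul_apply, Sob.toL2, map_smul]
  · rw [traj_of_notMem _ ht, traj_of_notMem _ ht, smul_zero]

theorem XSpace.traj_sub {s T : ℝ} (u w : XSpace s T) (t : ℝ) :
    (u - w).traj t = u.traj t - w.traj t := by
  rw [sub_eq_add_neg, ← neg_one_smul ℝ w, traj_add, traj_smul, neg_one_smul, sub_eq_add_neg]

theorem XSpace.sobNorm_add_dxNorm_le {s T : ℝ} (u : XSpace s T) {t : ℝ} (ht : t ∈ Icc 0 T) :
    (sobNorm s).toFun (u.traj t) + ENNReal.ofReal (t ^ weightExp s) * dxNorm (u.traj t) ≤ ‖u‖ₑ := by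
  rw [ExtNorm.enorm_eq, u.traj_of_mem ht]
  have h := le_iSup (fun t : Icc (0 : ℝ) T => (‖u.toCont t‖ₑ +
    ENNReal.ofReal ((t : ℝ) ^ weightExp s) * dxNorm (u.toCont t).toL2)) ⟨t, ht⟩
  rw [← ExtNorm.enorm_eq]
  exact h

theorem XSpace.sobNorm_le {s T : ℝ} (u : XSpace s T) {t : ℝ} (ht : t ∈ Icc 0 T) :
    (sobNorm s).toFun (u.traj t) ≤ ‖u‖ₑ := le_self_add.trans (u.sobNorm_add_dxNorm_le ht)

theorem XSpace.dxNorm_le {s T : ℝ} (u : XSpace s T) {t : ℝ} (ht : t ∈ Icc 0 T) :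
    ENNReal.ofReal (t ^ weightExp s) * dxNorm (u.traj t) ≤ ‖u‖ₑ :=
  le_add_self.trans (u.sobNorm_add_dxNorm_le ht)

theorem XSpace.continuousOn_traj {s T : ℝ} (hs : 0 ≤ s) (u : XSpace s T) :
    ContinuousOn u.traj (Icc 0 T) := by
  rw [continuousOn_iff_continuous_domRestrict]
  have : (Icc 0 T).domRestrict u.traj = fun t => (u.toCont t).toL2 :=
    funext fun t => u.traj_of_mem t.2
  rw [this]
  exact (continuous_toL2 hs).comp u.toCont.continuous

/-- A curve in `L²` that is bounded and continuous in the norms of `X_T^s` comes from an element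
of `X_T^s`. -/
theorem exists_xSpace {s T : ℝ} {w : ℝ → L2} {M : ℝ≥0∞} (hM : M < ⊤)
    (hb : ∀ t ∈ Icc 0 T,
      (sobNorm s).toFun (w t) + ENNReal.ofReal (t ^ weightExp s) * dxNorm (w t) ≤ M)
    (hc : ∀ t₀ ∈ Icc 0 T, Tendsto (fun t => (sobNorm s).toFun (w t - w t₀)) (𝓝[Icc 0 T] t₀) (𝓝 0)) :
    ∃ u : XSpace s T, (∀ t ∈ Icc 0 T, u.traj t = w t) ∧ ‖u‖ₑ ≤ M := by
  have hfin : ∀ t : Icc (0 : ℝ) T, (sobNorm s).toFun (w t) < ⊤ := fun t =>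
    (le_self_add.trans (hb t t.2)).trans_lt hM
  choose f hf using fun t => (sobNorm s).exists_incl (hfin t)
  have hfc : Continuous f := by
    rw [continuous_iff_continuousAt]
    intro t₀
    rw [ContinuousAt, tendsto_iff_edist_tendsto_0]
    have h1 : Tendsto (fun t : Icc (0 : ℝ) T => (t : ℝ)) (𝓝 t₀) (𝓝[Icc 0 T] t₀) :=
      tendsto_nhdsWithin_iff.2 ⟨continuous_subtype_val.tendsto t₀,
        Eventually.of_forall fun t => t.2⟩
    refine ((hc t₀ t₀.2).comp h1).congr fun t => ?_
    rw [edist_eq_enorm_sub, ExtNorm.enorm_eq, map_sub, hf, hf]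
    rfl
  let F : C(Icc (0 : ℝ) T, Sob s) := ⟨f, hfc⟩
  have hF : (xNorm s T).toFun F ≤ M := by
    refine iSup_le fun t => ?_
    have h := hb t t.2
    rw [← hf t, ← ExtNorm.enorm_eq] at h
    exact h
  obtain ⟨u, hu⟩ := (xNorm s T).exists_incl (hF.trans_lt hM)
  refine ⟨u, fun t ht => ?_, ?_⟩
  · rw [XSpace.traj_of_mem u ht, XSpace.toCont, hu]
    exact hf ⟨t, ht⟩
  · rw [ExtNorm.enorm_eq, hu]; exact hF

/-! ### Dominated convergence in `L²` -/

theorem tendsto_eLpNorm_of_dominated {ι E : Type*} [NormedAddCommGroup E] {l : Filter ι}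
    [l.IsCountablyGenerated] {f : ι → ℝ → E} {G : ℝ → ℝ} (hG : MemLp G 2)
    (hm : ∀ᶠ i in l, AEStronglyMeasurable (f i) volume)
    (hd : ∀ᶠ i in l, ∀ᵐ ξ, ‖f i ξ‖ ≤ G ξ)
    (ht : ∀ᵐ ξ, Tendsto (fun i => f i ξ) l (𝓝 0)) :
    Tendsto (fun i => eLpNorm (f i) 2 volume) l (𝓝 0) := by
  have h1 : Tendsto (fun i => ∫⁻ ξ, ‖f i ξ‖ₑ ^ (2 : ℝ)) l (𝓝 (∫⁻ _ : ℝ, 0)) := by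
    refine tendsto_lintegral_filter_of_dominated_convergence' (fun ξ => ‖G ξ‖ₑ ^ (2 : ℝ)) ?_ ?_ ?_ ?_
    · filter_upwards [hm] with i hi
      exact hi.enorm.pow_const _
    · filter_upwards [hd] with i hi
      filter_upwards [hi] with ξ hξ
      gcongr
      exact enorm_le_iff_norm_le.2 (hξ.trans (le_abs_self _))
    · have h := hG.2
      have h2 := lintegral_rpow_enorm_lt_top_of_eLpNorm_lt_top (p := 2) (by norm_num) (by norm_num) h
      simpa using h2.ne
    · filter_upwards [ht] with ξ hξ
      have := (hξ.enorm).ennrpow_const (2 : ℝ)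
      simpa using this
  rw [lintegral_zero] at h1
  have h2 := h1.ennrpow_const (1 / 2 : ℝ)
  rw [ENNReal.zero_rpow_of_pos (by norm_num)] at h2
  refine h2.congr fun i => ?_
  rw [eLpNorm_eq_lintegral_rpow_enorm_toReal (by norm_num) (by norm_num)]
  norm_num

/-- Continuity of a curve in a weighted norm, from pointwise continuity of its Fourier transform
and a square-integrable envelope. -/
theorem tendsto_wN_sub {A : Set ℝ} {w : ℝ → L2} {F : ℝ → ℝ → ℂ} {G W : ℝ → ℝ} (hW : Measurable W)
    (hF : ∀ t ∈ A, hat (w t) =ᵐ[volume] F t) (hc : ∀ ξ, ContinuousOn (fun t => F t ξ) A)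
    (hG : MemLp (fun ξ => W ξ * G ξ) 2) (hd : ∀ t ∈ A, ∀ᵐ ξ, ‖F t ξ‖ ≤ G ξ) {t₀ : ℝ}
    (ht₀ : t₀ ∈ A) : Tendsto (fun t => wN W (w t - w t₀)) (𝓝[A] t₀) (𝓝 0) := by
  have h1 : Tendsto (fun t => eLpNorm (fun ξ => W ξ • (F t ξ - F t₀ ξ)) 2 volume)
      (𝓝[A] t₀) (𝓝 0) := by
    refine tendsto_eLpNorm_of_dominated (G := fun ξ => 2 * ‖W ξ * G ξ‖) (hG.norm.const_mul 2)
      ?_ ?_ ?_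
    · filter_upwards [self_mem_nhdsWithin] with t ht
      exact hW.aestronglyMeasurable.smul
        (((hat_aestronglyMeasurable (w t)).congr (hF t ht)).sub
          ((hat_aestronglyMeasurable (w t₀)).congr (hF t₀ ht₀)))
    · filter_upwards [self_mem_nhdsWithin] with t ht
      filter_upwards [hd t ht, hd t₀ ht₀] with ξ e1 e2
      rw [norm_smul, norm_mul]
      have h3 := norm_sub_le (F t ξ) (F t₀ ξ)
      have h4 : ‖F t ξ - F t₀ ξ‖ ≤ 2 * ‖G ξ‖ := by
        have := le_abs_self (G ξ)
        rw [Real.norm_eq_abs]; linarith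
      calc _ ≤ ‖W ξ‖ * (2 * ‖G ξ‖) := by gcongr
        _ = _ := by ring
    · refine ae_of_all _ fun ξ => ?_
      have h := ((hc ξ t₀ ht₀).tendsto.sub_const (F t₀ ξ)).const_smul (W ξ)
      simpa using h
  refine h1.congr' ?_
  filter_upwards [self_mem_nhdsWithin] with t ht
  refine eLpNorm_congr_ae ?_
  filter_upwards [hat_sub (w t) (w t₀), hF t ht, hF t₀ ht₀] with ξ e1 e2 e3
  rw [e1, Pi.sub_apply, e2, e3]

/-! ### The velocity `∂ₓu` along a trajectory and the quadratic source -/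

/-- The frequency `ξ` truncated to `[-n,n]`. -/
noncomputable def truncFreq (n : ℕ) (ξ : ℝ) : ℝ := (Icc (-n : ℝ) n).indicator id ξ

theorem measurable_truncFreq (n : ℕ) : Measurable (truncFreq n) :=
  measurable_id.indicator measurableSet_Icc

theorem truncFreq_neg (n : ℕ) (ξ : ℝ) : truncFreq n (-ξ) = -truncFreq n ξ := by
  unfold truncFreq
  by_cases h : ξ ∈ Icc (-n : ℝ) n
  · rw [indicator_of_mem h, indicator_of_mem (by constructor <;> linarith [h.1, h.2])]; rfl
  · rw [indicator_of_notMem h, indicator_of_notMem (fun h' => h (by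
      constructor <;> linarith [h'.1, h'.2])), neg_zero]

theorem abs_truncFreq_le (n : ℕ) (ξ : ℝ) : |truncFreq n ξ| ≤ n := by
  unfold truncFreq
  by_cases h : ξ ∈ Icc (-n : ℝ) n
  · rw [indicator_of_mem h]; exact abs_le.2 h
  · rw [indicator_of_notMem h]; simp

theorem abs_truncFreq_sub_le (n : ℕ) (ξ : ℝ) : |truncFreq n ξ - ξ| ≤ |ξ| := by
  unfold truncFreq
  by_cases h : ξ ∈ Icc (-n : ℝ) n
  · rw [indicator_of_mem h]; simp
  · rw [indicator_of_notMem h]; simp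

theorem exists_truncDeriv (n : ℕ) (f : L2) :
    ∃ g : L2, hat g =ᵐ[volume] fun ξ => Complex.I * truncFreq n ξ * hat f ξ := by
  have hm : AEStronglyMeasurable (fun ξ => Complex.I * truncFreq n ξ * hat f ξ) volume := by
    have := measurable_truncFreq n
    exact (by fun_prop : Measurable fun ξ : ℝ =>
      Complex.I * (truncFreq n ξ : ℂ)).aestronglyMeasurable.mul (hat_aestronglyMeasurable f)
  refine exists_hat_eq ((memLp_hat f).of_le_mul hm (c := n) (ae_of_all _ fun ξ => ?_)) ?_
  · rw [norm_mul, norm_mul, Complex.norm_I, one_mul, Complex.norm_real]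
    exact mul_le_mul_of_nonneg_right (abs_truncFreq_le n ξ) (norm_nonneg _)
  · filter_upwards [hermitian_hat f] with ξ hξ
    rw [hξ, truncFreq_neg]; simp

/-- The weak derivative of the part of `f` with frequencies in `[-n,n]`. -/
noncomputable def truncDeriv (n : ℕ) (f : L2) : L2 := (exists_truncDeriv n f).choose

theorem hat_truncDeriv (n : ℕ) (f : L2) :
    hat (truncDeriv n f) =ᵐ[volume] fun ξ => Complex.I * truncFreq n ξ * hat f ξ :=
  (exists_truncDeriv n f).choose_spec

theorem continuous_truncDeriv (n : ℕ) : Continuous (truncDeriv n) := by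
  have h : LipschitzWith n (truncDeriv n) := by
    intro f g
    rw [edist_eq_enorm_sub, edist_eq_enorm_sub]
    have h1 : wN (fun _ => 1) (truncDeriv n f - truncDeriv n g) = wN (truncFreq n) (f - g) := by
      refine eLpNorm_congr_norm_ae ?_
      filter_upwards [hat_sub (truncDeriv n f) (truncDeriv n g), hat_sub f g, hat_truncDeriv n f,
        hat_truncDeriv n g] with ξ e1 e2 e3 e4
      rw [e1, e2, Pi.sub_apply, Pi.sub_apply, e3, e4, ← mul_sub, one_smul, norm_smul, norm_mul,
        norm_mul, Complex.norm_I, one_mul, Complex.norm_real]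
    have h2 : wN (truncFreq n) (f - g) ≤ wN (fun _ => (n : ℝ) * 1) (f - g) :=
      wN_mono (fun ξ => by
        rw [mul_one]; exact (abs_truncFreq_le n ξ).trans (le_abs_self _)) _
    rw [wN_const_mul, ← h1, wN_one, wN_one, mul_left_comm] at h2
    have h3 := (ENNReal.mul_le_mul_iff_right sqrt_two_pi_ne ENNReal.ofReal_ne_top).1 h2
    simpa using h3
  exact h.continuous

theorem tendsto_truncDeriv {f g : L2} (h : HasWeakDeriv f g) :
    Tendsto (fun n => truncDeriv n f) atTop (𝓝 g) := by
  have hfin : MemLp (fun ξ : ℝ => ‖ξ • hat f ξ‖) 2 := by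
    refine MemLp.norm ⟨aestronglyMeasurable_smul_hat measurable_id f, ?_⟩
    have := h.enorm_eq
    change wN (fun ξ => ξ) f < ⊤
    rw [← this]
    exact ENNReal.mul_lt_top ENNReal.ofReal_lt_top (by simp)
  have h1 : Tendsto (fun n : ℕ => eLpNorm (fun ξ => (truncFreq n ξ - ξ) • hat f ξ) 2 volume) atTop
      (𝓝 0) := by
    refine tendsto_eLpNorm_of_dominated hfin (Eventually.of_forall fun n => ?_)
      (Eventually.of_forall fun n => ae_of_all _ fun ξ => ?_) (ae_of_all _ fun ξ => ?_)
    · exact aestronglyMeasurable_smul_hat ((measurable_truncFreq n).sub measurable_id) f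
    · rw [norm_smul, norm_smul]
      exact mul_le_mul_of_nonneg_right (abs_truncFreq_sub_le n ξ) (norm_nonneg _)
    · obtain ⟨k, hk⟩ := exists_nat_ge |ξ|
      refine tendsto_const_nhds.congr' ?_
      filter_upwards [eventually_ge_atTop k] with n hn
      have : ξ ∈ Icc (-n : ℝ) n := abs_le.1 (hk.trans (by exact_mod_cast hn))
      rw [truncFreq, indicator_of_mem this]
      simp
  rw [tendsto_iff_edist_tendsto_0]
  have h2 : ∀ n, edist (truncDeriv n f) g = (ENNReal.ofReal (√(2 * Real.pi)))⁻¹ *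
      eLpNorm (fun ξ => (truncFreq n ξ - ξ) • hat f ξ) 2 volume := by
    intro n
    have e : eLpNorm (fun ξ => (truncFreq n ξ - ξ) • hat f ξ) 2 volume =
        ENNReal.ofReal (√(2 * Real.pi)) * ‖truncDeriv n f - g‖ₑ := by
      rw [← eLpNorm_hat]
      refine eLpNorm_congr_norm_ae ?_
      filter_upwards [hat_sub (truncDeriv n f) g, hat_truncDeriv n f,
        (hasWeakDeriv_iff f g).1 h] with ξ e1 e2 e3
      rw [e1, Pi.sub_apply, e2, e3, ← sub_mul, ← mul_sub, norm_mul, norm_mul, Complex.norm_I,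
        one_mul, norm_smul, ← Complex.ofReal_sub, Complex.norm_real]
    rw [e, ← mul_assoc, ENNReal.inv_mul_cancel sqrt_two_pi_ne ENNReal.ofReal_ne_top, one_mul,
      edist_eq_enorm_sub]
  simp only [h2]
  have h3 := ENNReal.Tendsto.const_mul h1
    (Or.inr (ENNReal.inv_ne_top.2 sqrt_two_pi_ne))
  rwa [mul_zero] at h3

/-- The velocity `∂ₓu(τ)` for `0 < τ ≤ T`, extended by zero. -/
noncomputable def XSpace.vel {s T : ℝ} (u : XSpace s T) (τ : ℝ) : L2 :=
  (Ioc 0 T).indicator (fun τ => dx (u.traj τ)) τ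

theorem XSpace.vel_of_mem {s T : ℝ} (u : XSpace s T) {τ : ℝ} (hτ : τ ∈ Ioc 0 T) :
    u.vel τ = dx (u.traj τ) := indicator_of_mem hτ _

theorem XSpace.dxNorm_lt_top {s T : ℝ} (u : XSpace s T) {τ : ℝ} (hτ : τ ∈ Ioc 0 T) :
    dxNorm (u.traj τ) < ⊤ := by
  have h := (u.dxNorm_le ⟨hτ.1.le, hτ.2⟩).trans_lt (by simp : ‖u‖ₑ < ⊤)
  refine ENNReal.lt_top_of_mul_ne_top_right h.ne ?_
  rw [ENNReal.ofReal_ne_zero_iff]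
  exact Real.rpow_pos_of_pos hτ.1 _

theorem XSpace.hasWeakDeriv_vel {s T : ℝ} (u : XSpace s T) {τ : ℝ} (hτ : τ ∈ Ioc 0 T) :
    HasWeakDeriv (u.traj τ) (u.vel τ) := by
  rw [u.vel_of_mem hτ]
  exact hasWeakDeriv_dx ((dxNorm_lt_top_iff _).1 (u.dxNorm_lt_top hτ))

theorem XSpace.vel_add {s T : ℝ} (u w : XSpace s T) (τ : ℝ) :
    (u + w).vel τ = u.vel τ + w.vel τ := by
  by_cases hτ : τ ∈ Ioc 0 T
  · have h := (u.hasWeakDeriv_vel hτ).add (w.hasWeakDeriv_vel hτ)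
    rw [← XSpace.traj_add] at h
    exact ((u + w).hasWeakDeriv_vel hτ).unique h
  · simp [XSpace.vel, indicator_of_notMem hτ]

theorem XSpace.vel_smul {s T : ℝ} (c : ℝ) (u : XSpace s T) (τ : ℝ) :
    (c • u).vel τ = c • u.vel τ := by
  by_cases hτ : τ ∈ Ioc 0 T
  · have h := (u.hasWeakDeriv_vel hτ).smul c
    rw [← XSpace.traj_smul] at h
    exact ((c • u).hasWeakDeriv_vel hτ).unique h
  · simp [XSpace.vel, indicator_of_notMem hτ]

theorem XSpace.vel_sub {s T : ℝ} (u w : XSpace s T) (τ : ℝ) :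
    (u - w).vel τ = u.vel τ - w.vel τ := by
  rw [sub_eq_add_neg, ← neg_one_smul ℝ w, vel_add, vel_smul, neg_one_smul, sub_eq_add_neg]

/-- The velocity of an element of `X_T^s` is a measurable curve in `L²`, as a pointwise limit of
continuous ones. -/
theorem XSpace.stronglyMeasurable_vel {s T : ℝ} (hs : 0 ≤ s) (hT : 0 ≤ T) (u : XSpace s T) :
    StronglyMeasurable u.vel := by
  let w : ℝ → L2 := fun τ => (u.toCont (projIcc 0 T hT τ)).toL2
  have hw : Continuous w :=
    (continuous_toL2 hs).comp (u.toCont.continuous.comp continuous_projIcc)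
  have hwu : ∀ τ ∈ Icc 0 T, w τ = u.traj τ := fun τ hτ => by
    rw [u.traj_of_mem hτ]
    simp only [w]
    rw [projIcc_of_mem hT hτ]
  refine stronglyMeasurable_of_tendsto (f := fun n : ℕ => (Ioc 0 T).indicator
    fun τ => truncDeriv n (w τ)) atTop (fun n => ?_) ?_
  · exact ((continuous_truncDeriv n).comp hw).stronglyMeasurable.indicator measurableSet_Ioc
  · rw [tendsto_pi_nhds]
    intro τ
    by_cases hτ : τ ∈ Ioc 0 T
    · simp only [indicator_of_mem hτ]
      rw [hwu τ ⟨hτ.1.le, hτ.2⟩]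
      exact tendsto_truncDeriv (u.hasWeakDeriv_vel hτ)
    · simp only [indicator_of_notMem hτ, XSpace.vel]
      exact tendsto_const_nhds

theorem sobNorm_dec_vel_le {s T : ℝ} (u : XSpace s T) {τ : ℝ} (hτ : τ ∈ Ioc 0 T) :
    ENNReal.ofReal (τ ^ weightExp s) * (sobNorm (dec s)).toFun (u.vel τ) ≤
      ENNReal.ofReal (√(2 * Real.pi)) * ‖u‖ₑ := by
  have hv := u.hasWeakDeriv_vel hτ
  have hm : τ ∈ Icc 0 T := ⟨hτ.1.le, hτ.2⟩
  rw [sobNorm_eq, hv.wN_eq]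
  rcases le_total s 1 with h | h
  · have e : dec s = 0 := max_eq_right (by linarith)
    rw [e]
    simp only [zero_div, Real.rpow_zero, one_mul]
    rw [← dxNorm_eq, mul_left_comm]
    gcongr
    exact u.dxNorm_le hm
  · have e : dec s = s - 1 := max_eq_left (by linarith)
    have e2 : weightExp s = 0 := max_eq_right (by linarith)
    rw [e, e2, Real.rpow_zero, ENNReal.ofReal_one, one_mul]
    refine le_trans ?_ (le_mul_of_one_le_left (by simp) sqrt_two_pi_le)
    refine le_trans (wN_mono (fun ξ => ?_) _) (u.sobNorm_le hm)
    have hJ := jap_pos ξ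
    rw [abs_mul, abs_of_nonneg (a := (1 + ξ ^ 2) ^ ((s - 1) / 2)) (by positivity),
      abs_of_nonneg (a := (1 + ξ ^ 2) ^ (s / 2)) (by positivity)]
    calc _ ≤ (1 + ξ ^ 2) ^ ((s - 1) / 2) * (1 + ξ ^ 2) ^ (1 / 2 : ℝ) := by
          gcongr; exact abs_le_japanese ξ
      _ = _ := by rw [← Real.rpow_add hJ]; congr 1; ring

theorem norm_vel_le {s T : ℝ} (u : XSpace s T) {τ : ℝ} (hτ : τ ∈ Ioc 0 T) :
    τ ^ weightExp s * ‖u.vel τ‖ ≤ ‖u‖ := by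
  have h := u.dxNorm_le ⟨hτ.1.le, hτ.2⟩
  have e : dxNorm (u.traj τ) = ‖u.vel τ‖ₑ := by
    have h1 := dxNorm_eq (u.traj τ)
    rw [← (u.hasWeakDeriv_vel hτ).enorm_eq] at h1
    exact (ENNReal.mul_right_inj sqrt_two_pi_ne ENNReal.ofReal_ne_top).1 h1
  have h0 : 0 ≤ τ ^ weightExp s := Real.rpow_nonneg hτ.1.le _
  rw [e, ← ofReal_norm, ← ofReal_norm, ← ENNReal.ofReal_mul h0] at h
  exact (ENNReal.ofReal_le_ofReal_iff (norm_nonneg _)).1 h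

/-- The transform of `∂ₓu ∂ₓw` along two trajectories. -/
noncomputable def src {s T : ℝ} (u w : XSpace s T) (τ ξ : ℝ) : ℂ := prodHat (u.vel τ) (w.vel τ) ξ

/-- The constant in the product estimate for the source. -/
noncomputable def srcC (s : ℝ) : ℝ := 2 ^ (dec s / 2) * (2 * Real.pi)

theorem srcC_pos (s : ℝ) : 0 < srcC s := by unfold srcC; positivity

theorem mul_mul_le_of_weighted {a j k c : ℝ} {X Y Z U W : ℝ≥0∞} (ha : 0 ≤ a) (hc : 0 ≤ c)
    (hk : 0 ≤ k) (hX : ENNReal.ofReal a * X ≤ ENNReal.ofReal c * U)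
    (hY : ENNReal.ofReal a * Y ≤ ENNReal.ofReal c * W)
    (hZ : ENNReal.ofReal j * Z ≤ ENNReal.ofReal k * (X * Y)) :
    ENNReal.ofReal (a * a * j) * Z ≤ ENNReal.ofReal (k * (c * c)) * (U * W) := by
  rw [ENNReal.ofReal_mul (mul_nonneg ha ha), ENNReal.ofReal_mul ha, ENNReal.ofReal_mul hk,
    ENNReal.ofReal_mul hc]
  calc _ = ENNReal.ofReal a * ENNReal.ofReal a * (ENNReal.ofReal j * Z) := by ring
    _ ≤ ENNReal.ofReal a * ENNReal.ofReal a * (ENNReal.ofReal k * (X * Y)) := by gcongr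
    _ = ENNReal.ofReal k * ((ENNReal.ofReal a * X) * (ENNReal.ofReal a * Y)) := by ring
    _ ≤ ENNReal.ofReal k * ((ENNReal.ofReal c * U) * (ENNReal.ofReal c * W)) := by gcongr
    _ = _ := by ring

theorem norm_src_le {s T : ℝ} (u w : XSpace s T) {τ : ℝ} (hτ : τ ∈ Ioc 0 T) (ξ : ℝ) :
    ‖src u w τ ξ‖ ≤ srcC s * (‖u‖ * ‖w‖) * τ ^ (-sing s) * (1 + ξ ^ 2) ^ (-(dec s / 2)) := by
  have ha : 0 < τ ^ weightExp s := Real.rpow_pos_of_pos hτ.1 _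
  have hJ : 0 < (1 + ξ ^ 2) ^ (dec s / 2) := Real.rpow_pos_of_pos (jap_pos ξ) _
  have h4 := mul_mul_le_of_weighted ha.le (Real.sqrt_nonneg _) (by positivity)
    (sobNorm_dec_vel_le u hτ) (sobNorm_dec_vel_le w hτ)
    (prodHat_weighted_le (dec_nonneg s) (u.vel τ) (w.vel τ) ξ)
  rw [← ofReal_norm u, ← ofReal_norm w, ← ofReal_norm (prodHat _ _ _),
    ← ENNReal.ofReal_mul (norm_nonneg u), ← ENNReal.ofReal_mul (by positivity),
    ← ENNReal.ofReal_mul (by positivity), ENNReal.ofReal_le_ofReal_iff (by positivity),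
    Real.mul_self_sqrt two_pi_pos.le, ← Real.rpow_add hτ.1, ← two_mul, two_mul_weightExp] at h4
  rw [Real.rpow_neg hτ.1.le, Real.rpow_neg (jap_pos ξ).le, ← div_eq_mul_inv, ← div_eq_mul_inv,
    le_div_iff₀ hJ, le_div_iff₀ (Real.rpow_pos_of_pos hτ.1 _)]
  refine le_trans (le_of_eq ?_) h4
  rw [src]; ring

theorem stronglyMeasurable_prodHat {v w : ℝ → L2} (hv : StronglyMeasurable v)
    (hw : StronglyMeasurable w) :
    StronglyMeasurable fun p : ℝ × ℝ => prodHat (v p.1) (w p.1) p.2 := by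
  have hcomp : ∀ {q : ℝ × ℝ → L2 × L2 × ℝ} {G : L2 × L2 × ℝ → ℂ}, StronglyMeasurable q →
      Continuous G → StronglyMeasurable fun p => G (q p) :=
    fun hq hG => hG.comp_stronglyMeasurable hq
  have hfst : ∀ {v : ℝ → L2}, StronglyMeasurable v → StronglyMeasurable fun p : ℝ × ℝ => v p.1 :=
    fun hv => hv.comp_measurable measurable_fst
  exact hcomp ((hfst hv).prodMk ((hfst hw).prodMk measurable_snd.stronglyMeasurable))
    continuous_prodHat

theorem stronglyMeasurable_src {s T : ℝ} (hs : 0 ≤ s) (hT : 0 ≤ T) (u w : XSpace s T) :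
    StronglyMeasurable (Function.uncurry (src u w)) :=
  stronglyMeasurable_prodHat (u.stronglyMeasurable_vel hs hT) (w.stronglyMeasurable_vel hs hT)

theorem isSource_src {s T : ℝ} (hs : 0 ≤ s) (hT : 0 ≤ T) (u w : XSpace s T) :
    IsSource T (srcC s * (‖u‖ * ‖w‖)) (sing s) (dec s) (src u w) where
  meas := stronglyMeasurable_src hs hT u w
  herm _ _ := prodHat_neg _ _ _
  bound _ hτ ξ := norm_src_le u w hτ ξ

theorem hatL1_sq_eq (v : L2) (ξ : ℝ) : hatL1 (fun x => (v x) ^ 2) ξ = prodHat v v ξ := by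
  simp only [prodHat, sq]

/-- On `X_T^s` the Duhamel formula is an equation for the Fourier transforms with the source
built from `∂ₓu`. -/
theorem isSolution_iff {μ s T : ℝ} (hs : 1 / 2 < s) (φ : L2) (u : XSpace s T) :
    IsSolution μ T φ u.traj ↔ ∀ t ∈ Icc 0 T, hat (u.traj t) =ᵐ[volume] fun ξ =>
      Real.exp (t * symb μ ξ) • hat φ ξ + duh μ (src u u) t ξ := by
  constructor
  · rintro ⟨v, hv, h⟩ t ht
    filter_upwards [h t ht] with ξ hξ
    rw [hξ.2, duh]
    congr 2
    refine intervalIntegral.integral_congr_ae (ae_of_all _ fun τ hτ => ?_)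
    rw [uIoc_of_le ht.1] at hτ
    have hτ' : τ ∈ Ioc 0 T := ⟨hτ.1, hτ.2.trans ht.2⟩
    rw [hatL1_sq_eq, (hv τ hτ').unique (u.hasWeakDeriv_vel hτ')]
    rfl
  · intro h
    refine ⟨u.vel, fun t ht => u.hasWeakDeriv_vel ht, fun t ht => ?_⟩
    filter_upwards [h t ht] with ξ hξ
    have e : (fun τ => Real.exp ((t - τ) * symb μ ξ) • hatL1 (fun x => (u.vel τ x) ^ 2) ξ) =
        fun τ => Real.exp ((t - τ) * symb μ ξ) • src u u τ ξ := by
      funext τ; rw [hatL1_sq_eq]; rfl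
    rw [e]
    exact ⟨(isSource_src (by linarith) (ht.1.trans ht.2) u u).exp_intervalIntegrable
      (by linarith [sing_lt hs]) ht _ _ _, hξ⟩

/-! ### Solving the linear problem in the time-weighted space -/

theorem rpow_weight_mul_exp_le {μ : ℝ} (hμ : 0 < μ) (s : ℝ) (hs : 0 ≤ s) {t : ℝ} (h0 : 0 ≤ t)
    (h1 : t ≤ 1) (ξ : ℝ) :
    t ^ weightExp s * (|ξ| * Real.exp (t * symb μ ξ)) ≤
      Real.exp (1 + μ) * (1 + ξ ^ 2) ^ (s / 2) := by
  have hJ := jap_pos ξ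
  have ha0 := weightExp_nonneg s
  have ha1 : weightExp s ≤ 1 := max_le (by linarith) zero_le_one
  have ha2 := le_weightExp s
  have hξ := abs_le_japanese ξ
  have hexp := exp_symb_le hμ h0 h1 ξ
  have key : t ^ weightExp s * Real.exp (-(t * (1 + ξ ^ 2))) ≤ (1 + ξ ^ 2) ^ (-weightExp s) := by
    rcases h0.eq_or_lt with h | h
    · rw [← h, zero_mul, neg_zero, Real.exp_zero, mul_one]
      rcases ha0.eq_or_lt with h' | h'
      · rw [← h']; simp
      · rw [Real.zero_rpow h'.ne']; positivity
    · have h2 := exp_neg_le_rpow ha0 ha1 (mul_pos h hJ)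
      rw [Real.mul_rpow h.le hJ.le] at h2
      calc _ ≤ t ^ weightExp s * (t ^ (-weightExp s) * (1 + ξ ^ 2) ^ (-weightExp s)) := by gcongr
        _ = _ := by rw [← mul_assoc, ← Real.rpow_add h]; simp
  calc _ ≤ t ^ weightExp s * ((1 + ξ ^ 2) ^ (1 / 2 : ℝ) *
        (Real.exp (1 + μ) * Real.exp (-(t * (1 + ξ ^ 2))))) := by gcongr
    _ = Real.exp (1 + μ) * (1 + ξ ^ 2) ^ (1 / 2 : ℝ) *
        (t ^ weightExp s * Real.exp (-(t * (1 + ξ ^ 2)))) := by ring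
    _ ≤ Real.exp (1 + μ) * (1 + ξ ^ 2) ^ (1 / 2 : ℝ) * (1 + ξ ^ 2) ^ (-weightExp s) := by gcongr
    _ = Real.exp (1 + μ) * (1 + ξ ^ 2) ^ (1 / 2 - weightExp s) := by
        rw [mul_assoc, ← Real.rpow_add hJ]; rfl
    _ ≤ _ := by
        gcongr
        · exact one_le_jap ξ
        · linarith

theorem memLp_sobolev {s : ℝ} {φ : L2} (hφ : (sobNorm s).toFun φ < ⊤) :
    MemLp (fun ξ : ℝ => (1 + ξ ^ 2) ^ (s / 2) * ‖hat φ ξ‖) 2 := by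
  have h : MemLp (fun ξ : ℝ => (1 + ξ ^ 2) ^ (s / 2) • hat φ ξ) 2 :=
    ⟨aestronglyMeasurable_smul_hat (by fun_prop) φ, hφ⟩
  refine h.norm.ae_eq (ae_of_all _ fun ξ => ?_)
  simp only [norm_smul]
  rw [Real.norm_of_nonneg (by have := jap_pos ξ; positivity)]

theorem eLpNorm_weight_add_le {W e V : ℝ → ℝ} {d : ℝ → ℂ} {E K r : ℝ} (φ : L2)
    (hW : Measurable W) (he : Measurable e) (hd : AEStronglyMeasurable d volume) (hE0 : 0 ≤ E)
    (hE : ∀ ξ, |W ξ| * |e ξ| ≤ E * |V ξ|) (hK : ∀ ξ, |W ξ| * ‖d ξ‖ ≤ K * (1 + ξ ^ 2) ^ (-r)) :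
    eLpNorm (fun ξ => W ξ • (e ξ • hat φ ξ + d ξ)) 2 volume ≤
      ENNReal.ofReal E * wN V φ + ENNReal.ofReal K * japN r := by
  have h1 : (fun ξ => W ξ • (e ξ • hat φ ξ + d ξ)) =
      (fun ξ => (W ξ * e ξ) • hat φ ξ) + fun ξ => W ξ • d ξ := by
    funext ξ; simp only [Pi.add_apply, smul_add, smul_smul]
  have h2 : eLpNorm (fun ξ => (W ξ * e ξ) • hat φ ξ) 2 volume ≤ ENNReal.ofReal E * wN V φ := by
    rw [← Real.enorm_of_nonneg hE0, ← wN_const_mul]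
    refine wN_mono (fun ξ => ?_) φ
    rw [abs_mul, abs_mul, abs_of_nonneg hE0]
    exact hE ξ
  have h3 : eLpNorm (fun ξ => W ξ • d ξ) 2 volume ≤ ENNReal.ofReal K * japN r := by
    have := eLpNorm_weight_le (w := fun _ => 1) (F := fun ξ => W ξ • d ξ) (K := K) (p := r) (q := 0)
      (fun ξ => by simp) fun ξ => by rw [norm_smul]; exact hK ξ
    simpa using this
  rw [h1]
  exact (eLpNorm_add_le (aestronglyMeasurable_smul_hat (hW.mul he) φ)
    (hW.aestronglyMeasurable.smul hd) (by norm_num)).trans (add_le_add h2 h3)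

/-- The inhomogeneous linear problem with data in `H^{s'}` and a source as it arises from the
quadratic term in `X_T^s` is solved in `X_T^{s'}`, if `s' < s + 1/2 - (1-s)₊`. -/
theorem exists_linear_solution {μ : ℝ} (hμ : 0 < μ) {s s' : ℝ} (hs : 1 / 2 < s) (hs0 : 0 ≤ s')
    (hs' : s' < s + 1 / 2 - sing s) :
    ∃ γ C : ℝ, 0 < γ ∧ 0 ≤ C ∧
      ∀ T ∈ Ioc (0 : ℝ) 1, ∀ (φ : L2) (K : ℝ) (h : ℝ → ℝ → ℂ), (sobNorm s').toFun φ < ⊤ → 0 ≤ K →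
        IsSource T K (sing s) (dec s) h →
        ∃ u : XSpace s' T, (∀ t ∈ Icc 0 T, hat (u.traj t) =ᵐ[volume] fun ξ =>
            Real.exp (t * symb μ ξ) • hat φ ξ + duh μ h t ξ) ∧
          ‖u‖ₑ ≤ ENNReal.ofReal (2 * Real.exp (1 + μ)) * (sobNorm s').toFun φ +
            ENNReal.ofReal (C * K * T ^ γ) := by
  obtain ⟨γ, p, p', C, hγ, hp, hp', hC, hbd⟩ := exists_duh_bound hμ hs hs'
  have hj1 : japN (p - s' / 2) < ⊤ := japN_lt_top (by linarith)
  have hj2 : japN (p' - 1 / 2) < ⊤ := japN_lt_top (by linarith)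
  refine ⟨γ, C * (japN (p - s' / 2) + japN (p' - 1 / 2)).toReal, hγ, by positivity, ?_⟩
  intro T hT φ K h hφ hK hh
  have hTγ : 0 ≤ T ^ γ := Real.rpow_nonneg hT.1.le _
  have hsing := sing_lt hs
  set E := Real.exp (1 + μ) with hE
  have hE0 : 0 < E := Real.exp_pos _
  set F : ℝ → ℝ → ℂ := fun t ξ => Real.exp (t * symb μ ξ) • hat φ ξ + duh μ h t ξ with hF
  set G : ℝ → ℝ := fun ξ => E * ‖hat φ ξ‖ + C * K * T ^ γ * (1 + ξ ^ 2) ^ (-p) with hG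
  have hsm := continuous_symb μ
  have hFm1 : ∀ t, AEStronglyMeasurable (fun ξ => Real.exp (t * symb μ ξ) • hat φ ξ) volume :=
    fun t => (by fun_prop : Continuous fun ξ => Real.exp (t * symb μ ξ)).aestronglyMeasurable.smul
      (hat_aestronglyMeasurable φ)
  have hFm2 : ∀ t, AEStronglyMeasurable (duh μ h t) volume :=
    fun t => (hh.stronglyMeasurable_duh μ t).aestronglyMeasurable
  have hFm : ∀ t, AEStronglyMeasurable (F t) volume := fun t => (hFm1 t).add (hFm2 t)
  have hexp : ∀ t ∈ Icc 0 T, ∀ ξ, ‖Real.exp (t * symb μ ξ) • hat φ ξ‖ ≤ E * ‖hat φ ξ‖ := by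
    intro t ht ξ
    rw [norm_smul, Real.norm_of_nonneg (Real.exp_pos _).le]
    gcongr
    exact exp_symb_le_const hμ ht.1 (ht.2.trans hT.2) ξ
  have hFG : ∀ t ∈ Icc 0 T, ∀ ξ, ‖F t ξ‖ ≤ G ξ := fun t ht ξ =>
    (norm_add_le _ _).trans (add_le_add (hexp t ht ξ) (hbd T hT K h hK hh t ht ξ).1)
  have hWG : MemLp (fun ξ => (1 + ξ ^ 2) ^ (s' / 2) * G ξ) 2 := by
    have h1 := (memLp_sobolev hφ).const_mul E
    have h2 := (memLp_jap (r := p - s' / 2) (by linarith)).const_mul (C * K * T ^ γ)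
    refine (h1.add h2).ae_eq (ae_of_all _ fun ξ => ?_)
    have e : (1 + ξ ^ 2) ^ (-(p - s' / 2)) = (1 + ξ ^ 2) ^ (s' / 2) * (1 + ξ ^ 2) ^ (-p) := by
      rw [← Real.rpow_add (jap_pos ξ)]; congr 1; ring
    simp only [Pi.add_apply, hG, e]
    ring
  have hF2 : ∀ t ∈ Icc 0 T, MemLp (F t) 2 := by
    intro t ht
    refine hWG.of_le (hFm t) (ae_of_all _ fun ξ => (hFG t ht ξ).trans ?_)
    have h1 : 1 ≤ (1 + ξ ^ 2) ^ (s' / 2) := Real.one_le_rpow (one_le_jap ξ) (by linarith)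
    have h2 : 0 ≤ G ξ := (norm_nonneg _).trans (hFG t ht ξ)
    rw [norm_mul, Real.norm_of_nonneg (by linarith), Real.norm_of_nonneg h2]
    exact le_mul_of_one_le_left h2 h1
  have hFh : ∀ t, Hermitian (F t) := by
    intro t
    filter_upwards [hermitian_hat φ] with ξ hξ
    simp only [hF, hξ, hh.duh_neg, symb_neg, map_add, Complex.real_smul, map_mul,
      Complex.conj_ofReal]
  have hw : ∀ t, ∃ w : L2, t ∈ Icc 0 T → hat w =ᵐ[volume] F t := by
    intro t
    by_cases ht : t ∈ Icc 0 T
    · obtain ⟨w, hw⟩ := exists_hat_eq (hF2 t ht) (hFh t)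
      exact ⟨w, fun _ => hw⟩
    · exact ⟨0, fun h' => (ht h').elim⟩
  choose w hw using hw
  have hcont : ∀ ξ, ContinuousOn (fun t => F t ξ) (Icc 0 T) := fun ξ =>
    ((by fun_prop : Continuous fun t : ℝ => Real.exp (t * symb μ ξ)).continuousOn.smul
      continuousOn_const).add (hh.continuousOn_duh (by linarith) hT.1.le μ ξ)
  have hM : ENNReal.ofReal (2 * E) * (sobNorm s').toFun φ +
      ENNReal.ofReal (C * (japN (p - s' / 2) + japN (p' - 1 / 2)).toReal * K * T ^ γ) < ⊤ :=
    ENNReal.add_lt_top.2 ⟨ENNReal.mul_lt_top ENNReal.ofReal_lt_top hφ, ENNReal.ofReal_lt_top⟩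
  have hbdd : ∀ t ∈ Icc 0 T, (sobNorm s').toFun (w t) + ENNReal.ofReal (t ^ weightExp s') *
      dxNorm (w t) ≤ ENNReal.ofReal (2 * E) * (sobNorm s').toFun φ +
      ENNReal.ofReal (C * (japN (p - s' / 2) + japN (p' - 1 / 2)).toReal * K * T ^ γ) := by
    intro t ht
    have hem : Measurable fun ξ => Real.exp (t * symb μ ξ) :=
      (by fun_prop : Continuous fun ξ => Real.exp (t * symb μ ξ)).measurable
    have b1 : (sobNorm s').toFun (w t) ≤ ENNReal.ofReal E * (sobNorm s').toFun φ +
        ENNReal.ofReal (C * K * T ^ γ) * japN (p - s' / 2) := by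
      have e1 : (sobNorm s').toFun (w t) = eLpNorm (fun ξ => (1 + ξ ^ 2) ^ (s' / 2) •
          (Real.exp (t * symb μ ξ) • hat φ ξ + duh μ h t ξ)) 2 volume := by
        refine eLpNorm_congr_ae ?_
        filter_upwards [hw t ht] with ξ hξ
        rw [hξ]
      rw [e1]
      refine eLpNorm_weight_add_le φ (by fun_prop) hem (hFm2 t) hE0.le (fun ξ => ?_) fun ξ => ?_
      · rw [mul_comm, abs_of_nonneg (Real.exp_pos _).le]
        gcongr
        exact exp_symb_le_const hμ ht.1 (ht.2.trans hT.2) ξ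
      · have hJ := jap_pos ξ
        have e : (1 + ξ ^ 2) ^ (-(p - s' / 2)) = (1 + ξ ^ 2) ^ (s' / 2) * (1 + ξ ^ 2) ^ (-p) := by
          rw [← Real.rpow_add hJ]; congr 1; ring
        rw [abs_of_nonneg (by positivity), e, mul_left_comm]
        gcongr
        exact (hbd T hT K h hK hh t ht ξ).1
    have b2 : ENNReal.ofReal (t ^ weightExp s') * dxNorm (w t) ≤
        ENNReal.ofReal E * (sobNorm s').toFun φ +
        ENNReal.ofReal (C * K * T ^ γ) * japN (p' - 1 / 2) := by
      have ht0 : 0 ≤ t ^ weightExp s' := Real.rpow_nonneg ht.1 _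
      have e0 : dxNorm (w t) ≤ wN (fun ξ => ξ) (w t) := by
        rw [← dxNorm_eq]
        exact le_mul_of_one_le_left (by simp) sqrt_two_pi_le
      have e1 : ENNReal.ofReal (t ^ weightExp s') * wN (fun ξ => ξ) (w t) =
          eLpNorm (fun ξ => (t ^ weightExp s' * ξ) •
            (Real.exp (t * symb μ ξ) • hat φ ξ + duh μ h t ξ)) 2 volume := by
        rw [← Real.enorm_of_nonneg ht0, ← wN_const_mul]
        refine eLpNorm_congr_ae ?_
        filter_upwards [hw t ht] with ξ hξ
        rw [hξ]
      refine (mul_le_mul_right e0 _).trans ?_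
      rw [e1]
      refine eLpNorm_weight_add_le φ (by fun_prop) hem (hFm2 t) hE0.le (fun ξ => ?_) fun ξ => ?_
      · rw [abs_mul, abs_of_nonneg ht0, abs_of_nonneg (Real.exp_pos _).le, mul_assoc]
        exact (rpow_weight_mul_exp_le hμ s' hs0 ht.1 (ht.2.trans hT.2) ξ).trans
          (mul_le_mul_of_nonneg_left (le_abs_self _) hE0.le)
      · have hJ := jap_pos ξ
        have e : (1 + ξ ^ 2) ^ (-(p' - 1 / 2)) =
            (1 + ξ ^ 2) ^ (1 / 2 : ℝ) * (1 + ξ ^ 2) ^ (-p') := by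
          rw [← Real.rpow_add hJ]; congr 1; ring
        rw [abs_mul, abs_of_nonneg ht0, e, mul_left_comm, mul_comm (t ^ weightExp s') |ξ|, mul_assoc]
        exact mul_le_mul (abs_le_japanese ξ) (hbd T hT K h hK hh t ht ξ).2 (by positivity)
          (by positivity)
    refine (add_le_add b1 b2).trans (le_of_eq ?_)
    rw [show C * (japN (p - s' / 2) + japN (p' - 1 / 2)).toReal * K * T ^ γ =
      C * K * T ^ γ * (japN (p - s' / 2) + japN (p' - 1 / 2)).toReal by ring,
      ENNReal.ofReal_mul (by positivity : 0 ≤ C * K * T ^ γ),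
      ENNReal.ofReal_toReal (ENNReal.add_lt_top.2 ⟨hj1, hj2⟩).ne,
      ENNReal.ofReal_mul (by norm_num : (0 : ℝ) ≤ 2)]
    have : ENNReal.ofReal 2 = 2 := by simp
    rw [this]
    ring
  obtain ⟨u, hu1, hu2⟩ := exists_xSpace hM hbdd
    (fun t₀ ht₀ => tendsto_wN_sub (by fun_prop) (fun t ht => hw t ht) hcont hWG
      (fun t ht => ae_of_all _ (hFG t ht)) ht₀)
  exact ⟨u, fun t ht => by rw [hu1 t ht]; exact hw t ht, hu2⟩

/-! ### Quadratic fixed point equations -/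

section Quadratic

variable {E X : Type*} [NormedAddCommGroup E] [NormedSpace ℝ E] [NormedAddCommGroup X]
  [NormedSpace ℝ X] {B : X →L[ℝ] X →L[ℝ] X} {β R : ℝ}

theorem norm_quadratic_sub_le (hβ : 0 ≤ β) (hB : ∀ u w, ‖B u w‖ ≤ β * ‖u‖ * ‖w‖)
    (hβR : β * R ≤ 1 / 4) {u w : X} (hu : ‖u‖ ≤ R) (hw : ‖w‖ ≤ R) :
    ‖B u u - B w w‖ ≤ 1 / 2 * ‖u - w‖ := by
  have e : B u u - B w w = B (u - w) u + B w (u - w) := by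
    simp only [map_sub, sub_apply]; abel
  have h1 : ‖B (u - w) u‖ ≤ 1 / 4 * ‖u - w‖ := by
    refine (hB _ _).trans ?_
    calc _ = (β * ‖u‖) * ‖u - w‖ := by ring
      _ ≤ (β * R) * ‖u - w‖ := by gcongr
      _ ≤ _ := by gcongr
  have h2 : ‖B w (u - w)‖ ≤ 1 / 4 * ‖u - w‖ := by
    refine (hB _ _).trans ?_
    calc _ ≤ (β * R) * ‖u - w‖ := by gcongr
      _ ≤ _ := by gcongr
  rw [e]
  exact (norm_add_le _ _).trans (by linarith)

theorem quadratic_injOn (hβ : 0 ≤ β) (hB : ∀ u w, ‖B u w‖ ≤ β * ‖u‖ * ‖w‖)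
    (hβR : β * R ≤ 1 / 4) {u w : X} (hu : ‖u‖ ≤ R) (hw : ‖w‖ ≤ R)
    (h : u - B u u = w - B w w) : u = w := by
  have h1 := norm_quadratic_sub_le hβ hB hβR hu hw
  have e : B u u - B w w = u - w := by
    rw [sub_eq_sub_iff_sub_eq_sub] at h
    exact h.symm
  rw [e] at h1
  have := norm_nonneg (u - w)
  exact sub_eq_zero.1 (norm_eq_zero.1 (by linarith))

theorem exists_quadratic_fixedPoint [CompleteSpace X] (hR : 0 < R) (hβ : 0 ≤ β)
    (hB : ∀ u w, ‖B u w‖ ≤ β * ‖u‖ * ‖w‖) (hβR : β * R ≤ 1 / 4) {y : X} (hy : ‖y‖ ≤ R / 2) :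
    ∃ u, ‖u‖ < R ∧ u = y + B u u := by
  have hball : ∀ u, ‖u‖ ≤ R → ‖y + B u u‖ < R := by
    intro u hu
    have h1 : ‖B u u‖ ≤ 1 / 4 * R := by
      refine (hB u u).trans ?_
      calc _ ≤ β * R * R := by gcongr
        _ ≤ _ := by gcongr
    exact (norm_add_le _ _).trans_lt (by linarith)
  have hmaps : MapsTo (fun u => y + B u u) (Metric.closedBall 0 R) (Metric.closedBall 0 R) := by
    intro u hu
    rw [mem_closedBall_zero_iff] at hu ⊢
    exact (hball u hu).le
  have hc : ContractingWith (1 / 2) (hmaps.restrict _ _ _) := by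
    refine ⟨by norm_num, LipschitzWith.of_dist_le_mul fun u w => ?_⟩
    have hu := mem_closedBall_zero_iff.1 u.2
    have hw := mem_closedBall_zero_iff.1 w.2
    rw [Subtype.dist_eq, Subtype.dist_eq, MapsTo.val_restrict_apply, MapsTo.val_restrict_apply,
      dist_eq_norm, dist_eq_norm, add_sub_add_left_eq_sub]
    have := norm_quadratic_sub_le hβ hB hβR hu hw
    simpa using this
  obtain ⟨u, hu, hfix, -⟩ := hc.exists_fixedPoint' Metric.isClosed_closedBall.isComplete hmaps
    (x := 0) (by simp [hR.le]) (edist_ne_top _ _)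
  have hfix' : y + B u u = u := hfix
  refine ⟨u, ?_, hfix'.symm⟩
  rw [mem_closedBall_zero_iff] at hu
  rw [← hfix']
  exact hball u hu

theorem contDiff_quadratic (B : X →L[ℝ] X →L[ℝ] X) : ContDiff ℝ ∞ fun u => u - B u u :=
  contDiff_id.sub (B.contDiff.clm_apply contDiff_id)

theorem hasFDerivAt_quadratic (B : X →L[ℝ] X →L[ℝ] X) (u : X) :
    HasFDerivAt (fun u => u - B u u) (1 - (B u + B.flip u)) u := by
  have h := (hasFDerivAt_id u).sub ((B.hasFDerivAt (x := u)).clm_apply (hasFDerivAt_id u))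
  exact h

/-- The solution of `u = y + B(u,u)` of small norm depends smoothly on `y`: it is a local inverse
of `u ↦ u - B(u,u)`, whose derivative is a small perturbation of the identity. -/
theorem contDiffAt_quadratic_solution [CompleteSpace X] (hβ : 0 ≤ β)
    (hB : ∀ u w, ‖B u w‖ ≤ β * ‖u‖ * ‖w‖) (hβR : β * R ≤ 1 / 4) {L : E →L[ℝ] X} {S : E → X}
    {φ₀ : E} (hS : ∀ᶠ φ in 𝓝 φ₀, ‖S φ‖ < R ∧ S φ = L φ + B (S φ) (S φ)) :
    ContDiffAt ℝ ∞ S φ₀ := by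
  obtain ⟨h1, h2⟩ := hS.self_of_nhds
  set u₀ := S φ₀ with hu₀
  set D : X →L[ℝ] X := B u₀ + B.flip u₀ with hD
  have hDn : ‖D‖ < 1 := by
    have hD1 : ‖D‖ ≤ 1 / 2 := by
      refine D.opNorm_le_bound (by norm_num) fun w => ?_
      have e : D w = B u₀ w + B w u₀ := rfl
      have a1 : ‖B u₀ w‖ ≤ 1 / 4 * ‖w‖ := (hB _ _).trans (by
        calc _ ≤ (β * R) * ‖w‖ := by gcongr
          _ ≤ _ := by gcongr)
      have a2 : ‖B w u₀‖ ≤ 1 / 4 * ‖w‖ := (hB _ _).trans (by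
        calc _ = (β * ‖u₀‖) * ‖w‖ := by ring
          _ ≤ (β * R) * ‖w‖ := by gcongr
          _ ≤ _ := by gcongr)
      rw [e]
      exact (norm_add_le _ _).trans (by linarith)
    linarith
  let e : X ≃L[ℝ] X := ContinuousLinearEquiv.unitsEquiv ℝ X (Units.oneSub D hDn)
  have he : HasFDerivAt (fun u => u - B u u) (e : X →L[ℝ] X) u₀ := hasFDerivAt_quadratic B u₀
  have hcd : ContDiffAt ℝ ∞ (fun u => u - B u u) u₀ := (contDiff_quadratic B).contDiffAt
  have hn : (∞ : WithTop ℕ∞) ≠ 0 := by simp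
  have hst := hcd.hasStrictFDerivAt' he hn
  have hL : L φ₀ = u₀ - B u₀ u₀ := by rw [eq_sub_iff_add_eq]; exact h2.symm
  have hinv : ContDiffAt ℝ ∞ (hcd.localInverse he hn) (u₀ - B u₀ u₀) := hcd.to_localInverse he hn
  have hinv0 : hcd.localInverse he hn (u₀ - B u₀ u₀) = u₀ := hcd.localInverse_apply_image he hn
  have hr : ∀ᶠ y in 𝓝 (u₀ - B u₀ u₀), hcd.localInverse he hn y -
      B (hcd.localInverse he hn y) (hcd.localInverse he hn y) = y :=
    hst.eventually_right_inverse
  rw [← hL] at hinv hinv0 hr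
  have hLc : Tendsto L (𝓝 φ₀) (𝓝 (L φ₀)) := L.continuous.tendsto φ₀
  refine (hinv.comp φ₀ L.contDiff.contDiffAt).congr_of_eventuallyEq ?_
  have hsmall : ∀ᶠ y in 𝓝 (L φ₀), ‖hcd.localInverse he hn y‖ < R := by
    have := hinv.continuousAt.norm
    refine this.eventually_lt continuousAt_const ?_
    rw [hinv0]; exact h1
  filter_upwards [hS, hLc.eventually hr, hLc.eventually hsmall] with φ a1 a2 a3
  refine quadratic_injOn hβ hB hβR a1.1.le a3.le ?_
  change _ = hcd.localInverse he hn (L φ) -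
    B (hcd.localInverse he hn (L φ)) (hcd.localInverse he hn (L φ))
  rw [a2, sub_eq_iff_eq_add]
  exact a1.2

end Quadratic

/-! ### The operators of the Duhamel formula on the time-weighted space -/

theorem duh_add {T K b m K' : ℝ} {h h' : ℝ → ℝ → ℂ} (hb : b < 1) (hh : IsSource T K b m h)
    (hh' : IsSource T K' b m h') (μ : ℝ) {t : ℝ} (ht : t ∈ Icc 0 T) (ξ : ℝ) :
    duh μ (fun τ ξ => h τ ξ + h' τ ξ) t ξ = duh μ h t ξ + duh μ h' t ξ := by
  simp only [duh, smul_add]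
  rw [intervalIntegral.integral_add (hh.exp_intervalIntegrable hb ht μ t ξ)
    (hh'.exp_intervalIntegrable hb ht μ t ξ), smul_add]

theorem duh_const_mul (μ c : ℝ) (h : ℝ → ℝ → ℂ) (t ξ : ℝ) :
    duh μ (fun τ ξ => c * h τ ξ) t ξ = c * duh μ h t ξ := by
  simp only [duh, Complex.real_smul, mul_left_comm _ (c : ℂ), intervalIntegral.integral_const_mul]

theorem duh_congr {μ : ℝ} {h h' : ℝ → ℝ → ℂ} {t ξ : ℝ} (ht : 0 ≤ t)
    (e : ∀ τ ∈ Ioc 0 t, h τ ξ = h' τ ξ) : duh μ h t ξ = duh μ h' t ξ := by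
  rw [duh, duh]
  congr 1
  refine intervalIntegral.integral_congr_ae (ae_of_all _ fun τ hτ => ?_)
  rw [uIoc_of_le ht] at hτ
  simp only [e τ hτ]

theorem src_add_left {s T : ℝ} (u u' w : XSpace s T) :
    src (u + u') w = fun τ ξ => src u w τ ξ + src u' w τ ξ := by
  funext τ ξ; rw [src, XSpace.vel_add, prodHat_add_left]; rfl

theorem src_smul_left {s T : ℝ} (c : ℝ) (u w : XSpace s T) :
    src (c • u) w = fun τ ξ => c * src u w τ ξ := by
  funext τ ξ; rw [src, XSpace.vel_smul, prodHat_smul_left]; rfl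

theorem src_comm {s T : ℝ} (u w : XSpace s T) : src u w = src w u := by
  funext τ ξ; exact prodHat_comm _ _ _

theorem isSource_zero (T b m : ℝ) : IsSource T 0 b m fun _ _ => 0 where
  meas := stronglyMeasurable_const
  herm := by simp
  bound := by simp

theorem duh_zero_source (μ t ξ : ℝ) : duh μ (fun _ _ => 0) t ξ = 0 := by simp [duh]

/-- The free evolution and the bilinear Duhamel operator on `X_T^s`. -/
theorem exists_operators {μ : ℝ} (hμ : 0 < μ) {s : ℝ} (hs : 1 / 2 < s) :
    ∃ γ C : ℝ, 0 < γ ∧ 0 ≤ C ∧ ∀ T ∈ Ioc (0 : ℝ) 1,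
      ∃ (L : Sob s →L[ℝ] XSpace s T) (B : XSpace s T →L[ℝ] XSpace s T →L[ℝ] XSpace s T),
        (∀ φ, ‖L φ‖ ≤ C * ‖φ‖) ∧ (∀ u w, ‖B u w‖ ≤ C * T ^ γ * ‖u‖ * ‖w‖) ∧
        (∀ φ : Sob s, ∀ t ∈ Icc 0 T, hat ((L φ).traj t) =ᵐ[volume] fun ξ =>
          Real.exp (t * symb μ ξ) • hat φ.toL2 ξ) ∧
        ∀ u w, ∀ t ∈ Icc 0 T, hat ((B u w).traj t) =ᵐ[volume] duh μ (src u w) t := by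
  have hs0 : 0 ≤ s := by linarith
  have hsing := sing_lt hs
  obtain ⟨γ, C, hγ, hC, hsol⟩ := exists_linear_solution hμ hs hs0
    (show s < s + 1 / 2 - sing s by linarith)
  have hcs := srcC_pos s
  refine ⟨γ, 2 * Real.exp (1 + μ) + C * srcC s, hγ, by positivity, fun T hT => ?_⟩
  have hTγ : 0 ≤ T ^ γ := Real.rpow_nonneg hT.1.le _
  have hL : ∀ φ : Sob s, ∃ u : XSpace s T, (∀ t ∈ Icc 0 T, hat (u.traj t) =ᵐ[volume] fun ξ =>
      Real.exp (t * symb μ ξ) • hat φ.toL2 ξ) ∧ ‖u‖ ≤ 2 * Real.exp (1 + μ) * ‖φ‖ := by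
    intro φ
    obtain ⟨u, h1, h2⟩ := hsol T hT φ.toL2 0 _ ((sobNorm s).incl_lt_top φ) le_rfl
      (isSource_zero T _ _)
    refine ⟨u, fun t ht => ?_, ?_⟩
    · filter_upwards [h1 t ht] with ξ hξ
      rw [hξ, duh_zero_source, add_zero]
    · rw [← ExtNorm.enorm_eq, mul_zero, zero_mul, ENNReal.ofReal_zero, add_zero, ← ofReal_norm,
        ← ofReal_norm, ← ENNReal.ofReal_mul (by positivity)] at h2
      exact (ENNReal.ofReal_le_ofReal_iff (by positivity)).1 h2
  have hB : ∀ u w : XSpace s T, ∃ z : XSpace s T,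
      (∀ t ∈ Icc 0 T, hat (z.traj t) =ᵐ[volume] duh μ (src u w) t) ∧
      ‖z‖ ≤ C * srcC s * T ^ γ * ‖u‖ * ‖w‖ := by
    intro u w
    obtain ⟨z, h1, h2⟩ := hsol T hT 0 (srcC s * (‖u‖ * ‖w‖)) (src u w) (by simp [ExtNorm.zero])
      (by positivity) (isSource_src hs0 hT.1.le u w)
    refine ⟨z, fun t ht => ?_, ?_⟩
    · filter_upwards [h1 t ht, hat_zero] with ξ hξ h0
      rw [hξ, h0]; simp
    · rw [ExtNorm.zero, mul_zero, zero_add, ← ofReal_norm] at h2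
      refine ((ENNReal.ofReal_le_ofReal_iff (by positivity)).1 h2).trans (le_of_eq ?_)
      ring
  choose L hL1 hL2 using hL
  choose B hB1 hB2 using hB
  let L' : Sob s →ₗ[ℝ] XSpace s T :=
    { toFun := L
      map_add' := fun φ ψ => by
        refine XSpace.ext_hat fun t ht => ?_
        rw [XSpace.traj_add]
        filter_upwards [hL1 (φ + ψ) t ht, hL1 φ t ht, hL1 ψ t ht, hat_add ((L φ).traj t)
          ((L ψ).traj t), hat_add φ.toL2 ψ.toL2] with ξ e1 e2 e3 e4 e5
        rw [e4, Pi.add_apply, e1, e2, e3, Sob.toL2, map_add, e5, Pi.add_apply, smul_add]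
      map_smul' := fun c φ => by
        refine XSpace.ext_hat fun t ht => ?_
        rw [RingHom.id_apply, XSpace.traj_smul]
        filter_upwards [hL1 (c • φ) t ht, hL1 φ t ht, hat_smul c ((L φ).traj t),
          hat_smul c φ.toL2] with ξ e1 e2 e4 e5
        rw [e4, Pi.smul_apply, e1, e2, Sob.toL2, map_smul, e5, Pi.smul_apply, smul_comm] }
  have hsrc := fun u w : XSpace s T => isSource_src hs0 hT.1.le u w
  have hadd : ∀ u u' w, B (u + u') w = B u w + B u' w := fun u u' w => by
    refine XSpace.ext_hat fun t ht => ?_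
    rw [XSpace.traj_add]
    filter_upwards [hB1 (u + u') w t ht, hB1 u w t ht, hB1 u' w t ht, hat_add ((B u w).traj t)
      ((B u' w).traj t)] with ξ e1 e2 e3 e4
    rw [e4, Pi.add_apply, e1, e2, e3, src_add_left, duh_add (by linarith) (hsrc u w) (hsrc u' w) μ ht]
  have hsmul : ∀ (c : ℝ) u w, B (c • u) w = c • B u w := fun c u w => by
    refine XSpace.ext_hat fun t ht => ?_
    rw [XSpace.traj_smul]
    filter_upwards [hB1 (c • u) w t ht, hB1 u w t ht, hat_smul c ((B u w).traj t)] with ξ e1 e2 e4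
    rw [e4, Pi.smul_apply, e1, e2, src_smul_left, duh_const_mul, Complex.real_smul]
  have hcomm : ∀ u w, B u w = B w u := fun u w => by
    refine XSpace.ext_hat fun t ht => ?_
    filter_upwards [hB1 u w t ht, hB1 w u t ht] with ξ e1 e2
    rw [e1, e2, src_comm]
  let B' : XSpace s T →ₗ[ℝ] XSpace s T →ₗ[ℝ] XSpace s T := LinearMap.mk₂ ℝ B hadd hsmul
    (fun u w w' => by rw [hcomm, hadd, hcomm w, hcomm w'])
    (fun c u w => by rw [hcomm, hsmul, hcomm w])
  refine ⟨L'.mkContinuous (2 * Real.exp (1 + μ)) hL2,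
    B'.mkContinuous₂ (C * srcC s * T ^ γ) hB2, fun φ => ?_, fun u w => ?_, hL1, hB1⟩
  · refine (hL2 φ).trans ?_
    gcongr
    have : 0 ≤ C * srcC s := by positivity
    linarith
  · refine (hB2 u w).trans ?_
    gcongr
    have := Real.exp_pos (1 + μ)
    linarith

/-- Local existence with smooth dependence on the data, on a time interval that depends only on
the size of the data. -/
theorem exists_flow {μ : ℝ} (hμ : 0 < μ) {s : ℝ} (hs : 1 / 2 < s) :
    ∃ T : ℝ → ℝ, ∀ r : ℝ, 0 ≤ r → 0 < T r ∧ T r ≤ 1 ∧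
      ∃ S : Sob s → XSpace s (T r), ContDiffOn ℝ ∞ S (Metric.ball 0 (r + 1)) ∧
        ∀ φ ∈ Metric.ball (0 : Sob s) (r + 1), IsSolution μ (T r) φ.toL2 (S φ).traj := by
  obtain ⟨γ, C, hγ, hC, hop⟩ := exists_operators hμ hs
  set R : ℝ → ℝ := fun r => 2 * (C * (r + 1)) + 1 with hR
  -- `T` is small enough that `C T^γ R ≤ 1/4`
  set T : ℝ → ℝ := fun r => min 1 ((4 * (C + 1) * R r)⁻¹ ^ γ⁻¹) with hTdef
  refine ⟨T, fun r hr => ?_⟩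
  have hR0 : 0 < R r := by have : 0 ≤ C * (r + 1) := by positivity
                           simp only [hR]; linarith
  have hx : 0 < (4 * (C + 1) * R r)⁻¹ := by positivity
  have hT0 : 0 < T r := lt_min one_pos (Real.rpow_pos_of_pos hx _)
  have hT1 : T r ≤ 1 := min_le_left _ _
  refine ⟨hT0, hT1, ?_⟩
  obtain ⟨L, B, hL, hB, hLt, hBt⟩ := hop (T r) ⟨hT0, hT1⟩
  have := completeSpace_xSpace (s := s) (by linarith) (T r)
  have hTγ : (T r) ^ γ ≤ (4 * (C + 1) * R r)⁻¹ := by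
    calc (T r) ^ γ ≤ ((4 * (C + 1) * R r)⁻¹ ^ γ⁻¹) ^ γ :=
          Real.rpow_le_rpow hT0.le (min_le_right _ _) hγ.le
      _ = _ := Real.rpow_inv_rpow hx.le hγ.ne'
  have hTγ0 : 0 ≤ (T r) ^ γ := Real.rpow_nonneg hT0.le _
  have hβR : C * (T r) ^ γ * R r ≤ 1 / 4 := by
    calc C * (T r) ^ γ * R r ≤ (C + 1) * (4 * (C + 1) * R r)⁻¹ * R r := by
          gcongr; linarith
      _ = 1 / 4 := by field_simp
  have hex : ∀ φ : Sob s, ∃ u : XSpace s (T r), φ ∈ Metric.ball (0 : Sob s) (r + 1) →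
      ‖u‖ < R r ∧ u = L φ + B u u := by
    intro φ
    by_cases hφ : φ ∈ Metric.ball (0 : Sob s) (r + 1)
    · have hφ' : ‖φ‖ < r + 1 := by simpa using hφ
      have hy : ‖L φ‖ ≤ R r / 2 := by
        refine (hL φ).trans ?_
        have : C * ‖φ‖ ≤ C * (r + 1) := by gcongr
        simp only [hR]; linarith
      obtain ⟨u, h1, h2⟩ := exists_quadratic_fixedPoint hR0 (by positivity) hB hβR hy
      exact ⟨u, fun _ => ⟨h1, h2⟩⟩
    · exact ⟨0, fun h => (hφ h).elim⟩
  choose S hS using hex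
  refine ⟨S, fun φ hφ => ?_, fun φ hφ => ?_⟩
  · refine (contDiffAt_quadratic_solution (by positivity) hB hβR
      (L := L) ?_).contDiffWithinAt
    filter_upwards [Metric.isOpen_ball.mem_nhds hφ] with ψ hψ
    exact hS ψ hψ
  · rw [isSolution_iff hs]
    intro t ht
    have h2 := (hS φ hφ).2
    have h3 : (S φ).traj t = (L φ).traj t + (B (S φ) (S φ)).traj t := by
      rw [← XSpace.traj_add, ← h2]
    filter_upwards [hLt φ t ht, hBt (S φ) (S φ) t ht,
      hat_add ((L φ).traj t) ((B (S φ) (S φ)).traj t)] with ξ e1 e2 e3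
    rw [h3, e3, Pi.add_apply, e1, e2]

/-! ### Uniqueness for the Duhamel formula -/

/-- If every upper bound `D ≥ 0` can be replaced by `D / 2`, there is the upper bound `0`. -/
theorem nonpos_of_halving {f : ℝ → ℝ} {A : Set ℝ} {D : ℝ} (hD0 : 0 ≤ D) (hD : ∀ τ ∈ A, f τ ≤ D)
    (h : ∀ D, 0 ≤ D → (∀ τ ∈ A, f τ ≤ D) → ∀ τ ∈ A, f τ ≤ D / 2) : ∀ τ ∈ A, f τ ≤ 0 := by
  have hn : ∀ n : ℕ, ∀ τ ∈ A, f τ ≤ D * (1 / 2) ^ n := by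
    intro n
    induction n with
    | zero => simpa using hD
    | succ n ih =>
      intro τ hτ
      refine (h _ (by positivity) ih τ hτ).trans (le_of_eq ?_)
      rw [pow_succ]; ring
  intro τ hτ
  have ht : Tendsto (fun n : ℕ => D * (1 / 2 : ℝ) ^ n) atTop (𝓝 (D * 0)) :=
    (tendsto_pow_atTop_nhds_zero_of_lt_one (by norm_num) (by norm_num)).const_mul D
  rw [mul_zero] at ht
  exact ge_of_tendsto ht (Eventually.of_forall fun n => hn n τ hτ)

theorem src_self_eq {s T : ℝ} (u w : XSpace s T) :
    src u u = fun τ ξ => (src (u - w) u τ ξ + src (u - w) w τ ξ) + src w w τ ξ := by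
  funext τ ξ
  simp only [src, XSpace.vel_sub, prodHat_sub_left, prodHat_comm (w.vel τ) (u.vel τ)]
  ring

/-- The Fourier transform of the difference of two solutions with the same data. -/
theorem hat_sub_eq_duh {μ s T : ℝ} (hs : 1 / 2 < s) {φ : L2} {u w : XSpace s T}
    (hu : IsSolution μ T φ u.traj) (hw : IsSolution μ T φ w.traj) {t : ℝ} (ht : t ∈ Icc 0 T) :
    hat ((u - w).traj t) =ᵐ[volume]
      duh μ (fun τ ξ => src (u - w) u τ ξ + src (u - w) w τ ξ) t := by
  rw [isSolution_iff hs] at hu hw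
  have hb : sing s < 1 := by linarith [sing_lt hs]
  have hS := fun u w : XSpace s T =>
    isSource_src (by linarith : 0 ≤ s) (ht.1.trans ht.2) u w
  rw [XSpace.traj_sub]
  filter_upwards [hu t ht, hw t ht, hat_sub (u.traj t) (w.traj t)] with ξ e1 e2 e3
  have e4 : duh μ (src u u) t ξ = duh μ (src (u - w) u) t ξ + duh μ (src (u - w) w) t ξ +
      duh μ (src w w) t ξ := by
    have hi := fun u w : XSpace s T => (hS u w).exp_intervalIntegrable hb ht μ t ξ
    simp only [duh]
    rw [← smul_add, ← smul_add, ← intervalIntegral.integral_add (hi _ _) (hi _ _),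
      ← intervalIntegral.integral_add ((hi _ _).add (hi _ _)) (hi _ _)]
    congr 1
    refine intervalIntegral.integral_congr fun τ _ => ?_
    rw [src_self_eq u w]
    simp only [smul_add]
  rw [e3, Pi.sub_apply, e1, e2, e4, duh_add hb (hS _ _) (hS _ _) μ ht]
  ring

theorem norm_src_sub_le {s T : ℝ} (u w : XSpace s T) {τ D lam : ℝ} (hτ : τ ∈ Ioc 0 T)
    (hD : Real.exp (-(lam * τ)) * (τ ^ weightExp s * ‖(u - w).vel τ‖) ≤ D) (ξ : ℝ) :
    ‖src (u - w) u τ ξ + src (u - w) w τ ξ‖ ≤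
      ((‖u‖ + ‖w‖) * D) * (Real.exp (lam * τ) * τ ^ (-sing s)) := by
  have ha : 0 < τ ^ weightExp s := Real.rpow_pos_of_pos hτ.1 _
  have hvu := norm_vel_le u hτ
  have hvw := norm_vel_le w hτ
  have he := Real.exp_pos (lam * τ)
  rw [Real.exp_neg, inv_mul_le_iff₀ he] at hD
  have e : τ ^ (-sing s) = (τ ^ weightExp s)⁻¹ * (τ ^ weightExp s)⁻¹ := by
    rw [← Real.rpow_neg hτ.1.le, ← Real.rpow_add hτ.1, ← two_mul_weightExp]; congr 1; ring
  have h1 : ‖src (u - w) u τ ξ + src (u - w) w τ ξ‖ ≤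
      ‖(u - w).vel τ‖ * (‖u.vel τ‖ + ‖w.vel τ‖) := by
    rw [mul_add]
    exact (norm_add_le _ _).trans (add_le_add (norm_prodHat_le _ _ _) (norm_prodHat_le _ _ _))
  calc _ ≤ _ := h1
    _ = (τ ^ weightExp s * ‖(u - w).vel τ‖) *
        (τ ^ weightExp s * ‖u.vel τ‖ + τ ^ weightExp s * ‖w.vel τ‖) * τ ^ (-sing s) := by
        rw [e]; field_simp
    _ ≤ (Real.exp (lam * τ) * D) * (‖u‖ + ‖w‖) * τ ^ (-sing s) := by
        have hED : 0 ≤ Real.exp (lam * τ) * D := le_trans (by positivity) hD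
        have hτb : 0 ≤ τ ^ (-sing s) := Real.rpow_nonneg hτ.1.le _
        gcongr
    _ = _ := by ring

/-- Two solutions of the Duhamel formula in `X_T^s` coincide. In the norm
`sup_t e^{-λt} t^{(1-s)₊/2} ‖∂ₓ(u - w)‖` the Duhamel operator has the factor `λ^{-ε}`, so that it
is a contraction for large `λ`, with no smallness of `T` or of the solutions. -/
theorem isSolution_unique {μ : ℝ} (hμ : 0 < μ) {s T : ℝ} (hs : 1 / 2 < s) (hT : T ∈ Ioc (0 : ℝ) 1)
    {φ : L2} {u w : XSpace s T} (hu : IsSolution μ T φ u.traj) (hw : IsSolution μ T φ w.traj) :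
    u = w := by
  have hsing := sing_lt hs
  have haw := two_mul_weightExp s
  have ha0 := weightExp_nonneg s
  set a := weightExp s with ha
  set b := sing s with hb
  set ε := (1 / 4 - a) / 4 with hε
  have hε0 : 0 < ε := by rw [hε]; linarith
  -- the decay `(1 + ξ² + λ)^{-θ}` is split into `λ^{-ε}`, one derivative and a square-integrable rest;
  -- `a < 1/4` leaves room for this below `θ = 1` and keeps `a + 1 - θ - 2a` nonnegative
  set θ := 3 / 4 + 2 * ε with hθ
  have hθ1 : θ < 1 := by rw [hθ, hε]; linarith
  have hj : japN (1 / 4 + ε) < ⊤ := japN_lt_top (by linarith)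
  set A := (japN (1 / 4 + ε)).toReal with hA
  set M := ‖u‖ + ‖w‖ with hM
  set C := Real.exp (1 + μ) * betaC θ b * M * A with hC
  have hβ := betaC_nonneg θ b
  have hA0 : 0 ≤ A := ENNReal.toReal_nonneg
  have hC0 : 0 ≤ C := by positivity
  -- `λ` is chosen so that `C λ^{-ε} ≤ 1/2`
  obtain ⟨lam, hlam0, hlam⟩ : ∃ lam : ℝ, 0 < lam ∧ C * lam ^ (-ε) ≤ 1 / 2 := by
    have h1 : Tendsto (fun x : ℝ => C * x ^ (-ε)) atTop (𝓝 (C * 0)) :=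
      (tendsto_rpow_neg_atTop hε0).const_mul C
    rw [mul_zero] at h1
    obtain ⟨x, hx1, hx2⟩ := ((eventually_gt_atTop 0).and
      (h1.eventually_le_const (by norm_num : (0 : ℝ) < 1 / 2))).exists
    exact ⟨x, hx1, hx2⟩
  set f : ℝ → ℝ := fun τ => Real.exp (-(lam * τ)) * (τ ^ a * ‖(u - w).vel τ‖) with hf
  have hf0 : ∀ τ ∈ Ioc 0 T, f τ ≤ ‖u - w‖ := by
    intro τ hτ
    have h1 := norm_vel_le (u - w) hτ
    have h2 : Real.exp (-(lam * τ)) ≤ 1 := by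
      rw [Real.exp_le_one_iff]
      have := mul_pos hlam0 hτ.1
      linarith
    have h3 : 0 ≤ τ ^ a := Real.rpow_nonneg hτ.1.le _
    calc f τ ≤ 1 * ‖u - w‖ := by
          simp only [hf]
          gcongr
      _ = _ := one_mul _
  have hhalf : ∀ D, 0 ≤ D → (∀ τ ∈ Ioc 0 T, f τ ≤ D) → ∀ τ ∈ Ioc 0 T, f τ ≤ D / 2 := by
    intro D hD0 hD t ht
    have htI : t ∈ Icc 0 T := ⟨ht.1.le, ht.2⟩
    have hptw : ∀ ξ, ‖duh μ (fun τ ξ => src (u - w) u τ ξ + src (u - w) w τ ξ) t ξ‖ ≤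
        Real.exp (1 + μ) * betaC θ b * (M * D) * Real.exp (lam * t) * t ^ (1 - θ - b) *
          lam ^ (-ε) * (1 + ξ ^ 2) ^ (-(3 / 4 + ε)) := by
      intro ξ
      have h1 := norm_duh_le (h := fun τ ξ => src (u - w) u τ ξ + src (u - w) w τ ξ) (b := b)
        (ξ := ξ) hμ (by positivity : 0 ≤ θ) hθ1 (by linarith) ht.1 (ht.2.trans hT.2) hlam0.le
        (fun τ hτ => norm_src_sub_le u w ⟨hτ.1, hτ.2.le.trans ht.2⟩
          (hD τ ⟨hτ.1, hτ.2.le.trans ht.2⟩) ξ)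
      refine h1.trans ?_
      have hJ := jap_pos ξ
      have ht0 := ht.1
      have h2 : (1 + ξ ^ 2 + lam) ^ (-θ) ≤ lam ^ (-ε) * (1 + ξ ^ 2) ^ (-(3 / 4 + ε)) := by
        have e : -θ = -ε + -(3 / 4 + ε) := by rw [hθ]; ring
        rw [e, Real.rpow_add (by positivity)]
        refine mul_le_mul ?_ ?_ (by positivity) (by positivity)
        · exact Real.rpow_le_rpow_of_nonpos hlam0 (by linarith) (by linarith)
        · exact Real.rpow_le_rpow_of_nonpos hJ (by linarith) (by linarith)
      calc _ ≤ Real.exp (1 + μ) * betaC θ b * (M * D) * Real.exp (lam * t) * t ^ (1 - θ - b) *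
            (lam ^ (-ε) * (1 + ξ ^ 2) ^ (-(3 / 4 + ε))) := by gcongr
        _ = _ := by ring
    set K := Real.exp (1 + μ) * betaC θ b * (M * D) * Real.exp (lam * t) * t ^ (1 - θ - b) *
          lam ^ (-ε) with hK
    have hK0 : 0 ≤ K := by have := ht.1; positivity
    have hwn : wN (fun ξ => ξ) ((u - w).traj t) ≤ ENNReal.ofReal K * japN (1 / 4 + ε) := by
      have e1 : wN (fun ξ => ξ) ((u - w).traj t) = eLpNorm (fun ξ => ξ •
          duh μ (fun τ ξ => src (u - w) u τ ξ + src (u - w) w τ ξ) t ξ) 2 volume := by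
        refine eLpNorm_congr_ae ?_
        filter_upwards [hat_sub_eq_duh hs hu hw htI] with ξ hξ
        rw [hξ]
      rw [e1, show 1 / 4 + ε = (3 / 4 + ε) - 1 / 2 by ring]
      exact eLpNorm_weight_le (q := 1 / 2) abs_le_japanese hptw
    have hvel : ‖(u - w).vel t‖ ≤ K * A := by
      have h1 := ((u - w).hasWeakDeriv_vel ht).enorm_eq
      have h2 : ‖(u - w).vel t‖ₑ ≤ ENNReal.ofReal K * japN (1 / 4 + ε) := by
        refine le_trans ?_ (h1.trans_le hwn)
        exact le_mul_of_one_le_left (by simp) sqrt_two_pi_le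
      rw [← ofReal_norm, ← ENNReal.ofReal_toReal hj.ne, ← ENNReal.ofReal_mul hK0] at h2
      exact (ENNReal.ofReal_le_ofReal_iff (by positivity)).1 h2
    have htp : t ^ a * t ^ (1 - θ - b) ≤ 1 := by
      rw [← Real.rpow_add ht.1]
      refine Real.rpow_le_one ht.1.le (ht.2.trans hT.2) ?_
      rw [hθ, hε]; linarith
    have ha' : 0 ≤ t ^ a := Real.rpow_nonneg ht.1.le _
    calc f t ≤ Real.exp (-(lam * t)) * (t ^ a * (K * A)) := by
          simp only [hf]; gcongr
      _ = (Real.exp (-(lam * t)) * Real.exp (lam * t)) * (t ^ a * t ^ (1 - θ - b)) *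
          ((C * lam ^ (-ε)) * D) := by rw [hK, hC]; ring
      _ ≤ 1 * 1 * (1 / 2 * D) := by
          have : Real.exp (-(lam * t)) * Real.exp (lam * t) = 1 := by rw [← Real.exp_add]; simp
          rw [this]
          gcongr
      _ = D / 2 := by ring
  have hzero := nonpos_of_halving (norm_nonneg (u - w)) hf0 hhalf
  have hvz : ∀ τ ∈ Ioc 0 T, (u - w).vel τ = 0 := by
    intro τ hτ
    have h1 := hzero τ hτ
    have h2 : 0 < Real.exp (-(lam * τ)) * τ ^ a :=
      mul_pos (Real.exp_pos _) (Real.rpow_pos_of_pos hτ.1 _)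
    simp only [hf, ← mul_assoc] at h1
    have h3 := nonpos_of_mul_nonpos_right h1 h2
    exact norm_le_zero_iff.1 h3
  refine XSpace.ext_traj fun t ht => ?_
  rw [← sub_eq_zero, ← XSpace.traj_sub]
  refine eq_zero_of_hat _ ?_
  filter_upwards [hat_sub_eq_duh hs hu hw ht] with ξ hξ
  rw [hξ, duh_congr (h' := fun _ _ => 0) ht.1 fun τ hτ => ?_, duh_zero_source]
  · rfl
  · have h0 : ‖(u - w).vel τ‖ = 0 := by rw [hvz τ ⟨hτ.1, hτ.2.trans ht.2⟩, norm_zero]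
    have h1 : ∀ z : XSpace s T, src (u - w) z τ ξ = 0 := fun z => by
      rw [← norm_le_zero_iff]
      refine (norm_prodHat_le _ _ _).trans ?_
      rw [h0, zero_mul]
    simp only [h1, add_zero]

/-! ### Smoothing -/

/-- The right-hand side of the Duhamel formula on the Fourier side. It agrees with `û(t)` for almost
every `ξ` only, but it is continuous in `t` for each `ξ`. -/
noncomputable def rhs {s T : ℝ} (μ : ℝ) (φ : L2) (u : XSpace s T) (t ξ : ℝ) : ℂ :=
  Real.exp (t * symb μ ξ) • hat φ ξ + duh μ (src u u) t ξ

theorem hat_eq_rhs {μ s T : ℝ} (hs : 1 / 2 < s) {φ : L2} {u : XSpace s T}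
    (hu : IsSolution μ T φ u.traj) {t : ℝ} (ht : t ∈ Icc 0 T) :
    hat (u.traj t) =ᵐ[volume] rhs μ φ u t := (isSolution_iff hs φ u).1 hu t ht

/-- The source restricted to the times after `ε`. -/
noncomputable def after (ε : ℝ) (h : ℝ → ℝ → ℂ) (τ ξ : ℝ) : ℂ :=
  (Ioi ε).indicator (fun τ => h τ ξ) τ

/-- The Duhamel integral up to `t` is the propagated one up to `ε` plus the part from `ε` on. -/
theorem duh_restart {T K b m : ℝ} {h : ℝ → ℝ → ℂ} (hh : IsSource T K b m h) (hb : b < 1) (μ : ℝ)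
    {ε t : ℝ} (hε : 0 ≤ ε) (hεt : ε ≤ t) (ht : t ≤ T) (ξ : ℝ) :
    duh μ h t ξ = Real.exp ((t - ε) * symb μ ξ) • duh μ h ε ξ + duh μ (after ε h) t ξ := by
  have hi1 : IntervalIntegrable (fun τ => Real.exp ((t - τ) * symb μ ξ) • h τ ξ) volume 0 ε :=
    hh.exp_intervalIntegrable hb ⟨hε, hεt.trans ht⟩ μ t ξ
  have hi2 : IntervalIntegrable (fun τ => Real.exp ((t - τ) * symb μ ξ) • h τ ξ) volume 0 t :=
    hh.exp_intervalIntegrable hb ⟨hε.trans hεt, ht⟩ μ t ξ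
  have hi3 : IntervalIntegrable (fun τ => Real.exp ((t - τ) * symb μ ξ) • h τ ξ) volume ε t :=
    hi1.symm.trans hi2
  have e1 : ∫ τ in (0 : ℝ)..ε, Real.exp ((t - τ) * symb μ ξ) • h τ ξ =
      Real.exp ((t - ε) * symb μ ξ) • ∫ τ in (0 : ℝ)..ε, Real.exp ((ε - τ) * symb μ ξ) • h τ ξ := by
    rw [← intervalIntegral.integral_smul]
    refine intervalIntegral.integral_congr fun τ _ => ?_
    simp only [smul_smul, ← Real.exp_add]
    congr 2; ring
  have e2 : ∫ τ in (0 : ℝ)..t, Real.exp ((t - τ) * symb μ ξ) • after ε h τ ξ =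
      ∫ τ in ε..t, Real.exp ((t - τ) * symb μ ξ) • h τ ξ := by
    rw [intervalIntegral.integral_of_le (hε.trans hεt), intervalIntegral.integral_of_le hεt]
    have e3 : (fun τ => Real.exp ((t - τ) * symb μ ξ) • after ε h τ ξ) =
        (Ioi ε).indicator fun τ => Real.exp ((t - τ) * symb μ ξ) • h τ ξ := by
      funext τ
      by_cases hτ : τ ∈ Ioi ε
      · simp only [after, indicator_of_mem hτ]
      · simp only [after, indicator_of_notMem hτ, smul_zero]
    rw [e3, setIntegral_indicator measurableSet_Ioi]
    congr 2
    ext τ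
    simp only [mem_inter_iff, mem_Ioc, mem_Ioi]
    exact ⟨fun h => ⟨h.2, h.1.2⟩, fun h => ⟨⟨hε.trans_lt h.1, h.2⟩, h.1⟩⟩
  rw [duh, duh, duh, e2, ← intervalIntegral.integral_add_adjacent_intervals hi1 hi3, e1, smul_add,
    smul_comm]

theorem rhs_restart {μ s T : ℝ} (hs : 1 / 2 < s) (φ : L2) (u : XSpace s T)
    {ε t : ℝ} (hε : 0 ≤ ε) (hεt : ε ≤ t) (ht : t ≤ T) (ξ : ℝ) :
    rhs μ φ u t ξ = Real.exp ((t - ε) * symb μ ξ) • rhs μ φ u ε ξ +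
      duh μ (after ε (src u u)) t ξ := by
  rw [rhs, rhs, duh_restart (isSource_src (by linarith) (hε.trans (hεt.trans ht)) u u)
    (by linarith [sing_lt hs]) μ hε hεt ht ξ, smul_add, smul_smul, ← Real.exp_add, ← add_assoc]
  congr 4; ring

/-- Boundedness in `H^r` away from the initial time. -/
def BoundedAway {s T : ℝ} (u : XSpace s T) (r : ℝ) : Prop :=
  ∀ ε ∈ Ioc 0 T, ∃ K : ℝ, 0 ≤ K ∧ ∀ t ∈ Icc ε T, (sobNorm r).toFun (u.traj t) ≤ ENNReal.ofReal K

/-- On each `[ε,T]`, `ε > 0`, the transforms given by the Duhamel formula are dominated by one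
function `G` with `⟨ξ⟩^r G ∈ L²`. -/
def HasEnvelope {s T : ℝ} (μ : ℝ) (φ : L2) (u : XSpace s T) (r : ℝ) : Prop :=
  ∀ ε ∈ Ioc 0 T, ∃ G : ℝ → ℝ, MemLp (fun ξ => (1 + ξ ^ 2) ^ (r / 2) * G ξ) 2 ∧
    ∀ t ∈ Icc ε T, ∀ ξ, ‖rhs μ φ u t ξ‖ ≤ G ξ

theorem BoundedAway.mono {s T r r' : ℝ} {u : XSpace s T} (h : BoundedAway u r) (hr : r' ≤ r) :
    BoundedAway u r' := fun ε hε => by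
  obtain ⟨K, hK, hb⟩ := h ε hε
  exact ⟨K, hK, fun t ht => (sobNorm_mono hr _).trans (hb t ht)⟩

theorem HasEnvelope.boundedAway {μ s T r : ℝ} (hs : 1 / 2 < s) {φ : L2} {u : XSpace s T}
    (hu : IsSolution μ T φ u.traj) (h : HasEnvelope μ φ u r) : BoundedAway u r := fun ε hε => by
  obtain ⟨G, hG, hb⟩ := h ε hε
  refine ⟨(eLpNorm (fun ξ => (1 + ξ ^ 2) ^ (r / 2) * G ξ) 2 volume).toReal, ENNReal.toReal_nonneg,
    fun t ht => ?_⟩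
  rw [ENNReal.ofReal_toReal hG.2.ne]
  refine eLpNorm_mono_ae ?_
  filter_upwards [hat_eq_rhs hs hu ⟨hε.1.le.trans ht.1, ht.2⟩] with ξ hξ
  rw [norm_smul, norm_mul, hξ]
  gcongr
  exact (hb t ht ξ).trans (le_abs_self _)

theorem boundedAway_one {s T : ℝ} (hs : 0 ≤ s) (u : XSpace s T) : BoundedAway u 1 := by
  intro ε hε
  have ha := weightExp_nonneg s
  have hεa : 0 < ε ^ weightExp s := Real.rpow_pos_of_pos hε.1 _
  refine ⟨‖u‖ + √(2 * Real.pi) * (ε ^ weightExp s)⁻¹ * ‖u‖, by positivity, fun t ht => ?_⟩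
  have htI : t ∈ Icc 0 T := ⟨hε.1.le.trans ht.1, ht.2⟩
  have h1 : (sobNorm 1).toFun (u.traj t) ≤
      wN (fun _ => 1) (u.traj t) + wN (fun ξ => ξ) (u.traj t) := by
    refine le_trans (eLpNorm_mono (g := fun ξ => ‖(1 : ℝ) • hat (u.traj t) ξ‖ +
      ‖ξ • hat (u.traj t) ξ‖) fun ξ => ?_) (le_trans (eLpNorm_add_le (p := 2)
        (aestronglyMeasurable_smul_hat measurable_const _).norm
        (aestronglyMeasurable_smul_hat measurable_id _).norm (by norm_num)) ?_)
    · rw [norm_smul, norm_smul, norm_smul, ← add_mul, norm_mul, norm_norm, norm_one]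
      gcongr
      rw [Real.norm_of_nonneg (by positivity), Real.norm_of_nonneg (by positivity),
        ← Real.sqrt_eq_rpow, Real.norm_eq_abs, Real.sqrt_le_left (by positivity)]
      nlinarith [abs_nonneg ξ, sq_abs ξ]
    · rw [eLpNorm_norm, eLpNorm_norm]; rfl
  have h2 : wN (fun _ => 1) (u.traj t) ≤ ENNReal.ofReal ‖u‖ := by
    rw [ofReal_norm]
    refine le_trans (wN_mono (fun ξ => ?_) _) (u.sobNorm_le htI)
    rw [abs_one]
    exact (Real.one_le_rpow (one_le_jap ξ) (by linarith)).trans (le_abs_self _)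
  have h3 : wN (fun ξ => ξ) (u.traj t) ≤
      ENNReal.ofReal (√(2 * Real.pi) * (ε ^ weightExp s)⁻¹ * ‖u‖) := by
    have h4 := norm_vel_le u ⟨hε.1.trans_le ht.1, ht.2⟩
    rw [← (u.hasWeakDeriv_vel ⟨hε.1.trans_le ht.1, ht.2⟩).enorm_eq, ← ofReal_norm,
      ← ENNReal.ofReal_mul (Real.sqrt_nonneg _), mul_assoc]
    refine ENNReal.ofReal_le_ofReal ?_
    gcongr
    rw [le_inv_mul_iff₀ hεa]
    refine le_trans ?_ h4
    gcongr
    · exact hε.1.le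
    · exact ht.1
  rw [ENNReal.ofReal_add (by positivity) (by positivity)]
  exact h1.trans (add_le_add h2 h3)

theorem BoundedAway.norm_src_le {s T r : ℝ} (hr : 1 ≤ r) {u : XSpace s T} (h : BoundedAway u r)
    {ε : ℝ} (hε : ε ∈ Ioc 0 T) : ∃ K : ℝ, 0 ≤ K ∧ ∀ t ∈ Icc ε T, ∀ ξ,
      ‖src u u t ξ‖ ≤ K * (1 + ξ ^ 2) ^ (-((r - 1) / 2)) := by
  obtain ⟨K, hK, hb⟩ := h ε hε
  refine ⟨2 ^ ((r - 1) / 2) * (K * K), by positivity, fun t ht ξ => ?_⟩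
  have htI : t ∈ Ioc 0 T := ⟨hε.1.trans_le ht.1, ht.2⟩
  have hv : (sobNorm (r - 1)).toFun (u.vel t) ≤ ENNReal.ofReal K := by
    rw [sobNorm_eq, (u.hasWeakDeriv_vel htI).wN_eq]
    refine le_trans (wN_mono (fun ξ => ?_) _) (hb t ht)
    have hJ := jap_pos ξ
    rw [abs_mul, abs_of_nonneg (a := (1 + ξ ^ 2) ^ ((r - 1) / 2)) (by positivity),
      abs_of_nonneg (a := (1 + ξ ^ 2) ^ (r / 2)) (by positivity)]
    calc _ ≤ (1 + ξ ^ 2) ^ ((r - 1) / 2) * (1 + ξ ^ 2) ^ (1 / 2 : ℝ) := by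
          gcongr; exact abs_le_japanese ξ
      _ = _ := by rw [← Real.rpow_add hJ]; congr 1; ring
  have hJ : 0 < (1 + ξ ^ 2) ^ ((r - 1) / 2) := Real.rpow_pos_of_pos (jap_pos ξ) _
  have h1 := (prodHat_weighted_le (by linarith : 0 ≤ r - 1) (u.vel t) (u.vel t) ξ).trans
    (mul_le_mul_right (mul_le_mul' hv hv) _)
  rw [← ENNReal.ofReal_mul hK, ← ENNReal.ofReal_mul (by positivity), ← ofReal_norm,
    ← ENNReal.ofReal_mul hJ.le, ENNReal.ofReal_le_ofReal_iff (by positivity)] at h1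
  rw [Real.rpow_neg (jap_pos ξ).le, ← div_eq_mul_inv, le_div_iff₀ hJ, mul_comm]
  exact h1

theorem norm_exp_smul_le {μ : ℝ} (hμ : 0 < μ) {N δ t : ℝ} (hN : 0 < N) (hδ : 0 < δ) (ht : δ ≤ t)
    (ht1 : t ≤ 1) (ξ : ℝ) :
    Real.exp (t * symb μ ξ) ≤ Real.exp (1 + μ) * (N ^ N * δ ^ (-N)) * (1 + ξ ^ 2) ^ (-N) := by
  have hJ := jap_pos ξ
  have h1 := exp_symb_le hμ (hδ.le.trans ht) ht1 ξ
  have h2 := exp_neg_le_rpow' hN (mul_pos hδ hJ)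
  have h3 : Real.exp (-(t * (1 + ξ ^ 2))) ≤ Real.exp (-(δ * (1 + ξ ^ 2))) := by
    rw [Real.exp_le_exp]; nlinarith
  rw [Real.mul_rpow hδ.le hJ.le] at h2
  calc _ ≤ Real.exp (1 + μ) * (N ^ N * (δ ^ (-N) * (1 + ξ ^ 2) ^ (-N))) := by
        refine h1.trans ?_
        gcongr
        exact h3.trans h2
    _ = _ := by ring

/-- A bound in `H^r` away from the initial time improves to an envelope in `H^{r + 1/4}`: restart
the Duhamel formula at a positive time. -/
theorem BoundedAway.hasEnvelope {μ : ℝ} (hμ : 0 < μ) {s T r : ℝ} (hs : 1 / 2 < s) (hT : T ≤ 1)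
    (hr : 1 ≤ r) {φ : L2} {u : XSpace s T} (hu : IsSolution μ T φ u.traj) (h : BoundedAway u r) :
    HasEnvelope μ φ u (r + 1 / 4) := by
  intro ε hε
  set δ := ε / 2 with hδ
  have hδ0 : 0 < δ := by have := hε.1; positivity
  have hδT : δ ∈ Ioc 0 T := ⟨hδ0, by linarith [hε.2]⟩
  have hδε : ε - δ = δ := by rw [hδ]; ring
  obtain ⟨K, hK, hsrc⟩ := h.norm_src_le hr hδT
  set N := (r + 1 / 4) / 2 with hN
  have hN0 : 0 < N := by rw [hN]; linarith
  set c₁ := Real.exp (1 + μ) * (N ^ N * δ ^ (-N)) with hc₁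
  set c₂ := Real.exp (1 + μ) * betaC (15 / 16) 0 * K with hc₂
  have hβ := betaC_nonneg (15 / 16) 0
  refine ⟨fun ξ => c₁ * (1 + ξ ^ 2) ^ (-N) * ‖rhs μ φ u δ ξ‖ +
    c₂ * (1 + ξ ^ 2) ^ (-(N + 5 / 16)), ?_, ?_⟩
  · have hm1 : MemLp (rhs μ φ u δ) 2 :=
      (memLp_hat (u.traj δ)).ae_eq (hat_eq_rhs hs hu ⟨hδ0.le, hδT.2⟩)
    have hm2 := (hm1.norm.const_mul c₁).add ((memLp_jap (r := 5 / 16) (by norm_num)).const_mul c₂)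
    refine hm2.ae_eq (ae_of_all _ fun ξ => ?_)
    have hJ := jap_pos ξ
    have e1 : (1 + ξ ^ 2) ^ N * (1 + ξ ^ 2) ^ (-N) = 1 := by rw [← Real.rpow_add hJ]; simp
    have e2 : (1 + ξ ^ 2) ^ (-(5 / 16) : ℝ) =
        (1 + ξ ^ 2) ^ N * (1 + ξ ^ 2) ^ (-(N + 5 / 16)) := by
      rw [← Real.rpow_add hJ]; congr 1; ring
    simp only [Pi.add_apply]
    rw [e2]
    calc _ = ((1 + ξ ^ 2) ^ N * (1 + ξ ^ 2) ^ (-N)) * (c₁ * ‖rhs μ φ u δ ξ‖) +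
          c₂ * ((1 + ξ ^ 2) ^ N * (1 + ξ ^ 2) ^ (-(N + 5 / 16))) := by rw [e1, one_mul]
      _ = _ := by ring
  · intro t ht ξ
    have hJ := jap_pos ξ
    have hδt : δ ≤ t := by have := hε.1; have := ht.1; linarith
    rw [rhs_restart hs φ u hδ0.le hδt ht.2 ξ]
    refine (norm_add_le _ _).trans (add_le_add ?_ ?_)
    · rw [norm_smul, Real.norm_of_nonneg (Real.exp_pos _).le]
      gcongr
      exact norm_exp_smul_le hμ hN0 hδ0 (by linarith [ht.1]) (by linarith [ht.2]) ξ
    -- the decay `⟨ξ⟩^{-2·15/16}` leaves `⟨ξ⟩^{-2·5/16} ∈ L²` after a gain of `1/4` over `H^r`,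
    -- since the source decays like `⟨ξ⟩^{-(r-1)}` only
    · have h1 := norm_duh_le (h := after δ (src u u)) (θ := 15 / 16) (b := 0) (ξ := ξ)
        (K := K * (1 + ξ ^ 2) ^ (-((r - 1) / 2))) (lam := 0) hμ (by norm_num) (by norm_num)
        (by norm_num) (hδ0.trans_le hδt) (ht.2.trans hT) le_rfl (fun τ hτ => ?_)
      · refine h1.trans ?_
        have e : -(N + 5 / 16) = -((r - 1) / 2) + -(15 / 16) := by rw [hN]; ring
        have ht1 : t ^ (1 - 15 / 16 - 0 : ℝ) ≤ 1 :=
          Real.rpow_le_one (by linarith) (ht.2.trans hT) (by norm_num)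
        have ht0 : 0 ≤ t ^ (1 - 15 / 16 - 0 : ℝ) := Real.rpow_nonneg (by linarith) _
        rw [e, Real.rpow_add hJ, zero_mul, Real.exp_zero, add_zero, hc₂]
        calc _ = Real.exp (1 + μ) * betaC (15 / 16) 0 * K * ((1 + ξ ^ 2) ^ (-((r - 1) / 2)) *
              (1 + ξ ^ 2) ^ (-(15 / 16) : ℝ)) * t ^ (1 - 15 / 16 - 0 : ℝ) := by ring
          _ ≤ Real.exp (1 + μ) * betaC (15 / 16) 0 * K * ((1 + ξ ^ 2) ^ (-((r - 1) / 2)) *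
              (1 + ξ ^ 2) ^ (-(15 / 16) : ℝ)) * 1 := by gcongr
          _ = _ := by ring
      · rw [zero_mul, Real.exp_zero, neg_zero, Real.rpow_zero, mul_one, mul_one]
        by_cases hτδ : τ ∈ Ioi δ
        · rw [after, indicator_of_mem hτδ]
          exact hsrc τ ⟨le_of_lt hτδ, hτ.2.le.trans ht.2⟩ ξ
        · rw [after, indicator_of_notMem hτδ, norm_zero]
          positivity

theorem boundedAway_all {μ : ℝ} (hμ : 0 < μ) {s T : ℝ} (hs : 1 / 2 < s) (hT : T ≤ 1)
    {φ : L2} {u : XSpace s T} (hu : IsSolution μ T φ u.traj) (r : ℝ) : BoundedAway u r := by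
  have h : ∀ n : ℕ, BoundedAway u (1 + n * (1 / 4)) := by
    intro n
    induction n with
    | zero => simpa using boundedAway_one (by linarith) u
    | succ n ih =>
      have h1 := (ih.hasEnvelope hμ hs hT (by have : (0 : ℝ) ≤ n := by positivity
                                              linarith) hu).boundedAway hs hu
      refine h1.mono (le_of_eq ?_)
      push_cast; ring
  obtain ⟨n, hn⟩ := exists_nat_ge (4 * r)
  exact (h n).mono (by linarith)

theorem hasEnvelope_all {μ : ℝ} (hμ : 0 < μ) {s T : ℝ} (hs : 1 / 2 < s) (hT : T ≤ 1)
    {φ : L2} {u : XSpace s T} (hu : IsSolution μ T φ u.traj) {r : ℝ} (hr : 2 ≤ r) :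
    HasEnvelope μ φ u r := by
  have h := (boundedAway_all hμ hs hT hu (r - 1 / 4)).hasEnvelope hμ hs hT (by linarith) hu
  rwa [sub_add_cancel] at h

theorem continuousOn_rhs {μ s T : ℝ} (hs : 1 / 2 < s) (hT : 0 ≤ T) (φ : L2) (u : XSpace s T)
    (ξ : ℝ) : ContinuousOn (fun t => rhs μ φ u t ξ) (Icc 0 T) :=
  ((by fun_prop : Continuous fun t : ℝ => Real.exp (t * symb μ ξ)).continuousOn.smul
    continuousOn_const).add ((isSource_src (by linarith) hT u u).continuousOn_duh
      (by linarith [sing_lt hs]) hT μ ξ)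

theorem Icc_mem_nhdsWithin {T t : ℝ} (ht : 0 < t) {A : Set ℝ} (hA : A ⊆ Iic T) :
    Icc (t / 2) T ∈ 𝓝[A] t := by
  have : Ioi (t / 2) ∈ 𝓝 t := Ioi_mem_nhds (by linarith)
  filter_upwards [self_mem_nhdsWithin, mem_nhdsWithin_of_mem_nhds this] with x h1 h2
  exact ⟨le_of_lt h2, hA h1⟩

theorem continuousInHInfty {μ : ℝ} (hμ : 0 < μ) {s T : ℝ} (hs : 1 / 2 < s) (hT : T ≤ 1)
    {φ : L2} {u : XSpace s T} (hu : IsSolution μ T φ u.traj) : ContinuousInHInfty T u.traj := by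
  intro r
  constructor
  · intro t ht
    obtain ⟨K, -, hK⟩ := boundedAway_all hμ hs hT hu r t ht
    exact (hK t ⟨le_rfl, ht.2⟩).trans_lt ENNReal.ofReal_lt_top
  · intro t₀ ht₀
    have hsub : Icc (t₀ / 2) T ⊆ Icc 0 T := Icc_subset_Icc_left (by linarith [ht₀.1])
    obtain ⟨G, hG, hb⟩ := hasEnvelope_all hμ hs hT hu (le_max_right r 2) (t₀ / 2)
      ⟨by linarith [ht₀.1], by linarith [ht₀.1, ht₀.2]⟩
    have h := tendsto_wN_sub (A := Icc (t₀ / 2) T) (w := u.traj)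
      (W := fun ξ => (1 + ξ ^ 2) ^ (max r 2 / 2)) (by fun_prop)
      (fun t ht => hat_eq_rhs hs hu (hsub ht))
      (fun ξ => (continuousOn_rhs hs (ht₀.1.le.trans ht₀.2) φ u ξ).mono hsub) hG
      (fun t ht => ae_of_all _ (hb t ht)) ⟨by linarith [ht₀.1], ht₀.2⟩
    have h2 := h.mono_left (nhdsWithin_le_of_mem (Icc_mem_nhdsWithin ht₀.1 (fun x hx => hx.2)) :
      𝓝[Ioc 0 T] t₀ ≤ _)
    exact tendsto_of_tendsto_of_tendsto_of_le_of_le tendsto_const_nhds h2 (fun _ => zero_le)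
      fun t => sobNorm_mono (le_max_left r 2) _

/-! ### Differentiability of curves in `L²` -/

/-- The Fourier transform as a map from real to complex `L²`. -/
noncomputable def hatLp : L2 →L[ℝ] L2C :=
  LinearMap.mkContinuous
    { toFun := fun f => (memLp_hat f).toLp
      map_add' := fun f g => by
        rw [← MemLp.toLp_add]
        exact MemLp.toLp_congr _ _ (hat_add f g)
      map_smul' := fun c f => by
        rw [RingHom.id_apply, ← MemLp.toLp_const_smul]
        exact MemLp.toLp_congr _ _ (hat_smul c f) }
    (√(2 * Real.pi)) fun f => by
      refine le_of_eq ?_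
      change ‖(memLp_hat f).toLp‖ = _
      rw [Lp.norm_toLp, eLpNorm_hat, ENNReal.toReal_mul,
        ENNReal.toReal_ofReal (Real.sqrt_nonneg _), toReal_enorm]

theorem coeFn_hatLp (f : L2) : hatLp f =ᵐ[volume] hat f := (memLp_hat f).coeFn_toLp

theorem norm_hatLp (f : L2) : ‖hatLp f‖ = √(2 * Real.pi) * ‖f‖ := by
  change ‖(memLp_hat f).toLp‖ = _
  rw [Lp.norm_toLp, eLpNorm_hat, ENNReal.toReal_mul,
    ENNReal.toReal_ofReal (Real.sqrt_nonneg _), toReal_enorm]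

/-- By Plancherel, differentiability of a curve in `L²` can be checked on the Fourier side. -/
theorem hasDerivWithinAt_of_hatLp {w : ℝ → L2} {w' : L2} {A : Set ℝ} {t : ℝ}
    (h : HasDerivWithinAt (fun τ => hatLp (w τ)) (hatLp w') A t) : HasDerivWithinAt w w' A t := by
  rw [hasDerivWithinAt_iff_tendsto_slope, tendsto_iff_norm_sub_tendsto_zero] at h ⊢
  have hp : 0 < √(2 * Real.pi) := Real.sqrt_pos.2 two_pi_pos
  have h2 := h.const_mul (√(2 * Real.pi))⁻¹
  rw [mul_zero] at h2
  refine h2.congr fun τ => ?_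
  rw [slope_def_module, slope_def_module, ← map_sub, ← map_smul, ← map_sub, norm_hatLp,
    inv_mul_cancel_left₀ hp.ne']

/-- A curve in `L²` is differentiable if it is so pointwise, with the pointwise derivative
dominated by a square-integrable function. -/
theorem hasDerivWithinAt_of_dominated {A : Set ℝ} (hA : Convex ℝ A) {t : ℝ} (ht : t ∈ A)
    {F F' : ℝ → ℝ → ℂ} {G : ℝ → ℝ} (hG : MemLp G 2)
    (hF : ∀ ξ, ∀ τ ∈ A, HasDerivWithinAt (fun τ => F τ ξ) (F' τ ξ) A τ)
    (hb : ∀ τ ∈ A, ∀ ξ, ‖F' τ ξ‖ ≤ G ξ) {f : ℝ → L2C} {f' : L2C}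
    (hf : ∀ τ ∈ A, f τ =ᵐ[volume] F τ) (hf' : f' =ᵐ[volume] F' t) :
    HasDerivWithinAt f f' A t := by
  rw [hasDerivWithinAt_iff_tendsto_slope, tendsto_iff_edist_tendsto_0]
  have hslope : ∀ τ ∈ A, ⇑(slope f t τ) - ⇑f' =ᵐ[volume]
      fun ξ => slope (fun τ => F τ ξ) t τ - F' t ξ := by
    intro τ hτ
    have h1 := Lp.coeFn_smul (τ - t)⁻¹ (f τ - f t)
    have h2 := Lp.coeFn_sub (f τ) (f t)
    filter_upwards [h1, h2, hf τ hτ, hf t ht, hf'] with ξ e1 e2 e3 e4 e5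
    rw [Pi.sub_apply, slope_def_module, slope_def_module, e1, Pi.smul_apply, e2, Pi.sub_apply, e3,
      e4, e5]
  have h : Tendsto (fun τ => eLpNorm (fun ξ => slope (fun τ => F τ ξ) t τ - F' t ξ) 2 volume)
      (𝓝[A \ {t}] t) (𝓝 0) := by
    refine tendsto_eLpNorm_of_dominated (G := fun ξ => 2 * G ξ) (hG.const_mul 2) ?_ ?_ ?_
    · filter_upwards [self_mem_nhdsWithin] with τ hτ
      exact ((Lp.aestronglyMeasurable _).sub (Lp.aestronglyMeasurable _)).congr (hslope τ hτ.1)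
    · filter_upwards [self_mem_nhdsWithin] with τ hτ
      refine ae_of_all _ fun ξ => ?_
      rw [two_mul]
      refine (norm_sub_le _ _).trans (add_le_add ?_ (hb t ht ξ))
      have h1 := hA.norm_image_sub_le_of_norm_hasDerivWithin_le (hF ξ) (fun x hx => hb x hx ξ) ht
        hτ.1
      have h0 : 0 < ‖τ - t‖ := norm_pos_iff.2 (sub_ne_zero.2 hτ.2)
      rw [slope_def_module, norm_smul, norm_inv, inv_mul_le_iff₀ h0, mul_comm]
      exact h1
    · refine ae_of_all _ fun ξ => ?_
      have := (hasDerivWithinAt_iff_tendsto_slope.1 (hF ξ t ht)).sub_const (F' t ξ)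
      rwa [sub_self] at this
  refine h.congr' ?_
  filter_upwards [self_mem_nhdsWithin] with τ hτ
  rw [Lp.edist_def, eLpNorm_congr_ae (hslope τ hτ.1)]

/-! ### The differential equation -/

theorem HasWeakDeriv.sub {f g f' g' : L2} (hf : HasWeakDeriv f f') (hg : HasWeakDeriv g g') :
    HasWeakDeriv (f - g) (f' - g') := by
  have := hf.add (hg.smul (-1))
  rwa [neg_one_smul, neg_one_smul, ← sub_eq_add_neg, ← sub_eq_add_neg] at this

theorem continuousOn_vel {μ : ℝ} (hμ : 0 < μ) {s T : ℝ} (hs : 1 / 2 < s) (hT : T ≤ 1)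
    {φ : L2} {u : XSpace s T} (hu : IsSolution μ T φ u.traj) : ContinuousOn u.vel (Ioc 0 T) := by
  intro t ht
  have h := (continuousInHInfty hμ hs hT hu 1).2 t ht
  rw [ContinuousWithinAt, tendsto_iff_edist_tendsto_0]
  refine tendsto_of_tendsto_of_tendsto_of_le_of_le' tendsto_const_nhds h
    (Eventually.of_forall fun _ => zero_le) ?_
  filter_upwards [self_mem_nhdsWithin] with τ hτ
  rw [edist_eq_enorm_sub]
  have h1 := ((u.hasWeakDeriv_vel hτ).sub (u.hasWeakDeriv_vel ht)).enorm_eq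
  exact (le_mul_of_one_le_left (by simp) sqrt_two_pi_le).trans
    (h1.le.trans (wN_id_le_sobNorm le_rfl _))

theorem continuousOn_src {μ : ℝ} (hμ : 0 < μ) {s T : ℝ} (hs : 1 / 2 < s) (hT : T ≤ 1)
    {φ : L2} {u : XSpace s T} (hu : IsSolution μ T φ u.traj) (ξ : ℝ) :
    ContinuousOn (fun τ => src u u τ ξ) (Ioc 0 T) := by
  have h := continuousOn_vel hμ hs hT hu
  have hcomp : ∀ {p : ℝ → L2 × L2 × ℝ} {g : L2 × L2 × ℝ → ℂ}, ContinuousOn p (Ioc 0 T) →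
      Continuous g → ContinuousOn (fun τ => g (p τ)) (Ioc 0 T) :=
    fun hp hg => hg.comp_continuousOn hp
  exact hcomp (h.prodMk (h.prodMk continuousOn_const)) continuous_prodHat

theorem hasDerivWithinAt_duh {T K b m : ℝ} {h : ℝ → ℝ → ℂ} (hh : IsSource T K b m h) (hb : b < 1)
    (μ : ℝ) {c t ξ : ℝ} (hc : 0 < c) (ht : t ∈ Icc c T)
    (hcont : ContinuousOn (fun τ => h τ ξ) (Ioc 0 T)) :
    HasDerivWithinAt (fun t => duh μ h t ξ) (symb μ ξ • duh μ h t ξ + (1 / 2 : ℝ) • h t ξ)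
      (Icc c T) t := by
  have hint := hh.intervalIntegrable hb ⟨hc.le.trans ht.1, ht.2⟩ ξ
    (g := fun τ => Real.exp (-τ * symb μ ξ)) (by fun_prop)
  have hI : ContinuousOn (fun τ => Real.exp (-τ * symb μ ξ) • h τ ξ) (Icc c T) :=
    ((by fun_prop : Continuous fun τ : ℝ => Real.exp (-τ * symb μ ξ)).continuousOn.smul hcont).mono
      fun x hx => ⟨hc.trans_le hx.1, hx.2⟩
  have : Fact (t ∈ Icc c T) := ⟨ht⟩
  have h1 : HasDerivWithinAt (fun x => ∫ τ in (0 : ℝ)..x, Real.exp (-τ * symb μ ξ) • h τ ξ)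
      (Real.exp (-t * symb μ ξ) • h t ξ) (Icc c T) t :=
    intervalIntegral.integral_hasDerivWithinAt_right hint
      (hI.stronglyMeasurableAtFilter_nhdsWithin measurableSet_Icc t) (hI t ht)
  have h2 : HasDerivWithinAt (fun t : ℝ => Real.exp (t * symb μ ξ))
      (Real.exp (t * symb μ ξ) * symb μ ξ) (Icc c T) t :=
    (((hasDerivAt_id t).mul_const (symb μ ξ)).exp.congr_deriv (by simp)).hasDerivWithinAt
  have h3 := (h2.smul h1).const_smul (1 / 2 : ℝ)
  have e : (fun t => duh μ h t ξ) = fun t => (1 / 2 : ℝ) • (Real.exp (t * symb μ ξ) •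
      ∫ τ in (0 : ℝ)..t, Real.exp (-τ * symb μ ξ) • h τ ξ) := funext fun t => duh_eq μ h t ξ
  rw [e]
  refine h3.congr_deriv ?_
  rw [duh_eq, smul_add, smul_smul (Real.exp (t * symb μ ξ)), ← Real.exp_add, add_comm]
  congr 1
  · simp only [Complex.real_smul]; push_cast; ring
  · simp

theorem hasDerivWithinAt_rhs {μ : ℝ} (hμ : 0 < μ) {s T : ℝ} (hs : 1 / 2 < s) (hT : T ≤ 1)
    {φ : L2} {u : XSpace s T} (hu : IsSolution μ T φ u.traj) {c t : ℝ} (hc : 0 < c)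
    (ht : t ∈ Icc c T) (ξ : ℝ) :
    HasDerivWithinAt (fun t => rhs μ φ u t ξ)
      (symb μ ξ • rhs μ φ u t ξ + (1 / 2 : ℝ) • src u u t ξ) (Icc c T) t := by
  have h1 := hasDerivWithinAt_duh
    (isSource_src (by linarith) (hc.le.trans (ht.1.trans ht.2)) u u)
    (by linarith [sing_lt hs]) μ hc ht (continuousOn_src hμ hs hT hu ξ)
  have h2 : HasDerivWithinAt (fun t : ℝ => Real.exp (t * symb μ ξ))
      (Real.exp (t * symb μ ξ) * symb μ ξ) (Icc c T) t :=
    (((hasDerivAt_id t).mul_const (symb μ ξ)).exp.congr_deriv (by simp)).hasDerivWithinAt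
  refine ((h2.smul_const (hat φ ξ)).add h1).congr_deriv ?_
  rw [rhs, smul_add, smul_smul, mul_comm, add_assoc]

theorem abs_symb_le {μ : ℝ} (hμ : 0 < μ) (ξ : ℝ) : |symb μ ξ| ≤ (1 + μ) * (1 + ξ ^ 2) := by
  have h1 : 0 ≤ μ / (1 + ξ ^ 2) ^ (1 / 2 : ℝ) := by have := jap_pos ξ; positivity
  have h2 : μ / (1 + ξ ^ 2) ^ (1 / 2 : ℝ) ≤ μ :=
    div_le_self hμ.le (Real.one_le_rpow (one_le_jap ξ) (by norm_num))
  rw [symb, abs_le]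
  constructor <;> nlinarith [sq_nonneg ξ, mul_nonneg hμ.le (sq_nonneg ξ)]

theorem memLp_src {s T : ℝ} (hs : 0 ≤ s) (hT : 0 ≤ T) (u : XSpace s T) {t K : ℝ}
    (hK : ∀ ξ, ‖src u u t ξ‖ ≤ K * (1 + ξ ^ 2) ^ (-(1 / 2) : ℝ)) : MemLp (src u u t) 2 :=
  ((memLp_jap (r := 1 / 2) (by norm_num)).const_mul K).mono
    (((isSource_src hs hT u u).meas.comp_measurable
      (measurable_const.prodMk measurable_id)).aestronglyMeasurable)
    (ae_of_all _ fun ξ => (hK ξ).trans (le_abs_self _))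

/-- The Bessel potential `(1 - ∂ₓ²)^{-1/2} f` is a real-valued `L²` function. -/
theorem exists_bessel (f : L2) :
    ∃ z : L2, hat z =ᵐ[volume] fun ξ => (1 + ξ ^ 2) ^ (-1 / 2 : ℝ) • hat f ξ := by
  refine exists_hat_eq ?_ ?_
  · refine (memLp_hat f).mono (aestronglyMeasurable_smul_hat (by fun_prop) f)
      (ae_of_all _ fun ξ => ?_)
    have hJ := jap_pos ξ
    rw [norm_smul, Real.norm_of_nonneg (by positivity)]
    exact mul_le_of_le_one_left (norm_nonneg _)
      (Real.rpow_le_one_of_one_le_of_nonpos (one_le_jap ξ) (by norm_num))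
  · filter_upwards [hermitian_hat f] with ξ hξ
    rw [hξ, neg_sq]
    simp [Complex.conj_ofReal]

/-- The transform of the right-hand side of the equation. -/
theorem hat_evolution {μ : ℝ} {f ux uxx z q : L2} (hux : HasWeakDeriv f ux)
    (huxx : HasWeakDeriv ux uxx)
    (hz : hat z =ᵐ[volume] fun ξ => (1 + ξ ^ 2) ^ (-1 / 2 : ℝ) • hat f ξ)
    (hq : hat q =ᵐ[volume] prodHat ux ux) :
    hat (uxx + μ • z + (1 / 2 : ℝ) • q) =ᵐ[volume]
      fun ξ => symb μ ξ • hat f ξ + (1 / 2 : ℝ) • prodHat ux ux ξ := by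
  filter_upwards [hat_add (uxx + μ • z) ((1 / 2 : ℝ) • q), hat_add uxx (μ • z), hat_smul μ z,
    hat_smul (1 / 2 : ℝ) q, (hasWeakDeriv_iff _ _).1 hux, (hasWeakDeriv_iff _ _).1 huxx, hz, hq]
    with ξ h1 h2 h3 h4 h5 h6 h7 h8
  rw [h1, Pi.add_apply, h2, Pi.add_apply, h3, h4, Pi.smul_apply, Pi.smul_apply, h6, h5, h7, h8,
    symb, add_smul, smul_smul]
  congr 2
  · simp only [Complex.real_smul]
    push_cast
    linear_combination (ξ ^ 2 * hat f ξ : ℂ) * Complex.I_sq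
  · rw [neg_div, Real.rpow_neg (jap_pos ξ).le, ← div_eq_mul_inv]

/-- The Duhamel formula implies the differential equation at positive times. -/
theorem solvesPDE {μ : ℝ} (hμ : 0 < μ) {s T : ℝ} (hs : 1 / 2 < s) (hT : T ≤ 1)
    {φ : L2} {u : XSpace s T} (hu : IsSolution μ T φ u.traj) : SolvesPDE μ T u.traj := by
  intro t ht
  have hT0 : 0 ≤ T := ht.1.le.trans ht.2
  have hc : 0 < t / 2 := by linarith [ht.1]
  have hcT : t / 2 ∈ Ioc 0 T := ⟨hc, by linarith [ht.1, ht.2]⟩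
  have htB : t ∈ Icc (t / 2) T := ⟨by linarith [ht.1], ht.2⟩
  have hBI : Icc (t / 2) T ⊆ Icc 0 T := Icc_subset_Icc_left hc.le
  obtain ⟨K, hK0, hK⟩ := (boundedAway_all hμ hs hT hu 2).norm_src_le (by norm_num) hcT
  have hK' : ∀ τ ∈ Icc (t / 2) T, ∀ ξ, ‖src u u τ ξ‖ ≤ K * (1 + ξ ^ 2) ^ (-(1 / 2) : ℝ) := by
    intro τ hτ ξ
    have := hK τ hτ ξ
    norm_num at this ⊢
    exact this
  obtain ⟨G, hG, hGb⟩ := hasEnvelope_all hμ hs hT hu le_rfl (t / 2) hcT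
  have hux := u.hasWeakDeriv_vel ht
  have hxx : HasWeakDeriv (u.vel t) (dx (u.vel t)) := by
    refine hasWeakDeriv_dx ((wN_id_le_sobNorm le_rfl _).trans_lt ?_)
    rw [sobNorm_eq, hux.wN_eq]
    refine lt_of_le_of_lt (wN_mono (fun ξ => ?_) _) ((continuousInHInfty hμ hs hT hu 2).1 t ht)
    have hJ := jap_pos ξ
    rw [abs_mul, abs_of_nonneg (a := (1 + ξ ^ 2) ^ (1 / 2 : ℝ)) (by positivity),
      abs_of_nonneg (a := (1 + ξ ^ 2) ^ (2 / 2 : ℝ)) (by positivity)]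
    calc _ ≤ (1 + ξ ^ 2) ^ (1 / 2 : ℝ) * (1 + ξ ^ 2) ^ (1 / 2 : ℝ) := by
          gcongr; exact abs_le_japanese ξ
      _ = _ := by rw [← Real.rpow_add hJ]; norm_num
  obtain ⟨z, hz⟩ := exists_bessel (u.traj t)
  obtain ⟨q, hq⟩ := exists_hat_eq (memLp_src (by linarith) hT0 u (hK' t htB))
    (ae_of_all _ fun ξ => prodHat_neg (u.vel t) (u.vel t) ξ)
  have hq2 : (fun x => u.vel t x * u.vel t x) =ᵐ[volume] q :=
    (hatL1_ae_eq_hat_iff (integrable_mul _ _) q).1 hq.symm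
  have hev := hat_evolution (μ := μ) hux hxx hz hq
  refine ⟨dx (u.vel t) + μ • z + (1 / 2 : ℝ) • q, u.vel t, dx (u.vel t), z, ?_, hux, hxx, hz, ?_⟩
  · have hGm : MemLp (fun ξ => (1 + μ) * ((1 + ξ ^ 2) ^ (2 / 2 : ℝ) * G ξ) +
        (1 / 2) * (K * (1 + ξ ^ 2) ^ (-(1 / 2) : ℝ))) 2 :=
      (hG.const_mul (1 + μ)).add
        (((memLp_jap (r := 1 / 2) (by norm_num)).const_mul K).const_mul (1 / 2))
    have hd : HasDerivWithinAt u.traj (dx (u.vel t) + μ • z + (1 / 2 : ℝ) • q)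
        (Icc (t / 2) T) t := by
      refine hasDerivWithinAt_of_hatLp (hasDerivWithinAt_of_dominated (convex_Icc _ _) htB hGm
        (F := rhs μ φ u)
        (F' := fun τ ξ => symb μ ξ • rhs μ φ u τ ξ + (1 / 2 : ℝ) • src u u τ ξ)
        (fun ξ τ hτ => hasDerivWithinAt_rhs hμ hs hT hu hc hτ ξ) (fun τ hτ ξ => ?_)
        (fun τ hτ => (coeFn_hatLp _).trans (hat_eq_rhs hs hu (hBI hτ))) ?_)
      · refine (norm_add_le _ _).trans (add_le_add ?_ ?_)
        · rw [norm_smul, Real.norm_eq_abs, div_self two_ne_zero, Real.rpow_one, ← mul_assoc]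
          exact mul_le_mul (abs_symb_le hμ ξ) (hGb τ hτ ξ) (norm_nonneg _)
            (by have := jap_pos ξ; positivity)
        · rw [norm_smul, Real.norm_of_nonneg (by norm_num)]
          exact mul_le_mul_of_nonneg_left (hK' τ hτ ξ) (by norm_num)
      · refine (coeFn_hatLp _).trans ?_
        filter_upwards [hev, hat_eq_rhs hs hu (hBI htB)] with ξ h1 h2
        rw [h1, h2]; rfl
    exact hd.mono_of_mem_nhdsWithin (Icc_mem_nhdsWithin ht.1 fun x hx => hx.2)
  · filter_upwards [Lp.coeFn_add (dx (u.vel t) + μ • z) ((1 / 2 : ℝ) • q),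
      Lp.coeFn_add (dx (u.vel t)) (μ • z), Lp.coeFn_smul μ z, Lp.coeFn_smul (1 / 2 : ℝ) q, hq2]
      with x h1 h2 h3 h4 h5
    rw [h1, Pi.add_apply, h2, Pi.add_apply, h3, h4, Pi.smul_apply, Pi.smul_apply, ← h5]
    simp only [smul_eq_mul, sq]

/-! ### From the differential equation back to the Duhamel formula -/

/-- The time derivative of a solution of the differential equation, on the Fourier side. -/
theorem hat_timeDeriv {μ s T : ℝ} {u : XSpace s T} (hu : SolvesPDE μ T u.traj) {t : ℝ}
    (ht : t ∈ Ioc 0 T) : ∃ ut : L2, HasDerivWithinAt u.traj ut (Icc 0 T) t ∧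
      hat ut =ᵐ[volume] fun ξ => symb μ ξ • hat (u.traj t) ξ + (1 / 2 : ℝ) • src u u t ξ := by
  obtain ⟨ut, ux, uxx, z, hd, hux, huxx, hz, he⟩ := hu t ht
  have e : ux = u.vel t := hux.unique (u.hasWeakDeriv_vel ht)
  subst e
  refine ⟨ut, hd, ?_⟩
  -- `(∂ₓu)²` is in `L²` because it is what the equation leaves for it
  set q : L2 := (2 : ℝ) • (ut - (uxx + μ • z)) with hq
  have hut : ut = uxx + μ • z + (1 / 2 : ℝ) • q := by
    rw [hq, smul_smul]; norm_num
  have hqx : (fun x => u.vel t x * u.vel t x) =ᵐ[volume] q := by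
    filter_upwards [he, Lp.coeFn_smul (2 : ℝ) (ut - (uxx + μ • z)),
      Lp.coeFn_sub ut (uxx + μ • z), Lp.coeFn_add uxx (μ • z), Lp.coeFn_smul μ z]
      with x h1 h2 h3 h4 h5
    rw [hq, h2, Pi.smul_apply, h3, Pi.sub_apply, h4, Pi.add_apply, h5, Pi.smul_apply, h1]
    simp only [smul_eq_mul]; ring
  rw [hut]
  exact hat_evolution hux huxx hz ((hatL1_ae_eq_hat_iff (integrable_mul _ _) q).2 hqx).symm

theorem integrableOn_smul_hat {A : Set ℝ} (hA : IsCompact A) {w : ℝ → ℝ} (hw : Continuous w)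
    (f : L2) : IntegrableOn (fun ξ => w ξ • hat f ξ) A :=
  (((memLp_hat f).locallyIntegrable (by norm_num)).integrableOn_isCompact hA).continuousOn_smul
    hw.continuousOn hA

/-- A real weight, cut off to a compact set of frequencies. -/
noncomputable def cutoff (A : Set ℝ) (w : ℝ → ℝ) (ξ : ℝ) : ℂ := A.indicator (fun ξ => (w ξ : ℂ)) ξ

theorem norm_cutoff_le {A : Set ℝ} {w : ℝ → ℝ} {M : ℝ} (hM : ∀ ξ ∈ A, |w ξ| ≤ M) (ξ : ℝ) :
    ‖cutoff A w ξ‖ ≤ A.indicator (fun _ => M) ξ := by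
  by_cases hξ : ξ ∈ A
  · rw [cutoff, indicator_of_mem hξ, indicator_of_mem hξ, Complex.norm_real]; exact hM ξ hξ
  · rw [cutoff, indicator_of_notMem hξ, indicator_of_notMem hξ, norm_zero]

theorem memLp_indicator_const_real {A : Set ℝ} (hA : IsCompact A) (M : ℝ) :
    MemLp (A.indicator fun _ => M) 2 :=
  memLp_indicator_const 2 hA.measurableSet M (Or.inr hA.measure_lt_top.ne)

theorem memLp_cutoff {A : Set ℝ} (hA : IsCompact A) {w : ℝ → ℝ} (hw : Continuous w) :
    MemLp (cutoff A w) 2 := by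
  obtain ⟨M, hM⟩ := hA.exists_bound_of_continuousOn hw.continuousOn
  refine (memLp_indicator_const_real hA M).mono
    ((Complex.continuous_ofReal.comp hw).aestronglyMeasurable.indicator hA.measurableSet)
    (ae_of_all _ fun ξ => (norm_cutoff_le hM ξ).trans (le_abs_self _))

theorem inner_cutoff {A : Set ℝ} (hA : IsCompact A) {w : ℝ → ℝ} (hw : Continuous w) (f : L2) :
    inner ℂ ((memLp_cutoff hA hw).toLp : L2C) (hatLp f) = ∫ ξ in A, w ξ • hat f ξ := by
  rw [L2.inner_def, ← integral_indicator hA.measurableSet]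
  refine integral_congr_ae ?_
  filter_upwards [(memLp_cutoff hA hw).coeFn_toLp, coeFn_hatLp f] with ξ h1 h2
  rw [h1, h2]
  by_cases hξ : ξ ∈ A
  · rw [cutoff, indicator_of_mem hξ, indicator_of_mem hξ]
    simp [mul_comm]
  · rw [cutoff, indicator_of_notMem hξ, indicator_of_notMem hξ, inner_zero_left]

/-- The propagator `e^{(t-τ)Φ}` cut off to a compact set of frequencies is a differentiable curve
in `L²`. -/
theorem hasDerivWithinAt_propagator {A : Set ℝ} (hA : IsCompact A) (μ : ℝ) {t τ : ℝ}
    (hτ : τ ∈ Icc 0 t)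
    (hE : ∀ τ : ℝ, Continuous fun ξ => Real.exp ((t - τ) * symb μ ξ))
    (hE' : ∀ τ : ℝ, Continuous fun ξ => -symb μ ξ * Real.exp ((t - τ) * symb μ ξ)) :
    HasDerivWithinAt (fun τ => ((memLp_cutoff hA (hE τ)).toLp : L2C))
      (memLp_cutoff hA (hE' τ)).toLp (Icc 0 t) τ := by
  obtain ⟨M, hM⟩ := hA.exists_bound_of_continuousOn (continuous_symb μ).continuousOn
  refine hasDerivWithinAt_of_dominated (convex_Icc _ _) hτ
    (G := A.indicator fun _ => M * Real.exp (t * M)) (memLp_indicator_const_real hA _)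
    (F := fun τ => cutoff A fun ξ => Real.exp ((t - τ) * symb μ ξ))
    (F' := fun τ => cutoff A fun ξ => -symb μ ξ * Real.exp ((t - τ) * symb μ ξ))
    (fun ξ σ _ => ?_) (fun σ hσ ξ => norm_cutoff_le (fun ξ hξ => ?_) ξ)
    (fun σ _ => (memLp_cutoff hA (hE σ)).coeFn_toLp) (memLp_cutoff hA (hE' τ)).coeFn_toLp
  · by_cases hξ : ξ ∈ A
    · simp only [cutoff, indicator_of_mem hξ]
      have h : HasDerivAt (fun σ : ℝ => Real.exp ((t - σ) * symb μ ξ))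
          (-symb μ ξ * Real.exp ((t - σ) * symb μ ξ)) σ :=
        ((((hasDerivAt_id σ).const_sub t).mul_const (symb μ ξ)).exp).congr_deriv (by simp; ring)
      exact h.ofReal_comp.hasDerivWithinAt
    · simp only [cutoff, indicator_of_notMem hξ]
      exact hasDerivWithinAt_const _ _ _
  · have h1 : |symb μ ξ| ≤ M := hM ξ hξ
    rw [abs_mul, abs_neg, abs_of_nonneg (Real.exp_pos _).le]
    refine mul_le_mul h1 (Real.exp_le_exp.2 ?_) (Real.exp_pos _).le ((abs_nonneg _).trans h1)
    calc (t - σ) * symb μ ξ ≤ (t - σ) * M :=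
          mul_le_mul_of_nonneg_left ((le_abs_self _).trans h1) (by linarith [hσ.2])
      _ ≤ t * M := mul_le_mul_of_nonneg_right (by linarith [hσ.1]) ((abs_nonneg _).trans h1)

theorem integrable_propagated_source {T K b m : ℝ} {h : ℝ → ℝ → ℂ} (hh : IsSource T K b m h)
    (hb : b < 1) (hm : 0 ≤ m) (μ : ℝ) {t : ℝ} (ht : t ∈ Icc 0 T) {A : Set ℝ} (hA : IsCompact A) :
    Integrable (Function.uncurry fun τ ξ => Real.exp ((t - τ) * symb μ ξ) • h τ ξ)
      ((volume.restrict (Ioc 0 t)).prod (volume.restrict A)) := by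
  obtain ⟨M, hM⟩ := hA.exists_bound_of_continuousOn (continuous_symb μ).continuousOn
  have h1 : IntegrableOn (fun τ : ℝ => |K| * τ ^ (-b)) (Ioc 0 t) :=
    (intervalIntegrable_iff_integrableOn_Ioc_of_le ht.1).1
      ((intervalIntegral.intervalIntegrable_rpow' (by linarith)).const_mul _)
  have h2 : IntegrableOn (fun _ : ℝ => Real.exp (t * M)) A := integrableOn_const hA.measure_lt_top.ne
  refine (Integrable.mul_prod h1 h2).mono' ?_ ?_
  · have hs := continuous_symb μ
    have : Continuous fun p : ℝ × ℝ => Real.exp ((t - p.1) * symb μ p.2) := by fun_prop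
    exact (this.stronglyMeasurable.smul hh.meas).aestronglyMeasurable
  · rw [Measure.prod_restrict]
    filter_upwards [ae_restrict_mem (measurableSet_Ioc.prod hA.measurableSet)] with p hp
    have hτ := hp.1
    have hξ : |symb μ p.2| ≤ M := hM _ hp.2
    have hb' := hh.bound p.1 ⟨hτ.1, hτ.2.trans ht.2⟩ p.2
    have hp0 : 0 ≤ p.1 ^ (-b) := Real.rpow_nonneg hτ.1.le _
    have hJ : (1 + p.2 ^ 2) ^ (-(m / 2)) ≤ 1 :=
      Real.rpow_le_one_of_one_le_of_nonpos (one_le_jap _) (by linarith)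
    have hJ0 : 0 ≤ (1 + p.2 ^ 2) ^ (-(m / 2)) := Real.rpow_nonneg (jap_pos _).le _
    simp only [Function.uncurry]
    rw [norm_smul, Real.norm_of_nonneg (Real.exp_pos _).le, mul_comm]
    refine mul_le_mul ?_ (Real.exp_le_exp.2 ?_) (Real.exp_pos _).le (by positivity)
    · calc _ ≤ K * p.1 ^ (-b) * (1 + p.2 ^ 2) ^ (-(m / 2)) := hb'
        _ ≤ |K| * p.1 ^ (-b) * (1 + p.2 ^ 2) ^ (-(m / 2)) := by gcongr; exact le_abs_self K
        _ ≤ |K| * p.1 ^ (-b) * 1 := by gcongr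
        _ = _ := mul_one _
    · calc (t - p.1) * symb μ p.2 ≤ (t - p.1) * M :=
            mul_le_mul_of_nonneg_left ((le_abs_self _).trans hξ) (by linarith [hτ.2])
        _ ≤ t * M := mul_le_mul_of_nonneg_right (by linarith [hτ.1]) ((abs_nonneg _).trans hξ)

theorem duh_eq_setIntegral (μ : ℝ) (h : ℝ → ℝ → ℂ) {t : ℝ} (ht : 0 ≤ t) (ξ : ℝ) :
    duh μ h t ξ = (1 / 2 : ℝ) • ∫ τ in Ioc 0 t, Real.exp ((t - τ) * symb μ ξ) • h τ ξ := by
  rw [duh, intervalIntegral.integral_of_le ht]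

/-- The Duhamel formula integrated over a compact set of frequencies. -/
theorem setIntegral_hat_eq {μ s T : ℝ} (hs : 1 / 2 < s) {u : XSpace s T}
    (hu : SolvesPDE μ T u.traj) {t : ℝ} (ht : t ∈ Ioc 0 T) {A : Set ℝ} (hA : IsCompact A) :
    ∫ ξ in A, duh μ (src u u) t ξ = (∫ ξ in A, hat (u.traj t) ξ) -
      ∫ ξ in A, Real.exp (t * symb μ ξ) • hat (u.traj 0) ξ := by
  have hT : 0 ≤ T := ht.1.le.trans ht.2
  have hsm := continuous_symb μ
  have hE : ∀ τ : ℝ, Continuous fun ξ => Real.exp ((t - τ) * symb μ ξ) := fun τ => by fun_prop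
  have hE' : ∀ τ : ℝ, Continuous fun ξ => -symb μ ξ * Real.exp ((t - τ) * symb μ ξ) :=
    fun τ => by fun_prop
  have hint := integrable_propagated_source (isSource_src (by linarith) hT u u)
    (by linarith [sing_lt hs]) (dec_nonneg s) μ ⟨ht.1.le, ht.2⟩ hA
  set c : ℝ → L2C := fun τ => (memLp_cutoff hA (hE τ)).toLp with hc
  set Y : ℝ → ℂ := fun τ => inner ℂ (c τ) (hatLp (u.traj τ)) with hY
  have hcd : ∀ τ ∈ Icc 0 t, HasDerivWithinAt c (memLp_cutoff hA (hE' τ)).toLp (Icc 0 t) τ :=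
    fun τ hτ => hasDerivWithinAt_propagator hA μ hτ hE hE'
  have hYc : ContinuousOn Y (Icc 0 t) := by
    refine ContinuousOn.inner (𝕜 := ℂ) (fun τ hτ => (hcd τ hτ).continuousWithinAt) ?_
    exact hatLp.continuous.comp_continuousOn
      ((u.continuousOn_traj (by linarith)).mono (Icc_subset_Icc_right ht.2))
  have hYd : ∀ τ ∈ Ioo 0 t, HasDerivAt Y
      ((1 / 2 : ℝ) • ∫ ξ in A, Real.exp ((t - τ) * symb μ ξ) • src u u τ ξ) τ := by
    intro τ hτ
    have hτT : τ ∈ Ioc 0 T := ⟨hτ.1, hτ.2.le.trans ht.2⟩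
    obtain ⟨ut, hd, hut⟩ := hat_timeDeriv hu hτT
    have h1 : HasDerivAt c (memLp_cutoff hA (hE' τ)).toLp τ :=
      (hcd τ ⟨hτ.1.le, hτ.2.le⟩).hasDerivAt (Icc_mem_nhds hτ.1 hτ.2)
    have h2 : HasDerivAt (fun τ => hatLp (u.traj τ)) (hatLp ut) τ :=
      hatLp.hasFDerivAt.comp_hasDerivAt τ
        (hd.hasDerivAt (Icc_mem_nhds hτ.1 (hτ.2.trans_le ht.2)))
    refine (h1.inner ℂ h2).congr_deriv ?_
    rw [hc, inner_cutoff hA (hE τ), inner_cutoff hA (hE' τ), ← integral_add (integrableOn_smul_hat hA (hE τ) ut)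
      (integrableOn_smul_hat hA (hE' τ) _), ← integral_smul]
    refine integral_congr_ae ?_
    filter_upwards [ae_restrict_of_ae hut] with ξ hξ
    rw [hξ]
    simp only [Complex.real_smul]
    push_cast; ring
  have hYi : IntegrableOn (fun τ => (1 / 2 : ℝ) •
      ∫ ξ in A, Real.exp ((t - τ) * symb μ ξ) • src u u τ ξ) (Ioc 0 t) :=
    (Integrable.integral_prod_left hint).smul (1 / 2 : ℝ)
  have hftc := intervalIntegral.integral_eq_sub_of_hasDerivAt_of_le ht.1.le hYc hYd
    ((intervalIntegrable_iff_integrableOn_Ioc_of_le ht.1.le).2 hYi)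
  have hYt : Y t = ∫ ξ in A, hat (u.traj t) ξ := by
    simp only [hY, hc]; rw [inner_cutoff hA (hE t)]; simp
  have hY0 : Y 0 = ∫ ξ in A, Real.exp (t * symb μ ξ) • hat (u.traj 0) ξ := by
    simp only [hY, hc]; rw [inner_cutoff hA (hE 0)]; simp
  rw [hYt, hY0, intervalIntegral.integral_of_le ht.1.le, integral_smul,
    integral_integral_swap hint, ← integral_smul] at hftc
  rw [← hftc]
  exact integral_congr_ae (ae_of_all _ fun ξ => duh_eq_setIntegral μ _ ht.1.le ξ)

/-- The differential equation implies the Duhamel formula. -/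
theorem isSolution_of_solvesPDE {μ s T : ℝ} (hs : 1 / 2 < s) {φ : L2} {u : XSpace s T}
    (h0 : u.traj 0 = φ) (hu : SolvesPDE μ T u.traj) : IsSolution μ T φ u.traj := by
  refine (isSolution_iff hs φ u).2 fun t ht => ?_
  rcases ht.1.eq_or_lt with h | h
  · refine ae_of_all _ fun ξ => ?_
    simp only [← h, h0, duh_zero]; simp
  have htT : t ∈ Ioc 0 T := ⟨h, ht.2⟩
  have hsm := continuous_symb μ
  have hduh : ∀ {A : Set ℝ}, IsCompact A → IntegrableOn (duh μ (src u u) t) A := fun hA => by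
    have hint := integrable_propagated_source
      (isSource_src (by linarith) (ht.1.trans ht.2) u u)
      (by linarith [sing_lt hs]) (dec_nonneg s) μ ht hA
    refine ((Integrable.integral_prod_right hint).smul (1 / 2 : ℝ)).congr
      (ae_of_all _ fun ξ => (duh_eq_setIntegral μ _ ht.1 ξ).symm)
  have hexp : ∀ {A : Set ℝ}, IsCompact A →
      IntegrableOn (fun ξ => Real.exp (t * symb μ ξ) • hat φ ξ) A := fun hA =>
    integrableOn_smul_hat hA (by fun_prop) φ
  have hhat : ∀ {A : Set ℝ}, IsCompact A → IntegrableOn (hat (u.traj t)) A := fun hA =>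
    ((memLp_hat _).locallyIntegrable (by norm_num)).integrableOn_isCompact hA
  have hz : (fun ξ => hat (u.traj t) ξ - Real.exp (t * symb μ ξ) • hat φ ξ -
      duh μ (src u u) t ξ) =ᵐ[volume] 0 := by
    refine ae_eq_zero_of_forall_setIntegral_isCompact_eq_zero' ?_ fun A hA => ?_
    · exact locallyIntegrable_iff.2 fun A hA => ((hhat hA).sub (hexp hA)).sub (hduh hA)
    · have h1 : IntegrableOn (fun ξ => hat (u.traj t) ξ - Real.exp (t * symb μ ξ) • hat φ ξ) A :=
        (hhat hA).sub (hexp hA)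
      rw [integral_sub h1 (hduh hA), integral_sub (hhat hA) (hexp hA),
        setIntegral_hat_eq hs hu htT hA, h0, sub_self]
  filter_upwards [hz] with ξ hξ
  have : hat (u.traj t) ξ - Real.exp (t * symb μ ξ) • hat φ ξ - duh μ (src u u) t ξ = 0 := hξ
  linear_combination this

/-! ### Persistence of regularity -/

theorem sing_anti {s s' : ℝ} (h : s ≤ s') : sing s' ≤ sing s :=
  max_le_max (by linarith) le_rfl

/-- A solution in `X_T^s` with data in `H^{s'}` lies in `X_T^{s'}`, if `s' < s + 1/2 - (1-s)₊`. -/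
theorem exists_smoother {μ : ℝ} (hμ : 0 < μ) {s s' T : ℝ} (hs : 1 / 2 < s) (hs0 : 0 ≤ s')
    (hs' : s' < s + 1 / 2 - sing s) (hT : T ∈ Ioc (0 : ℝ) 1) {φ : L2}
    (hφ : (sobNorm s').toFun φ < ⊤) {u : XSpace s T} (hu : IsSolution μ T φ u.traj) :
    ∃ w : XSpace s' T, w.traj = u.traj := by
  obtain ⟨γ, C, -, -, h⟩ := exists_linear_solution hμ hs hs0 hs'
  obtain ⟨w, hw, -⟩ := h T hT φ _ (src u u) hφ
    (mul_nonneg (srcC_pos s).le (by positivity)) (isSource_src (by linarith) hT.1.le u u)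
  refine ⟨w, funext fun t => ?_⟩
  by_cases ht : t ∈ Icc 0 T
  · exact hat_injective ((hw t ht).trans ((isSolution_iff hs φ u).1 hu t ht).symm)
  · rw [w.traj_of_notMem ht, u.traj_of_notMem ht]

/-- A solution in `X_T^s` with data in `H^{s'}` lies in `X_T^{s'}`: a fixed fraction of a
derivative is gained in each of finitely many steps. -/
theorem exists_persistent {μ : ℝ} (hμ : 0 < μ) {s s' T : ℝ} (hs : 1 / 2 < s) (hs' : s < s')
    (hT : T ∈ Ioc (0 : ℝ) 1) {φ : L2} (hφ : (sobNorm s').toFun φ < ⊤) {u : XSpace s T}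
    (hu : IsSolution μ T φ u.traj) : ∃ w : XSpace s' T, w.traj = u.traj := by
  set δ := (1 / 2 - sing s) / 2 with hδ
  have hδ0 : 0 < δ := by linarith [sing_lt hs]
  have h : ∀ n : ℕ, ∃ σ, σ = min s' (s + n * δ) ∧ ∃ w : XSpace σ T, w.traj = u.traj := by
    intro n
    induction n with
    | zero => exact ⟨s, by simp [hs'.le], u, rfl⟩
    | succ n ih =>
      obtain ⟨σ, hσ, w, hw⟩ := ih
      have hn : 0 ≤ (n : ℝ) * δ := by positivity
      have hσs : s ≤ σ := by rw [hσ]; exact le_min hs'.le (by linarith)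
      have hsing := sing_anti hσs
      have hnext : min s' (s + ((n + 1 : ℕ) : ℝ) * δ) ≤ σ + δ := by
        rw [hσ, ← min_add_add_right]
        refine min_le_min (by linarith) (le_of_eq ?_)
        push_cast; ring
      have hpos : s ≤ min s' (s + ((n + 1 : ℕ) : ℝ) * δ) :=
        le_min hs'.le (by push_cast; nlinarith)
      obtain ⟨w', hw'⟩ := exists_smoother hμ (s' := min s' (s + ((n + 1 : ℕ) : ℝ) * δ))
        (hs.trans_le hσs) (by linarith) (by linarith) hT
        ((sobNorm_mono (min_le_left _ _) φ).trans_lt hφ) (u := w) (by rw [hw]; exact hu)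
      exact ⟨_, rfl, w', hw'.trans hw⟩
  obtain ⟨n, hn⟩ := exists_nat_ge ((s' - s) / δ)
  obtain ⟨σ, hσ, w, hw⟩ := h n
  have e : σ = s' := by
    rw [hσ]
    refine min_eq_left ?_
    rw [div_le_iff₀ hδ0] at hn
    linarith
  subst e
  exact ⟨w, hw⟩

end KS

theorem theorem1p1 (μ : ℝ) (hμ : 0 < μ) (s : ℝ) (hs : 1 / 2 < s) :
    (∀ (T : ℝ) (u : KS.XSpace s T), ‖u.toCont‖ ≤ ‖u‖) ∧
    ∃ T : ℝ → ℝ, ∀ r : ℝ, 0 ≤ r → 0 < T r ∧ T r ≤ 1 ∧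
      ∃ ρ : ℝ, r < ρ ∧ ∃ S : KS.Sob s → KS.XSpace s (T r),
        ContDiffOn ℝ ∞ S (Metric.ball 0 ρ) ∧
        ∀ φ ∈ Metric.ball (0 : KS.Sob s) ρ,
          KS.IsSolution μ (T r) φ.toL2 (S φ).traj ∧
          KS.SolvesPDE μ (T r) (S φ).traj ∧
          (∀ u : KS.XSpace s (T r), KS.IsSolution μ (T r) φ.toL2 u.traj → u = S φ) ∧
          (∀ u : KS.XSpace s (T r),
            u.traj 0 = φ.toL2 → KS.SolvesPDE μ (T r) u.traj → u = S φ) ∧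
          KS.ContinuousInHInfty (T r) (S φ).traj ∧
          ∀ s' : ℝ, s < s' → ∀ φ' : KS.Sob s', φ'.toL2 = φ.toL2 →
            ∃ u' : KS.XSpace s' (T r),
              KS.IsSolution μ (T r) φ'.toL2 u'.traj ∧ u'.traj = (S φ).traj := by
  refine ⟨fun T u => KS.norm_toCont_le u, ?_⟩
  obtain ⟨T, hT⟩ := KS.exists_flow hμ hs
  refine ⟨T, fun r hr => ?_⟩
  obtain ⟨hT0, hT1, S, hS, hsol⟩ := hT r hr
  refine ⟨hT0, hT1, r + 1, by linarith, S, hS, fun φ hφ => ?_⟩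
  have hu := hsol φ hφ
  have huniq : ∀ u : KS.XSpace s (T r), KS.IsSolution μ (T r) φ.toL2 u.traj → u = S φ :=
    fun u h => KS.isSolution_unique hμ hs ⟨hT0, hT1⟩ h hu
  refine ⟨hu, KS.solvesPDE hμ hs hT1 hu, huniq,
    fun u h0 h => huniq u (KS.isSolution_of_solvesPDE hs h0 h),
    KS.continuousInHInfty hμ hs hT1 hu, fun s' hs' φ' hφ' => ?_⟩
  have hfin : (KS.sobNorm s').toFun φ.toL2 < ⊤ := hφ' ▸ (KS.sobNorm s').incl_lt_top φ'
  obtain ⟨w, hw⟩ := KS.exists_persistent hμ hs hs' ⟨hT0, hT1⟩ hfin hu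
  exact ⟨w, by rw [hw, hφ']; exact hu, hw⟩
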